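/- There is a universal constant $c$ with the following property. Let $G$ be a finite geometric planar graph (vertices are points of the plane, edges are straight segments, distinct open edges are disjoint and no vertex lies on an open edge) with connected components $C_1,\dots,C_r$, $r\ge 1$, each of which has a vertex incident to the outer face of $G$. For a connected geometric planar graph $H$ let $\partial H$ be the closed counterclockwise tour along the boundary of its outer face, $|\partial H|$ its number of edges ($0$ for a single vertex); the vertex occurrences on $\partial H$ are its corners, and each corner comes with an angular sector, on the side of the outer face, between the preceding and the following edge of the tour (all directions, for a single vertex). For each $i$ let $a_i$ be a corner of $\partial C_i$, the attachment corner of $C_i$; the numbering $C_1,\dots,C_r$, hence the order $a_1,\dots,a_r$, is arbitrary. Let $G^*$ be a connected augmentation of $G$, that is, a connected geometric planar graph obtained from $G$ by adding a smallest set of edges of the visibility graph of $G$ that makes $G$ connected (two vertices are visible if the open segment joining them does not meet $G$). Regard each $a_i$ as a corner of $\partial G^*$; if the sector of $a_i$ is divided by edges of $G^*$, choose any of the resulting corners. Let $\varphi$ be the path on the corners of $\partial G^*$ obtained by splitting $\partial G^*$ at one of the attachment corners $a_b$: it starts and ends at $a_b$ and visits every other corner exactly once. For attachment corners $a_i,a_j$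 let $\varphi(a_i,a_j)$ be the part of $\varphi$ between them (for $a_b$, take its first occurrence), $|\varphi(a_i,a_j)|$ its number of edges, $A(a_i,a_j)$ the set of attachment corners it visits, and $$\sigma_G(a_i,a_j)=|\varphi(a_i,a_j)|+2\sum_{a_t\in A(a_i,a_j)}|\partial C_t|-|\partial C_i|-|\partial C_j| .$$ Then there is a path $R=(\rho_1,\dots,\rho_m)$ of straight segments, from $a_1$ to $a_r$, that visits the corners $a_1,\dots,a_r$ in this order (the edges of $R$ at the vertex of $a_i$ lie in the sector of $a_i$), such that: 1. $G\cup R$ is a geometric planar graph; 2. every component $C_i$ lies to the right of $R$: the vertex of $a_i$ is the only vertex of $C_i$ on $R$, and if it is $\rho_j$ with $1<j<m$, then $\rho_{j+1}$ immediately follows $\rho_{j-1}$ in the clockwise order of the neighbours of $\rho_j$ in $G\cup R$; 3. for each $j\in\{1,\dots,r-1\}$, the subpath of $R$ from $a_j$ to $a_{j+1}$ has at most $c\,\sigma_G(a_j,a_{j+1})$ vertices. -/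

import Mathlib

/-- A graph whose vertices are points of the plane (identified with `ℂ`) and whose edges are
straight-line segments between them: a subgraph of the complete graph on all points. -/
abbrev GeomGraph : Type := (⊤ : SimpleGraph ℂ).Subgraph

namespace GeomGraph

/-- A finite geometric graph is planar if open edges are pairwise disjoint and no vertex lies on
an open edge. -/
structure IsPlanar (G : GeomGraph) : Prop where
  finite : G.verts.Finite
  edges_disjoint : ∀ u w x y : ℂ, G.Adj u w → G.Adj x y → s(u, w) ≠ s(x, y) →
    Disjoint (openSegment ℝ u w) (openSegment ℝ x y)
  vert_notMem : ∀ u w y : ℂ, G.Adj u w → y ∈ G.verts → y ∉ openSegment ℝ u w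

/-- The point set of a geometric graph: all its vertices and all points on its edges. -/
def pointSet (G : GeomGraph) : Set ℂ :=
  G.verts ∪ {z | ∃ u v : ℂ, G.Adj u v ∧ z ∈ segment ℝ u v}

/-- The outer face: all points that lie in an unbounded connected component of the complement. -/
def outerFace (G : GeomGraph) : Set ℂ :=
  {z | z ∈ G.pointSetᶜ ∧ ¬ Bornology.IsBounded (connectedComponentIn G.pointSetᶜ z)}

/-- `C` is a connected component of `G`: a maximal connected subgraph. -/
def IsComponent (G C : GeomGraph) : Prop :=
  Maximal (fun H : GeomGraph => H ≤ G ∧ H.Connected) C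

/-- `G` contains a vertex incident to the outer face of the geometric graph `K`. -/
def TouchesOuterFace (G K : GeomGraph) : Prop :=
  ∃ v ∈ G.verts, v ∈ closure K.outerFace

/-- The angle in `(0, 2π]` by which the ray from `o` through `p` has to be turned
counterclockwise, about `o`, until it passes through `q` (it is `2π` if `q` is on that ray). -/
noncomputable def ccwAngle (o p q : ℂ) : ℝ :=
  if 0 < ((q - o) / (p - o)).arg then ((q - o) / (p - o)).arg
  else ((q - o) / (p - o)).arg + 2 * Real.pi

/-- Among the neighbours of `v` in `G`, the one that follows the neighbour `u` in
counterclockwise order around `v` is `w` (which is `u` itself if `u` is the only neighbour). -/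
def IsCcwSucc (G : GeomGraph) (v u w : ℂ) : Prop :=
  G.Adj v u ∧ G.Adj v w ∧ ∀ x : ℂ, G.Adj v x → ccwAngle v u w ≤ ccwAngle v u x

/-- The edge `uv`, traversed from `u` to `v`, has the outer face immediately to its right. These
are the edge traversals of the counterclockwise tour along the boundary of the outer face. -/
def IsOuterDart (G : GeomGraph) (u v : ℂ) : Prop :=
  G.Adj u v ∧ ∃ ε : ℝ, 0 < ε ∧ ∀ t : ℝ, 0 < t → t < ε →
    (u + v) / 2 - (t : ℂ) * (Complex.I * (v - u)) ∈ G.outerFace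

/-- `|∂C|`: the number of edges (with multiplicity) of the boundary tour `∂C` of a connected
geometric planar graph `C`. It is `0` if `C` is a single vertex. -/
noncomputable def boundaryLength (C : GeomGraph) : ℕ :=
  {d : ℂ × ℂ | C.IsOuterDart d.1 d.2}.ncard

/-- A corner, i.e. an occurrence `pt` of a vertex in a boundary tour, recorded together with the
vertices visited just before and just after it. The corner of a one-vertex graph has
`prev = pt = next`. -/
structure Corner where
  prev : ℂ
  pt : ℂ
  next : ℂ

/-- `c` is a corner of the boundary tour `∂C`. The tour is counterclockwise, so it has the outer
face on its right, and at a vertex entered from `prev` it leaves along the edge that follows the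
edge to `prev` counterclockwise; the angle swept in between is in the outer face. -/
def IsCorner (C : GeomGraph) (c : Corner) : Prop :=
  (C.IsOuterDart c.prev c.pt ∧ C.IsCcwSucc c.pt c.prev c.next) ∨
    (C.verts = {c.pt} ∧ c.prev = c.pt ∧ c.next = c.pt)

/-- The direction from `c.pt` to `z` points into the open angular sector of the corner `c`, which
extends counterclockwise from `c.prev` to `c.next` (the sector of the corner of a one-vertex graph
contains all directions). -/
def Corner.Contains (c : Corner) (z : ℂ) : Prop :=
  z ≠ c.pt ∧ (c.prev = c.pt ∨ ccwAngle c.pt c.prev z < ccwAngle c.pt c.prev c.next)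

/-- The corner `g` (of a supergraph) lies in the corner `a`: same vertex, and the sector of `g` is
part of the sector of `a`. -/
def Corner.LiesIn (g a : Corner) : Prop :=
  g.pt = a.pt ∧ ∀ z : ℂ, g.Contains z → a.Contains z

/-- Two vertices are visible if the open segment joining them does not meet `G`. -/
def Visible (G : GeomGraph) (u v : ℂ) : Prop :=
  u ∈ G.verts ∧ v ∈ G.verts ∧ u ≠ v ∧ Disjoint (openSegment ℝ u v) G.pointSet

/-- `H` arises from `G` by adding edges of the visibility graph of `G`, and `H` is connected. -/
structure IsVisibilityConnection (G H : GeomGraph) : Prop where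
  le : G ≤ H
  verts_eq : H.verts = G.verts
  visible : ∀ u v : ℂ, H.Adj u v → ¬ G.Adj u v → G.Visible u v
  connected : H.Connected

/-- `Gs` is a connected augmentation of `G`: it is planar and arises from `G` by adding a smallest
set of edges of the visibility graph of `G` that makes `G` connected. -/
structure IsConnectedAugmentation (G Gs : GeomGraph) : Prop
    extends IsVisibilityConnection G Gs where
  planar : Gs.IsPlanar
  smallest : ∀ H : GeomGraph, IsVisibilityConnection G H →
    (Gs.edgeSet \ G.edgeSet).ncard ≤ (H.edgeSet \ G.edgeSet).ncard

/-- `φ 0, …, φ m`, with `m = |∂G|`, is the path on the corners of `∂G` obtained by splitting the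
boundary tour `∂G` of the connected geometric planar graph `G` at the corner `b`: it follows the
tour, starts and ends at `b`, and apart from this visits every corner exactly once. -/
structure IsSplitBoundary (G : GeomGraph) (b : Corner) (φ : ℕ → Corner) : Prop where
  start : φ 0 = b
  finish : φ G.boundaryLength = b
  step : ∀ k < G.boundaryLength,
    (φ (k + 1)).prev = (φ k).pt ∧ (φ (k + 1)).pt = (φ k).next
  visits : ∀ c : Corner, G.IsCorner c ↔ ∃ k ≤ G.boundaryLength, φ k = c
  injOn : Set.InjOn φ {k | k < G.boundaryLength}

/-- The index at which the corner `c` first occurs on `φ`. -/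
noncomputable def tourIndex (φ : ℕ → Corner) (c : Corner) : ℕ := sInf {k | φ k = c}

/-- `|φ(u,v)|`: the number of edges of the part of `φ` between the corners `u` and `v`. -/
noncomputable def tourDist (φ : ℕ → Corner) (u v : Corner) : ℕ :=
  Nat.dist (tourIndex φ u) (tourIndex φ v)

open Classical in
/-- `A(u,v)`: the (indices of the) attachment corners `g t` visited by the part of `φ` between
the corners `u` and `v`. -/
noncomputable def visitedBetween {r : ℕ} (φ : ℕ → Corner) (g : Fin r → Corner) (u v : Corner) :
    Finset (Fin r) :=
  Finset.univ.filter fun t => ∃ k ∈ Finset.uIcc (tourIndex φ u) (tourIndex φ v), φ k = g t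

/-- The cost `σ(g i, g j) = |φ(g i, g j)| + 2 ∑_{t ∈ A(g i, g j)} |∂C t| - |∂C i| - |∂C j|`. -/
noncomputable def cost {r : ℕ} (φ : ℕ → Corner) (C : Fin r → GeomGraph) (g : Fin r → Corner)
    (i j : Fin r) : ℤ :=
  (tourDist φ (g i) (g j) : ℤ)
    + 2 * ∑ t ∈ visitedBetween φ g (g i) (g j), ((C t).boundaryLength : ℤ)
    - (C i).boundaryLength - (C j).boundaryLength

/-- Wherever the path `R` passes through the vertex of the corner `a`, it does so inside the
sector of `a`. -/
def StaysInCorner {u v : ℂ} (R : (⊤ : SimpleGraph ℂ).Walk u v) (a : Corner) : Prop :=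
  ∀ k ≤ R.length, R.getVert k = a.pt →
    (0 < k → a.Contains (R.getVert (k - 1))) ∧ (k < R.length → a.Contains (R.getVert (k + 1)))

/-- The component `C` of `G`, with attachment corner `a`, lies to the right of the path `R`:
`a` is the only vertex of `C` on `R`, and where `R` passes through `a` (not as an endpoint), the
next vertex of `R` immediately follows the previous vertex of `R` in the clockwise order of the
neighbours of `a` in `G ∪ R`. -/
def LiesRightOf (G C : GeomGraph) (a : Corner) {u v : ℂ} (R : (⊤ : SimpleGraph ℂ).Walk u v) :
    Prop :=
  {x | x ∈ C.verts ∧ x ∈ R.support} = {a.pt} ∧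
    ∀ k : ℕ, 0 < k → k < R.length → R.getVert k = a.pt →
      IsCcwSucc (G ⊔ R.toSubgraph) a.pt (R.getVert (k + 1)) (R.getVert (k - 1))

end GeomGraph

/-!
The path `R` consists of tracks: the `i`-th track leads from the attachment vertex of `C i` to that
of `C (i + 1)` in a thin neighbourhood of the augmentation `Gs`, following the tour `∂Gs` between
the two attachment corners. The tracks have distinct heights, and tracks of different heights keep
different distances to `Gs`, so they run in parallel and do not meet.

The order in which the attachment corners have to be visited is unrelated to the tour, so tracks
have to get past the attachment corners of other components, and they must do so without separating
these corners from the tracks that still have to reach them. For this a gate is placed at each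
attachment vertex, in the middle of the sector of the attachment corner of `Gs`. A track of height
`h` passes the gate of `C t` on the outside if `t ≤ h`. If `h < t`, it turns towards the component
at the gate, goes around `C t` alone, and continues on the other side of the gate. In doing so it
crosses edges of `Gs`, but no edge of `G`. Around `G` the order of the heights is reversed: inside
the outer levels `10 + 8 * height h` there are inner levels `10 - 8 * height h` (in units of a small
length `ε`), so that a higher track passes outside a lower one near `Gs` and between it and `C t`
near `C t`. At the gate of `C t` only the tracks of heights `t - 1` and `t` meet the attachment
vertex. Seen from the outside, the former arrives on the right hand side of the gate and the latter
leaves on the left hand side, with no edge of `G` between them, so `C t` is to the right of `R`.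

Whether two pieces of tracks meet is decided locally. Every piece is a strip along an edge, an arc
in the sector between two consecutive rays at a vertex, or part of a gate, and in the polar
coordinates `polar` around a vertex these are separated by their angles and radii. The angle `δ`
and the length `ε` of a `Layout` are small enough for this (`exists_layout`), and
`Layout.track_compatible` lists how two pieces can meet. It yields that the concatenation of the
tracks is a path and that `G` together with this path is plane (`Layout.isPlanar_sup`). The outer
face is only used to see that the walk along the face that contains an attachment corner of `C t`
consists of edge traversals counted by `∂(C t)` (`IsOuterDart.succ`, `exists_face_walk`), which
bounds the length of the way around `C t` (`Layout.reach_around`). Hence a track takes a bounded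
number of steps per edge of `∂Gs`, and per edge of the boundaries of the components it goes around;
since the cost counts every visited component twice, and subtracts only the first and the last of
them once, this is at most a constant times the cost (`length_le_cost`).
-/

open Complex (exp I)
open scoped Real

namespace GeomGraph

/-! ### Angles and polar coordinates -/

/-- The unit vector pointing from `v` to `x` (zero if `x = v`). -/
noncomputable def unitDir (v x : ℂ) : ℂ := (x - v) / (‖x - v‖ : ℝ)

/-- The point with polar coordinates `(ψ, s)` around `v`, where the angle `ψ` is measured
counterclockwise from the ray from `v` through `x`. -/
noncomputable def polar (v x : ℂ) (ψ s : ℝ) : ℂ := v + s * exp (ψ * I) * unitDir v x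

lemma norm_unitDir {v x : ℂ} (h : x ≠ v) : ‖unitDir v x‖ = 1 := by
  have : ‖x - v‖ ≠ 0 := norm_ne_zero_iff.2 (sub_ne_zero.2 h)
  simp [unitDir, this]

lemma unitDir_ne_zero {v x : ℂ} (h : x ≠ v) : unitDir v x ≠ 0 := by
  intro h0
  have := norm_unitDir h
  simp [h0] at this

lemma norm_mul_unitDir (v x : ℂ) : (‖x - v‖ : ℂ) * unitDir v x = x - v := by
  by_cases h : x = v
  · simp [h]
  · have : (‖x - v‖ : ℂ) ≠ 0 := by exact_mod_cast norm_ne_zero_iff.2 (sub_ne_zero.2 h)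
    rw [unitDir, mul_div_cancel₀ _ this]

lemma unitDir_swap (v x : ℂ) : unitDir x v = - unitDir v x := by
  rw [unitDir, unitDir, norm_sub_rev v x, ← neg_sub x v, neg_div]

lemma polar_zero_norm (v x : ℂ) : polar v x 0 ‖x - v‖ = x := by
  simp only [polar, Complex.ofReal_zero, zero_mul, Complex.exp_zero, mul_one]
  rw [norm_mul_unitDir]; ring

lemma norm_polar_sub {v x : ℂ} (h : x ≠ v) (ψ s : ℝ) : ‖polar v x ψ s - v‖ = |s| := by
  simp [polar, norm_unitDir h, Complex.norm_exp_ofReal_mul_I]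

lemma polar_ne {v x : ℂ} (h : x ≠ v) {ψ s : ℝ} (hs : 0 < s) : polar v x ψ s ≠ v := by
  intro h0
  have := norm_polar_sub h ψ s
  rw [h0, sub_self, norm_zero] at this
  exact hs.ne' (abs_eq_zero.1 this.symm)

lemma ccwAngle_pos (o p q : ℂ) : 0 < ccwAngle o p q := by
  unfold ccwAngle
  split_ifs with h
  · exact h
  · linarith [Complex.neg_pi_lt_arg ((q - o) / (p - o)), Real.pi_pos]

lemma ccwAngle_le (o p q : ℂ) : ccwAngle o p q ≤ 2 * π := by
  unfold ccwAngle
  split_ifs with h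
  · linarith [Complex.arg_le_pi ((q - o) / (p - o)), Real.pi_pos]
  · linarith

lemma exp_ccwAngle (o p q : ℂ) :
    exp (ccwAngle o p q * I) = exp (((q - o) / (p - o)).arg * I) := by
  unfold ccwAngle
  split_ifs with h
  · rfl
  · push_cast
    rw [add_mul, Complex.exp_add, Complex.exp_two_pi_mul_I, mul_one]

lemma polar_add_two_pi (v x : ℂ) (ψ s : ℝ) : polar v x (ψ + 2 * π) s = polar v x ψ s := by
  simp only [polar]
  push_cast
  rw [add_mul, Complex.exp_add, Complex.exp_two_pi_mul_I, mul_one]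

/-- Polar coordinates around `v` with positive radius are unique, the angle up to less than a full
turn. -/
lemma polar_inj {v x : ℂ} (h : x ≠ v) {ψ ψ' s s' : ℝ} (hs : 0 < s) (hs' : 0 < s')
    (hlt : ψ < ψ' + 2 * π) (hlt' : ψ' < ψ + 2 * π) (he : polar v x ψ s = polar v x ψ' s') :
    ψ = ψ' ∧ s = s' := by
  have hn := congrArg (fun z => ‖z - v‖) he
  simp only [norm_polar_sub h, abs_of_pos hs, abs_of_pos hs'] at hn
  subst hn
  refine ⟨?_, rfl⟩
  have h1 : exp (ψ * I) = exp (ψ' * I) := by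
    have h2 := add_left_cancel he
    have h3 := mul_right_cancel₀ (unitDir_ne_zero h) h2
    exact mul_left_cancel₀ (by exact_mod_cast hs.ne') h3
  rw [Complex.exp_eq_exp_iff_exists_int] at h1
  obtain ⟨n, hn⟩ := h1
  have h2 : (ψ : ℂ) = ψ' + n * (2 * π) := by
    have : (ψ : ℂ) * I = (ψ' + n * (2 * π)) * I := by rw [hn]; ring
    exact mul_right_cancel₀ Complex.I_ne_zero this
  have h3 : ψ = ψ' + n * (2 * π) := by exact_mod_cast h2
  have hp := Real.pi_pos
  have hn1 : (n : ℝ) < 1 := by nlinarith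
  have hn2 : (-1 : ℝ) < n := by nlinarith
  have : n = 0 := by
    have : n < 1 := by exact_mod_cast hn1
    have : -1 < n := by exact_mod_cast hn2
    omega
  simpa [this] using h3

lemma eq_polar {v x : ℂ} (hx : x ≠ v) (z : ℂ) :
    z = polar v x (ccwAngle v x z) ‖z - v‖ := by
  have hx' : (‖x - v‖ : ℂ) ≠ 0 := by exact_mod_cast norm_ne_zero_iff.2 (sub_ne_zero.2 hx)
  have hx0 := sub_ne_zero.2 hx
  have h := Complex.norm_mul_exp_arg_mul_I ((z - v) / (x - v))
  rw [polar, exp_ccwAngle, unitDir]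
  rw [norm_div, Complex.ofReal_div] at h
  have h2 : (z - v) = (‖z - v‖ : ℂ) * exp (((z - v) / (x - v)).arg * I) *
      ((x - v) / (‖x - v‖ : ℝ)) := by
    field_simp at h ⊢
    linear_combination -h
  rw [← h2]; ring

lemma unitDir_polar {v x : ℂ} (hx : x ≠ v) {ψ s : ℝ} (hs : 0 < s) :
    unitDir v (polar v x ψ s) = exp (ψ * I) * unitDir v x := by
  have hs' : (s : ℂ) ≠ 0 := by exact_mod_cast hs.ne'
  rw [unitDir, norm_polar_sub hx, abs_of_pos hs, polar]
  field_simp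
  ring

lemma polar_polar {v x : ℂ} (hx : x ≠ v) {ψ s : ℝ} (hs : 0 < s) (t u : ℝ) :
    polar v (polar v x ψ s) t u = polar v x (ψ + t) u := by
  rw [polar, unitDir_polar hx hs, polar]
  push_cast
  rw [add_mul, Complex.exp_add]
  ring

lemma polar_rebase {v x y : ℂ} (hx : x ≠ v) (hy : y ≠ v) (t u : ℝ) :
    polar v y t u = polar v x (ccwAngle v x y + t) u := by
  conv_lhs => rw [eq_polar hx y]
  exact polar_polar hx (norm_pos_iff.2 (sub_ne_zero.2 hy)) t u

lemma ccwAngle_polar {v x : ℂ} (hx : x ≠ v) {ψ s : ℝ} (hs : 0 < s) (h0 : 0 < ψ)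
    (h1 : ψ ≤ 2 * π) : ccwAngle v x (polar v x ψ s) = ψ := by
  have h := eq_polar hx (polar v x ψ s)
  have h2 := polar_inj hx hs (norm_pos_iff.2 (sub_ne_zero.2 (polar_ne hx hs (ψ := ψ))))
    (by linarith [ccwAngle_pos v x (polar v x ψ s)])
    (by linarith [ccwAngle_le v x (polar v x ψ s)]) h
  exact h2.1.symm

lemma ccwAngle_self {v x : ℂ} (hx : x ≠ v) : ccwAngle v x x = 2 * π := by
  have h := ccwAngle_polar hx (norm_pos_iff.2 (sub_ne_zero.2 hx)) Real.two_pi_pos le_rfl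
  rwa [← zero_add (2 * π), polar_add_two_pi, polar_zero_norm, zero_add] at h

/-- Angles between rays add up, modulo a full turn. -/
lemma ccwAngle_add {v x y z : ℂ} (hx : x ≠ v) (hy : y ≠ v) (hz : z ≠ v) :
    ccwAngle v x y + ccwAngle v y z = ccwAngle v x z ∨
      ccwAngle v x y + ccwAngle v y z = ccwAngle v x z + 2 * π := by
  have hn := norm_pos_iff.2 (sub_ne_zero.2 hz)
  have h1 : z = polar v x (ccwAngle v x y + ccwAngle v y z) ‖z - v‖ := by
    rw [← polar_rebase hx hy, ← eq_polar hy z]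
  have h2 : z = polar v x (ccwAngle v x z) ‖z - v‖ := eq_polar hx z
  by_cases h : ccwAngle v x y + ccwAngle v y z ≤ 2 * π
  · left
    refine (polar_inj hx hn hn ?_ ?_ (h1.symm.trans h2)).1
    · linarith [ccwAngle_pos v x z]
    · linarith [ccwAngle_pos v x y, ccwAngle_pos v y z, ccwAngle_le v x z]
  · right
    push Not at h
    rw [← polar_add_two_pi] at h2
    refine (polar_inj hx hn hn ?_ ?_ (h1.symm.trans h2)).1
    · linarith [ccwAngle_pos v x z, ccwAngle_le v x y, ccwAngle_le v y z]
    · linarith [ccwAngle_pos v x y, ccwAngle_pos v y z, ccwAngle_le v x z]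

lemma eq_ray_of_ccwAngle_eq {v x y : ℂ} (hx : x ≠ v)
    (h : ccwAngle v x y = 2 * π) : y = polar v x 0 ‖y - v‖ := by
  conv_lhs => rw [eq_polar hx y, h, ← zero_add (2 * π), polar_add_two_pi]

/-- A segment between two points with angles `ψ₁ < ψ₂ < ψ₁ + π` around `v` stays in the convex
angular sector between them and touches the bounding rays only in its endpoints. -/
lemma exists_polar_of_mem_segment {v x z : ℂ} {ψ₁ ψ₂ s₁ s₂ : ℝ} (h1 : ψ₁ < ψ₂)
    (h2 : ψ₂ < ψ₁ + π) (hs₁ : 0 < s₁) (hs₂ : 0 < s₂)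
    (hz : z ∈ segment ℝ (polar v x ψ₁ s₁) (polar v x ψ₂ s₂)) :
    ∃ ψ s, z = polar v x ψ s ∧ 0 < s ∧ ψ₁ ≤ ψ ∧ ψ ≤ ψ₂ ∧
      (ψ = ψ₁ → z = polar v x ψ₁ s₁) ∧ (ψ = ψ₂ → z = polar v x ψ₂ s₂) ∧
      (s₁ = s₂ → s ≤ s₁ ∧ (ψ₂ - ψ₁ ≤ 2 * π / 3 → s₁ / 2 ≤ s)) := by
  obtain ⟨a, b, ha, hb, hab, rfl⟩ := hz
  set ω := ψ₂ - ψ₁ with hω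
  have hω0 : 0 < ω := by linarith
  have hωπ : ω < π := by linarith
  have hsin : 0 < Real.sin ω := Real.sin_pos_of_pos_of_lt_pi hω0 hωπ
  set w : ℂ := ((a * s₁ + b * s₂ * Real.cos ω : ℝ) : ℂ) + ((b * s₂ * Real.sin ω : ℝ) : ℂ) * I
    with hw
  have hre : w.re = a * s₁ + b * s₂ * Real.cos ω := by
    simp only [hw, Complex.add_re, Complex.mul_re, Complex.ofReal_re, Complex.ofReal_im,
      Complex.I_re, Complex.I_im]; ring
  have him : w.im = b * s₂ * Real.sin ω := by
    simp only [hw, Complex.add_im, Complex.mul_im, Complex.ofReal_re, Complex.ofReal_im,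
      Complex.I_re, Complex.I_im]; ring
  have hw0 : w ≠ 0 := by
    intro h0
    have e1 := congrArg Complex.im h0
    have e2 := congrArg Complex.re h0
    rw [him] at e1; rw [hre] at e2
    simp only [Complex.zero_im, Complex.zero_re] at e1 e2
    have hb0 : b = 0 := by
      rcases mul_eq_zero.1 e1 with h | h
      · exact (mul_eq_zero.1 h).resolve_right hs₂.ne'
      · exact absurd h hsin.ne'
    rw [hb0] at e2 hab
    have ha1 : a = 1 := by linarith
    rw [ha1] at e2
    linarith
  have harg0 : 0 ≤ w.arg := Complex.arg_nonneg_iff.2 (by rw [him]; positivity)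
  have hargpi := Complex.arg_le_pi w
  have hwn : 0 < ‖w‖ := norm_pos_iff.2 hw0
  have hcos : ‖w‖ * Real.cos w.arg = w.re := Complex.norm_mul_cos_arg w
  have hsn : ‖w‖ * Real.sin w.arg = w.im := Complex.norm_mul_sin_arg w
  have hsub : ‖w‖ * Real.sin (ω - w.arg) = a * s₁ * Real.sin ω := by
    rw [Real.sin_sub]
    have : ‖w‖ * (Real.sin ω * Real.cos w.arg - Real.cos ω * Real.sin w.arg)
      = Real.sin ω * (‖w‖ * Real.cos w.arg) - Real.cos ω * (‖w‖ * Real.sin w.arg) := by ring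
    rw [this, hcos, hsn, hre, him]; ring
  have hargω : w.arg ≤ ω := by
    by_contra hlt
    push Not at hlt
    have h3 : Real.sin (ω - w.arg) < 0 := Real.sin_neg_of_neg_of_neg_pi_lt (by linarith)
      (by linarith)
    have h4 : 0 ≤ a * s₁ * Real.sin ω := by positivity
    nlinarith
  have key : ∀ c : ℂ, a • (c + s₁ * exp (ψ₁ * I) * unitDir v x) + b • (c + s₂ * exp (ψ₂ * I) *
      unitDir v x) = c + exp (ψ₁ * I) * w * unitDir v x := by
    intro c
    have e2 : exp (ψ₂ * I) = exp (ψ₁ * I) * (Real.cos ω + Real.sin ω * I) := by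
      rw [Complex.ofReal_cos, Complex.ofReal_sin, ← Complex.exp_mul_I, ← Complex.exp_add]
      congr 1; rw [hω]; push_cast; ring
    rw [e2, hw]
    have habC : (a : ℂ) + b = 1 := by exact_mod_cast hab
    simp only [Complex.real_smul]
    push_cast
    linear_combination c * habC
  have hpol : a • polar v x ψ₁ s₁ + b • polar v x ψ₂ s₂ = polar v x (ψ₁ + w.arg) ‖w‖ := by
    rw [polar, polar, key, polar]
    have := Complex.norm_mul_exp_arg_mul_I w
    push_cast
    rw [add_mul, Complex.exp_add]
    linear_combination (-exp (ψ₁ * I) * unitDir v x) * this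
  refine ⟨ψ₁ + w.arg, ‖w‖, hpol, hwn, by linarith, by linarith, ?_, ?_, ?_⟩
  · intro h
    have h0 : w.arg = 0 := by linarith
    rw [h0, Real.sin_zero, mul_zero, him] at hsn
    have hb0 : b = 0 := by
      rcases mul_eq_zero.1 hsn.symm with h | h
      · exact (mul_eq_zero.1 h).resolve_right hs₂.ne'
      · exact absurd h hsin.ne'
    have ha1 : a = 1 := by linarith
    simp [hb0, ha1]
  · intro h
    have h0 : ω - w.arg = 0 := by linarith
    rw [h0, Real.sin_zero, mul_zero] at hsub
    have ha0 : a = 0 := by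
      rcases mul_eq_zero.1 hsub.symm with h | h
      · exact (mul_eq_zero.1 h).resolve_right hs₁.ne'
      · exact absurd h hsin.ne'
    have hb1 : b = 1 := by linarith
    simp [hb1, ha0]
  · rintro rfl
    have hsq : ‖w‖ ^ 2 = s₁ ^ 2 * (1 - 2 * (a * b) * (1 - Real.cos ω)) := by
      rw [← Complex.normSq_eq_norm_sq, Complex.normSq_apply, hre, him]
      have h5 := Real.sin_sq_add_cos_sq ω
      have h6 : a = 1 - b := by linarith
      rw [h6]
      linear_combination (b * s₁) ^ 2 * h5
    have hab0 : 0 ≤ a * b := by positivity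
    constructor
    · have := Real.cos_le_one ω
      refine le_of_sq_le_sq ?_ hs₁.le
      rw [hsq]
      nlinarith [mul_nonneg hab0 (sub_nonneg.2 this), sq_nonneg s₁]
    · intro h23
      have hc : -(1 / 2) ≤ Real.cos ω := by
        have : Real.cos (2 * π / 3) = -(1 / 2) := by
          rw [show 2 * π / 3 = π - π / 3 by ring, Real.cos_pi_sub, Real.cos_pi_div_three]
        rw [← this]
        exact Real.cos_le_cos_of_nonneg_of_le_pi hω0.le (by linarith [Real.pi_pos]) h23
      have hab4 : a * b ≤ 1 / 4 := by nlinarith [sq_nonneg (a - b)]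
      refine le_of_sq_le_sq ?_ hwn.le
      rw [hsq]
      have : a * b * (1 - Real.cos ω) ≤ 1 / 4 * (3 / 2) := by
        apply mul_le_mul hab4 (by linarith) (by linarith [Real.cos_le_one ω]) (by norm_num)
      nlinarith [sq_nonneg s₁]

/-- Chords of a convex angular sector that cut off equal lengths on its two rays are disjoint for
different lengths. -/
lemma radius_eq_of_mem_segment {v x z : ℂ} (hx : x ≠ v) {ψ₁ ψ₂ s s' : ℝ} (h1 : ψ₁ < ψ₂)
    (h2 : ψ₂ < ψ₁ + π)
    (hz : z ∈ segment ℝ (polar v x ψ₁ s) (polar v x ψ₂ s))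
    (hz' : z ∈ segment ℝ (polar v x ψ₁ s') (polar v x ψ₂ s')) : s = s' := by
  obtain ⟨a, b, ha, hb, hab, rfl⟩ := hz
  obtain ⟨a', b', ha', hb', hab', h⟩ := hz'
  have hsin : 0 < Real.sin (ψ₂ - ψ₁) := Real.sin_pos_of_pos_of_lt_pi (by linarith) (by linarith)
  have e2 : exp (ψ₂ * I) = exp (ψ₁ * I) * (Real.cos (ψ₂ - ψ₁) + Real.sin (ψ₂ - ψ₁) * I) := by
    rw [Complex.ofReal_cos, Complex.ofReal_sin, ← Complex.exp_mul_I, ← Complex.exp_add]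
    congr 1; push_cast; ring
  simp only [polar, e2, Complex.real_smul] at h
  have habC : (a : ℂ) + b = 1 := by exact_mod_cast hab
  have habC' : (a' : ℂ) + b' = 1 := by exact_mod_cast hab'
  have h3 : exp (ψ₁ * I) * unitDir v x *
      (((a' * s' + b' * s' * Real.cos (ψ₂ - ψ₁) : ℝ) : ℂ) + ((b' * s' * Real.sin (ψ₂ - ψ₁) : ℝ) : ℂ) * I)
      = exp (ψ₁ * I) * unitDir v x *
      (((a * s + b * s * Real.cos (ψ₂ - ψ₁) : ℝ) : ℂ) + ((b * s * Real.sin (ψ₂ - ψ₁) : ℝ) : ℂ) * I) := by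
    push_cast at h ⊢
    linear_combination h + v * habC - v * habC'
  have h4 := mul_left_cancel₀ (mul_ne_zero (Complex.exp_ne_zero _) (unitDir_ne_zero hx)) h3
  have hre := congrArg Complex.re h4
  have him := congrArg Complex.im h4
  simp only [Complex.add_re, Complex.add_im, Complex.mul_re, Complex.mul_im, Complex.ofReal_re,
    Complex.ofReal_im, Complex.I_re, Complex.I_im] at hre him
  have h5 : b' * s' = b * s := by
    have : b' * s' * Real.sin (ψ₂ - ψ₁) = b * s * Real.sin (ψ₂ - ψ₁) := by linarith
    exact mul_right_cancel₀ hsin.ne' this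
  have h6 : a' * s' = a * s := by rw [h5] at hre; linarith
  have : (a + b) * s = (a' + b') * s' := by linarith
  rw [hab, hab'] at this
  linarith

/-! ### Consecutive rays around a vertex -/

/-- The rays from `v` through the points of `N` are pairwise distinct, and any two of them
enclose an angle of at least `4δ`. -/
structure Spread (N : Set ℂ) (v : ℂ) (δ : ℝ) : Prop where
  ne : ∀ x ∈ N, x ≠ v
  le_angle : ∀ a ∈ N, ∀ b ∈ N, 4 * δ ≤ ccwAngle v a b
  angle_lt : ∀ a ∈ N, ∀ b ∈ N, a ≠ b → ccwAngle v a b < 2 * π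

lemma Spread.mono {N N' : Set ℂ} {v : ℂ} {δ : ℝ} (h : Spread N v δ) (hN : N' ⊆ N) :
    Spread N' v δ :=
  ⟨fun x hx => h.ne x (hN hx), fun a ha b hb => h.le_angle a (hN ha) b (hN hb),
    fun a ha b hb => h.angle_lt a (hN ha) b (hN hb)⟩

/-- Among the rays from `v` through the points of `N`, the one through `y` follows the one
through `x` counterclockwise. -/
def Consec (N : Set ℂ) (v x y : ℂ) : Prop :=
  x ∈ N ∧ y ∈ N ∧ ∀ z ∈ N, ccwAngle v x y ≤ ccwAngle v x z

section Rays

variable {N : Set ℂ} {v : ℂ} {δ : ℝ}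

lemma Spread.angle_add_swap (hN : Spread N v δ) {x y : ℂ} (hx : x ∈ N) (hy : y ∈ N)
    (hxy : x ≠ y) : ccwAngle v x y + ccwAngle v y x = 2 * π := by
  have h := ccwAngle_add (hN.ne x hx) (hN.ne y hy) (hN.ne x hx)
  rw [ccwAngle_self (hN.ne x hx)] at h
  have h1 := hN.angle_lt x hx y hy hxy
  have h2 := hN.angle_lt y hy x hx hxy.symm
  rcases h with h | h <;> linarith

lemma Spread.eq_of_angle_eq (hN : Spread N v δ) {x y y' : ℂ} (hx : x ∈ N) (hy : y ∈ N)
    (hy' : y' ∈ N) (h : ccwAngle v x y = ccwAngle v x y') : y = y' := by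
  by_contra hne
  have h1 := ccwAngle_add (hN.ne x hx) (hN.ne y hy) (hN.ne y' hy')
  have h2 := hN.angle_lt y hy y' hy' hne
  have h3 := ccwAngle_pos v y y'
  rcases h1 with h1 | h1 <;> linarith

/-- The open sectors between consecutive rays are disjoint. -/
lemma Spread.sector_unique (hN : Spread N v δ) {x y x' y' : ℂ} {ψ ψ' s s' : ℝ}
    (h : Consec N v x y) (h' : Consec N v x' y') (hs : 0 < s) (hs' : 0 < s')
    (h0 : 0 < ψ) (h1 : ψ < ccwAngle v x y) (h0' : 0 < ψ') (h1' : ψ' < ccwAngle v x' y')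
    (he : polar v x ψ s = polar v x' ψ' s') : x = x' ∧ y = y' := by
  have hx := hN.ne x h.1
  have hx' := hN.ne x' h'.1
  have hxx : x = x' := by
    by_contra hne
    have hsum := hN.angle_add_swap h.1 h'.1 hne
    have h2 := h.2.2 x' h'.1
    have h3 := h'.2.2 x h.1
    rw [polar_rebase hx hx'] at he
    have := (polar_inj hx hs hs' (by linarith) (by linarith) he).1
    linarith
  subst hxx
  exact ⟨rfl, hN.eq_of_angle_eq h.1 h.2.1 h'.2.1 (le_antisymm (h.2.2 _ h'.2.1)
    (h'.2.2 _ h.2.1))⟩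

/-- A point that lies within angle `δ` of one of the rays, and at angle at least `δ` from the rays
bounding a sector that contains it, has angle exactly `δ` to one of the latter. -/
lemma Spread.boundary_ray (hN : Spread N v δ) (hδ : 0 < δ) {x y w : ℂ} {ψ φ s s' : ℝ}
    (h : Consec N v x y) (hw : w ∈ N) (hs : 0 < s) (hs' : 0 < s')
    (h0 : δ ≤ ψ) (h1 : ψ ≤ ccwAngle v x y - δ) (hφ : -δ ≤ φ) (hφ' : φ ≤ δ)
    (he : polar v x ψ s = polar v w φ s') :
    (w = x ∧ φ = δ ∧ ψ = δ ∧ s = s') ∨ (w = y ∧ φ = -δ ∧ ψ = ccwAngle v x y - δ ∧ s = s') := by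
  have hx := hN.ne x h.1
  have hθ := ccwAngle_le v x y
  by_cases hwx : w = x
  · subst hwx
    rcases lt_or_ge ψ (φ + 2 * π) with hlt | hge
    · obtain ⟨e1, e2⟩ := polar_inj hx hs hs' hlt (by linarith [Real.pi_pos]) he
      exact Or.inl ⟨rfl, by linarith, by linarith, e2⟩
    · have hθ2 : ccwAngle v w y = 2 * π := by linarith
      have hwy : w = y := by
        by_contra hne
        exact absurd hθ2 (hN.angle_lt w hw y h.2.1 hne).ne
      have e : ψ = φ + 2 * π := by linarith
      rw [e, polar_add_two_pi] at he
      have := polar_inj hx hs hs' (by linarith [Real.pi_pos]) (by linarith [Real.pi_pos]) he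
      exact Or.inr ⟨hwy, by linarith, by linarith, this.2⟩
  · have h2 := h.2.2 w hw
    have hsum := hN.angle_add_swap h.1 hw (Ne.symm hwx)
    have h4 := hN.le_angle x h.1 w hw
    have h5 := hN.le_angle w hw x h.1
    rw [polar_rebase hx (hN.ne w hw)] at he
    obtain ⟨e1, e2⟩ := polar_inj hx hs hs' (by linarith) (by linarith) he
    have e3 : φ = -δ := by linarith
    have e4 : ccwAngle v x w = ccwAngle v x y := by linarith
    exact Or.inr ⟨hN.eq_of_angle_eq h.1 hw h.2.1 e4, e3, by linarith, e2⟩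

/-- The sectors of angle `δ` around the rays are disjoint. -/
lemma Spread.ray_unique (hN : Spread N v δ) (hδ : 0 < δ) {w w' : ℂ} {φ φ' s s' : ℝ}
    (hw : w ∈ N) (hw' : w' ∈ N) (hs : 0 < s) (hs' : 0 < s')
    (h0 : -δ ≤ φ) (h1 : φ ≤ δ) (h0' : -δ ≤ φ') (h1' : φ' ≤ δ)
    (he : polar v w φ s = polar v w' φ' s') : w = w' := by
  by_contra hne
  have hsum := hN.angle_add_swap hw hw' hne
  have h4 := hN.le_angle w hw w' hw'
  have h5 := hN.le_angle w' hw' w hw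
  rw [polar_rebase (hN.ne w hw) (hN.ne w' hw')] at he
  have := (polar_inj (hN.ne w hw) hs hs' (by linarith) (by linarith) he).1
  linarith

lemma exists_consec (hfin : N.Finite) {x : ℂ} (hx : x ∈ N) : ∃ y, Consec N v x y := by
  obtain ⟨y, hy, hmin⟩ := Set.exists_min_image N (fun z => ccwAngle v x z) hfin ⟨x, hx⟩
  exact ⟨y, hx, hy, hmin⟩

/-- A ray is determined by its successor. -/
lemma Spread.consec_left_unique (hN : Spread N v δ) {x x' y : ℂ} (h : Consec N v x y)
    (h' : Consec N v x' y) : x = x' := by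
  by_contra hne
  have hsum := hN.angle_add_swap h.1 h'.1 hne
  have h1 := h.2.2 x' h'.1
  have h2 := h'.2.2 x h.1
  have h3 := ccwAngle_add (hN.ne x h.1) (hN.ne x' h'.1) (hN.ne y h.2.1)
  have h4 := ccwAngle_pos v x y
  have h5 := ccwAngle_pos v x' y
  rcases h3 with h3 | h3 <;> linarith

/-- Inserting a ray outside the sector between two consecutive rays keeps them consecutive. -/
lemma Consec.insert_of_le {x y f : ℂ} (h : Consec N v x y)
    (hf : ccwAngle v x y ≤ ccwAngle v x f) : Consec (insert f N) v x y :=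
  ⟨Or.inr h.1, Or.inr h.2.1, by
    rintro z (rfl | hz)
    · exact hf
    · exact h.2.2 z hz⟩

/-- A ray inserted into the sector between two consecutive rays follows the first of them. -/
lemma Consec.insert_left {x y f : ℂ} (h : Consec N v x y)
    (hf : ccwAngle v x f < ccwAngle v x y) : Consec (insert f N) v x f :=
  ⟨Or.inr h.1, Or.inl rfl, by
    rintro z (rfl | hz)
    · exact le_rfl
    · exact hf.le.trans (h.2.2 z hz)⟩

/-- A ray inserted into the sector between two consecutive rays precedes the second of them. -/
lemma Consec.insert_right {x y f : ℂ} (hN : ∀ z ∈ N, z ≠ v) (hfv : f ≠ v) (h : Consec N v x y)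
    (hf : ccwAngle v x f < ccwAngle v x y) : Consec (insert f N) v f y := by
  have hx := hN x h.1
  have key : ∀ z ∈ N, ccwAngle v x f + ccwAngle v f z = ccwAngle v x z := by
    intro z hz
    rcases ccwAngle_add hx hfv (hN z hz) with e | e
    · exact e
    · have := h.2.2 z hz
      have := ccwAngle_le v f z
      linarith
  refine ⟨Or.inl rfl, Or.inr h.2.1, ?_⟩
  rintro z (rfl | hz)
  · rw [ccwAngle_self hfv]; exact ccwAngle_le _ _ _
  · have := key z hz
    have := key y h.2.1
    have := h.2.2 z hz
    linarith

end Rays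

/-! ### Arcs, strips and gates -/

/-- The `j`-th breakpoint (`j = 0, 1, 2, 3`), at distance `s` from `v`, of the polygonal arc that
runs counterclockwise inside the sector from the ray through `x` to the ray through `y`; it keeps
angle `δ` to these two rays. -/
noncomputable def arcPt (δ : ℝ) (v x y : ℂ) (s : ℝ) (j : ℕ) : ℂ :=
  polar v x (δ + j * ((ccwAngle v x y - 2 * δ) / 3)) s

lemma arcPt_zero (δ : ℝ) (v x y : ℂ) (s : ℝ) : arcPt δ v x y s 0 = polar v x δ s := by
  simp [arcPt]

lemma arcPt_three (δ : ℝ) {v x y : ℂ} (hx : x ≠ v) (hy : y ≠ v) (s : ℝ) :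
    arcPt δ v x y s 3 = polar v y (-δ) s := by
  rw [polar_rebase hx hy, arcPt]
  congr 1
  push_cast; ring

/-- The points of the `j`-th segment of an arc in polar coordinates. -/
lemma exists_polar_of_mem_arc {δ : ℝ} {v x y z : ℂ} {s : ℝ} {j : ℕ} (hδ : 0 < δ) (hs : 0 < s)
    (hθ : 4 * δ ≤ ccwAngle v x y)
    (hz : z ∈ segment ℝ (arcPt δ v x y s j) (arcPt δ v x y s (j + 1))) :
    ∃ ψ σ, z = polar v x ψ σ ∧ s / 2 ≤ σ ∧ σ ≤ s ∧
      δ + j * ((ccwAngle v x y - 2 * δ) / 3) ≤ ψ ∧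
      ψ ≤ δ + (j + 1) * ((ccwAngle v x y - 2 * δ) / 3) ∧
      (ψ = δ + j * ((ccwAngle v x y - 2 * δ) / 3) → z = arcPt δ v x y s j) ∧
      (ψ = δ + (j + 1) * ((ccwAngle v x y - 2 * δ) / 3) → z = arcPt δ v x y s (j + 1)) := by
  have hle := ccwAngle_le v x y
  have hpi := Real.pi_pos
  set ω := (ccwAngle v x y - 2 * δ) / 3 with hω
  have e1 : (δ + ((j + 1 : ℕ) : ℝ) * ω) = δ + (j + 1) * ω := by push_cast; ring
  have hω0 : 0 < ω := by rw [hω]; linarith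
  have hω1 : ω ≤ 2 * π / 3 := by rw [hω]; linarith
  have hz' : z ∈ segment ℝ (polar v x (δ + j * ω) s) (polar v x (δ + (j + 1) * ω) s) := by
    rw [← e1]; exact hz
  obtain ⟨ψ, σ, h1, h2, h3, h4, h5, h6, h7⟩ :=
    exists_polar_of_mem_segment (by linarith) (by linarith) hs hs hz'
  exact ⟨ψ, σ, h1, (h7 rfl).2 (by linarith), (h7 rfl).1, h3, h4, h5, fun h => by
    rw [h6 h, arcPt, ← hω, e1]⟩

/-- A point at distance `Y = s sin δ` from a ray, on which it projects to distance
`X ≥ s cos δ` from the origin, has angle at most `δ`. -/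
lemma exists_angle_of_height {δ s X Y : ℝ} (hδ : 0 < δ) (hδ' : δ < π / 2) (hs : 0 < s)
    (hY : Y = s * Real.sin δ) (hX : s * Real.cos δ ≤ X) :
    ∃ φ σ, 0 < φ ∧ φ ≤ δ ∧ X ≤ σ ∧ 0 < σ ∧ X = σ * Real.cos φ ∧ Y = σ * Real.sin φ ∧
      (φ = δ → X = s * Real.cos δ) := by
  have hsin : 0 < Real.sin δ := Real.sin_pos_of_pos_of_lt_pi hδ (by linarith)
  have hcos : 0 < Real.cos δ := Real.cos_pos_of_mem_Ioo ⟨by linarith, hδ'⟩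
  have hX0 : 0 < X := lt_of_lt_of_le (by positivity) hX
  have hY0 : 0 < Y := by rw [hY]; positivity
  set w : ℂ := ⟨X, Y⟩ with hw
  have hw0 : w ≠ 0 := fun h => hX0.ne' (congrArg Complex.re h)
  have hwn : 0 < ‖w‖ := norm_pos_iff.2 hw0
  have hc : ‖w‖ * Real.cos w.arg = X := Complex.norm_mul_cos_arg w
  have hsn : ‖w‖ * Real.sin w.arg = Y := Complex.norm_mul_sin_arg w
  have harg : |w.arg| < π / 2 := Complex.abs_arg_lt_pi_div_two_iff.2 (Or.inl hX0)
  have harg' := abs_lt.1 harg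
  have hpos : 0 < w.arg := by
    by_contra hle
    push Not at hle
    have : Real.sin w.arg ≤ 0 := Real.sin_nonpos_of_nonpos_of_neg_pi_le hle (by linarith)
    nlinarith
  have hkey : ‖w‖ * Real.sin (δ - w.arg) = (X - s * Real.cos δ) * Real.sin δ := by
    rw [Real.sin_sub]
    have : ‖w‖ * (Real.sin δ * Real.cos w.arg - Real.cos δ * Real.sin w.arg)
      = Real.sin δ * (‖w‖ * Real.cos w.arg) - Real.cos δ * (‖w‖ * Real.sin w.arg) := by ring
    rw [this, hc, hsn, hY]; ring
  refine ⟨w.arg, ‖w‖, hpos, ?_, ?_, hwn, hc.symm, hsn.symm, ?_⟩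
  · by_contra hlt
    push Not at hlt
    have : Real.sin (δ - w.arg) < 0 := Real.sin_neg_of_neg_of_neg_pi_lt (by linarith)
      (by linarith)
    have h2 : 0 ≤ (X - s * Real.cos δ) * Real.sin δ := mul_nonneg (by linarith) hsin.le
    nlinarith
  · rw [← hc]
    have := Real.cos_le_one w.arg
    nlinarith
  · intro h
    rw [h, sub_self, Real.sin_zero, mul_zero] at hkey
    have := (mul_eq_zero.1 hkey.symm).resolve_right hsin.ne'
    linarith

lemma polar_eq_cos_sin (v x : ℂ) (ψ s : ℝ) :
    polar v x ψ s = v + ((s * Real.cos ψ : ℝ) + (s * Real.sin ψ : ℝ) * I) * unitDir v x := by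
  rw [polar, Complex.exp_mul_I]
  push_cast; ring

/-- The segment that runs on the right-hand side of the edge from `u` to `v` and starts and ends
at distance `s` from `u` and `v`, at angle `δ` to the edge, is parallel to the edge. -/
lemma exists_offset_of_mem_strip {δ s : ℝ} {u v z : ℂ}
    (hz : z ∈ segment ℝ (polar u v (-δ) s) (polar v u δ s)) (hL : 2 * s < ‖v - u‖)
    (hs : 0 < s) :
    ∃ x : ℝ, s * Real.cos δ ≤ x ∧ x ≤ ‖v - u‖ - s * Real.cos δ ∧
      z = u + ((x : ℂ) - (s * Real.sin δ : ℝ) * I) * unitDir u v ∧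
      z = v + ((‖v - u‖ - x : ℝ) + (s * Real.sin δ : ℝ) * I) * unitDir v u := by
  obtain ⟨a, b, ha, hb, hab, rfl⟩ := hz
  have hc := Real.cos_le_one δ
  have hsc : s * Real.cos δ ≤ s := by nlinarith
  have hn := norm_mul_unitDir u v
  have habC : (a : ℂ) = 1 - b := by
    have : (a : ℂ) + b = 1 := by exact_mod_cast hab
    linear_combination this
  refine ⟨a * (s * Real.cos δ) + b * (‖v - u‖ - s * Real.cos δ), ?_, ?_, ?_, ?_⟩
  · have : a = 1 - b := by linarith
    rw [this]; nlinarith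
  · have : b = 1 - a := by linarith
    rw [this]; nlinarith
  · rw [polar_eq_cos_sin, polar_eq_cos_sin, unitDir_swap u v]
    simp only [Complex.real_smul, Real.cos_neg, Real.sin_neg]
    push_cast
    rw [habC]
    linear_combination (-b : ℂ) * hn
  · rw [polar_eq_cos_sin, polar_eq_cos_sin, unitDir_swap u v]
    simp only [Complex.real_smul, Real.cos_neg, Real.sin_neg]
    push_cast
    rw [habC]
    linear_combination (1 - b : ℂ) * hn

lemma exists_polar_left_of_mem_strip {δ s : ℝ} {u v z : ℂ} (hδ : 0 < δ) (hδ' : δ < π / 2)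
    (hz : z ∈ segment ℝ (polar u v (-δ) s) (polar v u δ s)) (hL : 2 * s < ‖v - u‖)
    (hs : 0 < s) :
    ∃ φ σ, z = polar u v φ σ ∧ -δ ≤ φ ∧ φ < 0 ∧ s * Real.cos δ ≤ σ ∧ 0 < σ ∧
      (φ = -δ → z = polar u v (-δ) s) := by
  obtain ⟨x, h1, h2, h3, -⟩ := exists_offset_of_mem_strip hz hL hs
  obtain ⟨φ, σ, a1, a2, a3, a4, a5, a6, a7⟩ := exists_angle_of_height hδ hδ' hs rfl h1
  refine ⟨-φ, σ, ?_, by linarith, by linarith, by linarith, a4, ?_⟩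
  · rw [h3, polar_eq_cos_sin, Real.cos_neg, Real.sin_neg, a6, a5]
    push_cast; ring
  · intro h
    rw [h3, a7 (by linarith), polar_eq_cos_sin, Real.cos_neg, Real.sin_neg]
    push_cast; ring

lemma exists_polar_right_of_mem_strip {δ s : ℝ} {u v z : ℂ} (hδ : 0 < δ) (hδ' : δ < π / 2)
    (hz : z ∈ segment ℝ (polar u v (-δ) s) (polar v u δ s)) (hL : 2 * s < ‖v - u‖)
    (hs : 0 < s) :
    ∃ φ σ, z = polar v u φ σ ∧ 0 < φ ∧ φ ≤ δ ∧ s * Real.cos δ ≤ σ ∧ 0 < σ ∧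
      (φ = δ → z = polar v u δ s) := by
  obtain ⟨x, h1, h2, -, h3⟩ := exists_offset_of_mem_strip hz hL hs
  obtain ⟨φ, σ, a1, a2, a3, a4, a5, a6, a7⟩ := exists_angle_of_height hδ hδ' hs rfl
    (show s * Real.cos δ ≤ ‖v - u‖ - x by linarith)
  refine ⟨φ, σ, ?_, a1, a2, by linarith, a4, ?_⟩
  · rw [h3, polar_eq_cos_sin, a6, a5]
  · intro h
    rw [h3, a7 h, polar_eq_cos_sin]

/-- Strips along the same side of an edge are disjoint for different distances. -/
lemma strip_radius_unique {δ s s' : ℝ} {u v z : ℂ} (hδ : 0 < δ) (hδ' : δ < π / 2)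
    (hz : z ∈ segment ℝ (polar u v (-δ) s) (polar v u δ s)) (hL : 2 * s < ‖v - u‖)
    (hs : 0 < s)
    (hz' : z ∈ segment ℝ (polar u v (-δ) s') (polar v u δ s')) (hL' : 2 * s' < ‖v - u‖)
    (hs' : 0 < s') : s = s' := by
  obtain ⟨x, -, -, h, -⟩ := exists_offset_of_mem_strip hz hL hs
  obtain ⟨x', -, -, h', -⟩ := exists_offset_of_mem_strip hz' hL' hs'
  have hsin : 0 < Real.sin δ := Real.sin_pos_of_pos_of_lt_pi hδ (by linarith [Real.pi_pos])
  have hne : v ≠ u := by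
    rintro rfl
    simp at hL; linarith
  rw [h] at h'
  have h2 := mul_right_cancel₀ (unitDir_ne_zero hne) (add_left_cancel h')
  have h3 := congrArg Complex.im h2
  simp only [Complex.sub_im, Complex.mul_im, Complex.ofReal_re, Complex.ofReal_im,
    Complex.I_re, Complex.I_im] at h3
  have h4 : s * Real.sin δ = s' * Real.sin δ := by linarith
  exact mul_right_cancel₀ hsin.ne' h4

/-- A strip stays close to its edge. -/
lemma exists_dist_le_of_mem_strip {δ s : ℝ} {u v z : ℂ} (hu : v ≠ u) (hs : 0 < s)
    (hz : z ∈ segment ℝ (polar u v (-δ) s) (polar v u δ s)) :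
    ∃ y ∈ segment ℝ u v, dist z y ≤ s := by
  obtain ⟨a, b, ha, hb, hab, rfl⟩ := hz
  refine ⟨a • u + b • v, ⟨a, b, ha, hb, hab, rfl⟩, ?_⟩
  have : a • polar u v (-δ) s + b • polar v u δ s - (a • u + b • v)
      = a • (polar u v (-δ) s - u) + b • (polar v u δ s - v) := by
    simp only [Complex.real_smul]; ring
  rw [dist_eq_norm, this]
  refine (norm_add_le _ _).trans ?_
  rw [norm_smul, norm_smul, norm_polar_sub hu, norm_polar_sub hu.symm, abs_of_pos hs,
    Real.norm_of_nonneg ha, Real.norm_of_nonneg hb, ← add_mul, hab, one_mul]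

/-- The point with coordinates `(ε c₁, ε c₂)` with respect to the unit vectors at `v` that enclose
the angles `-δ` and `δ` with the ray through `f`. -/
noncomputable def gatePt (δ ε : ℝ) (v f : ℂ) (c : ℝ × ℝ) : ℂ :=
  v + (ε * c.1 : ℝ) * exp ((-δ : ℝ) * I) * unitDir v f + (ε * c.2 : ℝ) * exp (δ * I) * unitDir v f

lemma gatePt_left (δ ε : ℝ) (v f : ℂ) (a : ℝ) :
    gatePt δ ε v f (a, 0) = polar v f (-δ) (ε * a) := by
  simp [gatePt, polar]

lemma gatePt_right (δ ε : ℝ) (v f : ℂ) (b : ℝ) :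
    gatePt δ ε v f (0, b) = polar v f δ (ε * b) := by
  simp [gatePt, polar]

lemma gatePt_zero (δ ε : ℝ) (v f : ℂ) : gatePt δ ε v f (0, 0) = v := by
  simp [gatePt]

lemma gatePt_injective {δ ε : ℝ} {v f : ℂ} (hδ : 0 < δ) (hδ' : δ < π / 2) (hε : 0 < ε)
    (hf : f ≠ v) : Function.Injective (gatePt δ ε v f) := by
  rintro ⟨a, b⟩ ⟨a', b'⟩ h
  have hsin : 0 < Real.sin δ := Real.sin_pos_of_pos_of_lt_pi hδ (by linarith [Real.pi_pos])
  have hcos : 0 < Real.cos δ := Real.cos_pos_of_mem_Ioo ⟨by linarith, hδ'⟩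
  simp only [gatePt, Complex.exp_mul_I, ← Complex.ofReal_cos, ← Complex.ofReal_sin, Real.cos_neg,
    Real.sin_neg] at h
  have h2 : ((ε : ℂ) * (((a + b) * Real.cos δ : ℝ) + ((b - a) * Real.sin δ : ℝ) * I)) * unitDir v f
      = ((ε : ℂ) * (((a' + b') * Real.cos δ : ℝ) + ((b' - a') * Real.sin δ : ℝ) * I)) *
        unitDir v f := by
    push_cast at h ⊢
    linear_combination h
  have h3 := mul_left_cancel₀ (by exact_mod_cast hε.ne') (mul_right_cancel₀ (unitDir_ne_zero hf) h2)
  have hre := congrArg Complex.re h3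
  have him := congrArg Complex.im h3
  simp only [Complex.add_re, Complex.add_im, Complex.mul_re, Complex.mul_im, Complex.ofReal_re,
    Complex.ofReal_im, Complex.I_re, Complex.I_im, mul_zero, mul_one, sub_zero, add_zero,
    zero_add] at hre him
  have e1 := mul_right_cancel₀ hcos.ne' hre
  have e2 := mul_right_cancel₀ hsin.ne' him
  exact Prod.ext (by simp only; linarith) (by simp only; linarith)

lemma mem_segment_gatePt {δ ε : ℝ} {v f z : ℂ} {p q : ℝ × ℝ}
    (hz : z ∈ segment ℝ (gatePt δ ε v f p) (gatePt δ ε v f q)) :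
    ∃ c ∈ segment ℝ p q, z = gatePt δ ε v f c := by
  obtain ⟨a, b, ha, hb, hab, rfl⟩ := hz
  refine ⟨a • p + b • q, ⟨a, b, ha, hb, hab, rfl⟩, ?_⟩
  have habC : (a : ℂ) = 1 - b := by
    have : (a : ℂ) + b = 1 := by exact_mod_cast hab
    linear_combination this
  simp only [gatePt, Complex.real_smul, Prod.fst_add, Prod.snd_add, Prod.smul_fst, Prod.smul_snd,
    smul_eq_mul]
  push_cast
  rw [habC]
  ring

/-- The points of the gate with nonnegative coordinates in polar coordinates. -/
lemma exists_polar_gatePt {δ ε : ℝ} {v f : ℂ} (hδ : 0 < δ) (hδ' : δ < π / 2) (hε : 0 < ε)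
    (hf : f ≠ v) {c : ℝ × ℝ} (h1 : 0 ≤ c.1) (h2 : 0 ≤ c.2) (hc : 0 < c.1 + c.2) :
    ∃ φ σ, gatePt δ ε v f c = polar v f φ σ ∧ 0 < σ ∧ σ ≤ ε * (c.1 + c.2) ∧ -δ ≤ φ ∧ φ ≤ δ ∧
      (φ = -δ → c.2 = 0) ∧ (φ = δ → c.1 = 0) := by
  obtain ⟨a, b⟩ := c
  simp only at h1 h2 hc ⊢
  have hmem : gatePt δ ε v f (a, b) ∈
      segment ℝ (polar v f (-δ) (ε * (a + b))) (polar v f δ (ε * (a + b))) := by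
    refine ⟨a / (a + b), b / (a + b), by positivity, by positivity, by field_simp, ?_⟩
    have hC : (a : ℂ) + b ≠ 0 := by exact_mod_cast hc.ne'
    simp only [polar, gatePt, Complex.real_smul]
    push_cast
    field_simp
    ring
  obtain ⟨φ, σ, e1, e2, e3, e4, e5, e6, e7⟩ := exists_polar_of_mem_segment (by linarith)
    (by linarith) (by positivity) (by positivity) hmem
  refine ⟨φ, σ, e1, e2, (e7 rfl).1, e3, e4, fun h => ?_, fun h => ?_⟩
  · have := e5 h
    rw [← gatePt_left] at this
    exact congrArg Prod.snd (gatePt_injective hδ hδ' hε hf this)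
  · have := e6 h
    rw [← gatePt_right] at this
    exact congrArg Prod.fst (gatePt_injective hδ hδ' hε hf this)

/-! ### Heights -/

/-- The height of the `h`-th track, a strictly increasing sequence in `[3/4, 1)`. Hence the inner
levels `10 - 8 * height h` are in `(2, 4]`, the outer levels `10 + 8 * height h` are in `[16, 18)`,
and the turning points at level `10 + height h` of the gates are in between. -/
noncomputable def height (h : ℕ) : ℝ := 1 - 1 / (h + 4)

lemma height_ge (h : ℕ) : 3 / 4 ≤ height h := by
  have : (1 : ℝ) / (h + 4) ≤ 1 / 4 :=
    one_div_le_one_div_of_le (by norm_num) (by linarith [Nat.cast_nonneg (α := ℝ) h])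
  unfold height; linarith

lemma height_lt (h : ℕ) : height h < 1 := by
  have : (0 : ℝ) < 1 / (h + 4) := by positivity
  unfold height; linarith

lemma height_strictMono : StrictMono height := by
  intro a b hab
  have : (1 : ℝ) / (b + 4) < 1 / (a + 4) :=
    one_div_lt_one_div_of_lt (by positivity) (by
      have : (a : ℝ) < b := by exact_mod_cast hab
      linarith)
  unfold height; linarith

/-- The segments, in gate coordinates, by which the `h`-th track meets the gate of the `t`-th
component; left and right are as seen by an observer who faces the vertex. If `t ≤ h` it passes the gate outside the component (`pass`). If `h < t` it turns
around before the gate, both on the left (`outerLeft`, `innerLeft`) and on the right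
(`outerRight`, `innerRight`), from the level outside the big graph to the level close to the
component. The track that starts at the gate does so with `start` and `outerLeft`; the one that ends
there does so with `finish`, after it has come in by `outerRight` or `innerRight`. -/
inductive GateSeg (t h : ℕ) : ℝ × ℝ → ℝ × ℝ → Prop
  | pass : t ≤ h → GateSeg t h (10 + 8 * height h, 0) (0, 10 + 8 * height h)
  | outerLeft : h ≤ t → GateSeg t h (10 + 8 * height h, 0) (10, height h)
  | innerLeft : h < t → GateSeg t h (10, height h) (10 - 8 * height h, 0)
  | start : h = t → GateSeg t h (0, 0) (10, height h)
  | outerRight : h < t → GateSeg t h (0, 10 + 8 * height h) (height h, 10)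
  | innerRight : h < t → GateSeg t h (height h, 10) (0, 10 - 8 * height h)
  | finish : h + 1 = t → GateSeg t h (0, 0) (height h, 10)

/-- The gate segments described by linear (in)equalities. -/
lemma GateSeg.cases_mem {t h : ℕ} {p q c : ℝ × ℝ} (H : GateSeg t h p q)
    (hc : c ∈ segment ℝ p q) :
    (t ≤ h ∧ p = (10 + 8 * height h, 0) ∧ q = (0, 10 + 8 * height h) ∧
      c.1 + c.2 = 10 + 8 * height h ∧ 0 ≤ c.1 ∧ 0 ≤ c.2) ∨
    (h ≤ t ∧ p = (10 + 8 * height h, 0) ∧ q = (10, height h) ∧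
      c.1 - 10 + 8 * c.2 = 8 * height h ∧ 10 ≤ c.1 ∧ 0 ≤ c.2) ∨
    (h < t ∧ p = (10, height h) ∧ q = (10 - 8 * height h, 0) ∧
      10 - c.1 + 8 * c.2 = 8 * height h ∧ c.1 ≤ 10 ∧ 0 ≤ c.2) ∨
    (h = t ∧ p = (0, 0) ∧ q = (10, height h) ∧
      10 * c.2 = height h * c.1 ∧ c.1 ≤ 10 ∧ 0 ≤ c.1) ∨
    (h < t ∧ p = (0, 10 + 8 * height h) ∧ q = (height h, 10) ∧
      c.2 - 10 + 8 * c.1 = 8 * height h ∧ 10 ≤ c.2 ∧ 0 ≤ c.1) ∨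
    (h < t ∧ p = (height h, 10) ∧ q = (0, 10 - 8 * height h) ∧
      10 - c.2 + 8 * c.1 = 8 * height h ∧ c.2 ≤ 10 ∧ 0 ≤ c.1) ∨
    (h + 1 = t ∧ p = (0, 0) ∧ q = (height h, 10) ∧
      10 * c.1 = height h * c.2 ∧ c.2 ≤ 10 ∧ 0 ≤ c.2) := by
  have hl := height_ge h
  have hl' := height_lt h
  obtain ⟨a, b, ha, hb, hab, rfl⟩ := hc
  have ha' : a = 1 - b := by linarith
  subst ha'
  cases H with
  | pass H => exact Or.inl ⟨H, rfl, rfl, by simp; ring, by simp; nlinarith, by simp; nlinarith⟩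
  | outerLeft H =>
    exact Or.inr (Or.inl ⟨H, rfl, rfl, by simp; ring, by simp; nlinarith, by simp; nlinarith⟩)
  | innerLeft H =>
    exact Or.inr (Or.inr (Or.inl ⟨H, rfl, rfl, by simp; ring, by simp; nlinarith,
      by simp; nlinarith⟩))
  | start H =>
    exact Or.inr (Or.inr (Or.inr (Or.inl ⟨H, rfl, rfl, by simp; ring, by simp; nlinarith,
      by simp; nlinarith⟩)))
  | outerRight H =>
    exact Or.inr (Or.inr (Or.inr (Or.inr (Or.inl ⟨H, rfl, rfl, by simp; ring, by simp; nlinarith,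
      by simp; nlinarith⟩))))
  | innerRight H =>
    exact Or.inr (Or.inr (Or.inr (Or.inr (Or.inr (Or.inl ⟨H, rfl, rfl, by simp; ring,
      by simp; nlinarith, by simp; nlinarith⟩)))))
  | finish H =>
    exact Or.inr (Or.inr (Or.inr (Or.inr (Or.inr (Or.inr ⟨H, rfl, rfl, by simp; ring,
      by simp; nlinarith, by simp; nlinarith⟩)))))

lemma GateSeg.bounds {t h : ℕ} {p q c : ℝ × ℝ} (H : GateSeg t h p q)
    (hc : c ∈ segment ℝ p q) : 0 ≤ c.1 ∧ 0 ≤ c.2 ∧ c.1 + c.2 ≤ 18 := by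
  have hl := height_ge h
  have hl' := height_lt h
  rcases H.cases_mem hc with ⟨-, -, -, h1, h2, h3⟩ | ⟨-, -, -, h1, h2, h3⟩ | ⟨-, -, -, h1, h2, h3⟩ |
    ⟨-, -, -, h1, h2, h3⟩ | ⟨-, -, -, h1, h2, h3⟩ | ⟨-, -, -, h1, h2, h3⟩ | ⟨-, -, -, h1, h2, h3⟩
  all_goals refine ⟨?_, ?_, ?_⟩ <;> nlinarith

/-- A gate segment meets the rays that bound the gate only in endpoints, at the two levels of its
track, and the vertex of the gate only as an endpoint. -/
lemma GateSeg.boundary {t h : ℕ} {p q c : ℝ × ℝ} (H : GateSeg t h p q)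
    (hc : c ∈ segment ℝ p q) (h0 : c.1 = 0 ∨ c.2 = 0) :
    (c = p ∨ c = q) ∧ (c = 0 ∨ c.1 + c.2 = 10 + 8 * height h ∨ c.1 + c.2 = 10 - 8 * height h) := by
  have hl := height_ge h
  have hl' := height_lt h
  obtain ⟨x, y⟩ := c
  simp only [Prod.mk_eq_zero] at h0 ⊢
  rcases H.cases_mem hc with ⟨-, rfl, rfl, h1, h2, h3⟩ | ⟨-, rfl, rfl, h1, h2, h3⟩ |
    ⟨-, rfl, rfl, h1, h2, h3⟩ | ⟨-, rfl, rfl, h1, h2, h3⟩ | ⟨-, rfl, rfl, h1, h2, h3⟩ |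
    ⟨-, rfl, rfl, h1, h2, h3⟩ | ⟨-, rfl, rfl, h1, h2, h3⟩
  all_goals simp only [Prod.mk.injEq] at *
  all_goals rcases h0 with rfl | rfl
  · exact ⟨Or.inr ⟨rfl, by linarith⟩, Or.inr (Or.inl (by linarith))⟩
  · exact ⟨Or.inl ⟨by linarith, rfl⟩, Or.inr (Or.inl (by linarith))⟩
  · linarith
  · exact ⟨Or.inl ⟨by linarith, rfl⟩, Or.inr (Or.inl (by linarith))⟩
  · linarith
  · exact ⟨Or.inr ⟨by linarith, rfl⟩, Or.inr (Or.inr (by linarith))⟩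
  · exact ⟨Or.inl ⟨rfl, by linarith⟩, Or.inl ⟨rfl, by linarith⟩⟩
  · have : x = 0 := by nlinarith
    exact ⟨Or.inl ⟨this, rfl⟩, Or.inl ⟨this, rfl⟩⟩
  · exact ⟨Or.inl ⟨rfl, by linarith⟩, Or.inr (Or.inl (by linarith))⟩
  · linarith
  · exact ⟨Or.inr ⟨rfl, by linarith⟩, Or.inr (Or.inr (by linarith))⟩
  · linarith
  · have : y = 0 := by nlinarith
    exact ⟨Or.inl ⟨rfl, this⟩, Or.inl ⟨rfl, this⟩⟩
  · exact ⟨Or.inl ⟨by linarith, rfl⟩, Or.inl ⟨by linarith, rfl⟩⟩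

set_option maxHeartbeats 1000000 in
/-- Gate segments at the same gate do not cross, and segments of different tracks have no point in
common apart from the vertex of the gate. -/
lemma GateSeg.disjoint {t h h' : ℕ} {p q p' q' c : ℝ × ℝ} (H : GateSeg t h p q)
    (H' : GateSeg t h' p' q') (hc : c ∈ segment ℝ p q) (hc' : c ∈ segment ℝ p' q') :
    (p = p' ∧ q = q' ∧ h = h') ∨
      ((c = p ∨ c = q) ∧ (c = p' ∨ c = q') ∧ (h = h' ∨ c = 0)) := by
  have hl := height_ge h
  have hl2 := height_lt h
  have hl' := height_ge h'
  have hl2' := height_lt h'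
  have hmono : h < h' → height h < height h' := fun H => height_strictMono H
  have hmono' : h' < h → height h' < height h := fun H => height_strictMono H
  have D := H.cases_mem hc
  have D' := H'.cases_mem hc'
  obtain ⟨x, y⟩ := c
  clear H H' hc hc'
  rcases lt_trichotomy h h' with hh | hh | hh
  all_goals first | have hm := hmono hh | have hm := hmono' hh | skip
  all_goals
    rcases D with ⟨g, rfl, rfl, h1, h2, h3⟩ | ⟨g, rfl, rfl, h1, h2, h3⟩ |
      ⟨g, rfl, rfl, h1, h2, h3⟩ | ⟨g, rfl, rfl, h1, h2, h3⟩ | ⟨g, rfl, rfl, h1, h2, h3⟩ |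
      ⟨g, rfl, rfl, h1, h2, h3⟩ | ⟨g, rfl, rfl, h1, h2, h3⟩
  all_goals
    rcases D' with ⟨g', rfl, rfl, h1', h2', h3'⟩ | ⟨g', rfl, rfl, h1', h2', h3'⟩ |
      ⟨g', rfl, rfl, h1', h2', h3'⟩ | ⟨g', rfl, rfl, h1', h2', h3'⟩ |
      ⟨g', rfl, rfl, h1', h2', h3'⟩ | ⟨g', rfl, rfl, h1', h2', h3'⟩ |
      ⟨g', rfl, rfl, h1', h2', h3'⟩
  all_goals simp only [Prod.mk.injEq, Prod.mk_eq_zero] at *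
  all_goals first
    | (exfalso; omega)
    | (exfalso; linarith)
    | (subst hh; left; simp; done)
    | (exfalso; nlinarith)
    | skip
  all_goals right
  all_goals first
    | (subst hh
       have ex : x = 10 := by linarith
       have ey : y = height h := by linarith
       simp [ex, ey])
    | (subst hh
       have ey : y = 10 := by linarith
       have ex : x = height h := by linarith
       simp [ex, ey])
    | (subst hh
       have ey : y = 0 := by linarith
       have ex : x = 10 + 8 * height h := by linarith
       simp [ex, ey])
    | (have ex : x = 0 := by nlinarith
       have ey : y = 0 := by nlinarith
       simp [ex, ey])
    | (subst hh
       have ey : y = 10 := by nlinarith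
       have ex : x = height h := by linarith
       simp [ex, ey])

/-! ### The system of tracks -/

/-- The neighbours of `v` in `K`, together with a point on the gate at `v` if there is one; the
gate of the `t`-th component is at the vertex `P t`, in the direction of `f t`. -/
def rays {r : ℕ} (K : GeomGraph) (P f : Fin r → ℂ) (v : ℂ) : Set ℂ :=
  {w | K.Adj v w ∨ ∃ t, P t = v ∧ f t = w}

lemma rays_mono {r : ℕ} {K K' : GeomGraph} (h : K ≤ K') (P f : Fin r → ℂ) (v : ℂ) :
    rays K P f v ⊆ rays K' P f v := by
  rintro w (hw | hw)
  · exact Or.inl (h.2 hw)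
  · exact Or.inr hw

/-- Two graphs `G ≤ B` with the same vertices, gates at some of the vertices, an angle `δ` that is
small compared to the angles at the vertices of `B`, and a length `ε` that is small compared to
the distances between vertices and edges of `B`. -/
structure Layout {r : ℕ} (G B : GeomGraph) (P f : Fin r → ℂ) (δ ε : ℝ) : Prop where
  le : G ≤ B
  verts_eq : B.verts = G.verts
  P_mem : ∀ t, P t ∈ B.verts
  P_inj : Function.Injective P
  gate_notAdj : ∀ t, ¬ B.Adj (P t) (f t)
  δ_pos : 0 < δ
  δ_le : δ ≤ π / 3
  spread : ∀ v, Spread (rays B P f v) v δ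
  ε_pos : 0 < ε
  sep_vert : ∀ v ∈ B.verts, ∀ w ∈ B.verts, v ≠ w → 40 * ε < dist v w
  sep_edge : ∀ v ∈ B.verts, ∀ x y, B.Adj x y → v ≠ x → v ≠ y →
    ∀ z ∈ segment ℝ x y, 40 * ε < dist v z
  sep_edges : ∀ u v x y, B.Adj u v → B.Adj x y → u ≠ x → u ≠ y → v ≠ x → v ≠ y →
    ∀ z ∈ segment ℝ u v, ∀ z' ∈ segment ℝ x y, 40 * ε < dist z z'

/-- The graphs that are surrounded by the `h`-th track, with the distance it keeps to their
vertices: it surrounds the big graph `B` at the outer level `ε (10 + 8 height h)` and the small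
graph `G` at the inner level `ε (10 - 8 height h)`. -/
inductive Ring (G B : GeomGraph) (ε : ℝ) (h : ℕ) : GeomGraph → ℝ → Prop
  | outer : Ring G B ε h B (ε * (10 + 8 * height h))
  | inner : Ring G B ε h G (ε * (10 - 8 * height h))

/-- The segments that may be used by the `h`-th track: strips along the edges, arcs around the
vertices, and the segments at the gates. -/
inductive Track {r : ℕ} (G B : GeomGraph) (P f : Fin r → ℂ) (δ ε : ℝ) (h : ℕ) : ℂ → ℂ → Prop
  | strip {K : GeomGraph} {s : ℝ} (u v : ℂ) : Ring G B ε h K s → K.Adj u v →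
      Track G B P f δ ε h (polar u v (-δ) s) (polar v u δ s)
  | arc {K : GeomGraph} {s : ℝ} (v x y : ℂ) (j : ℕ) : Ring G B ε h K s → v ∈ B.verts →
      Consec (rays K P f v) v x y → j < 3 →
      Track G B P f δ ε h (arcPt δ v x y s j) (arcPt δ v x y s (j + 1))
  | gate {p q : ℝ × ℝ} (t : Fin r) : GateSeg t h p q →
      Track G B P f δ ε h (gatePt δ ε (P t) (f t) p) (gatePt δ ε (P t) (f t) q)

lemma eq_polar_of_mem_segment {u v z : ℂ} (hz : z ∈ segment ℝ u v) :
    z = polar u v 0 ‖z - u‖ := by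
  obtain ⟨a, b, ha, hb, hab, rfl⟩ := hz
  have habC : (a : ℂ) + b = 1 := by exact_mod_cast hab
  have h : a • u + b • v - u = b * (v - u) := by
    simp only [Complex.real_smul]
    linear_combination u * habC
  rw [polar, h, norm_mul, Complex.norm_real, Real.norm_of_nonneg hb]
  have := norm_mul_unitDir u v
  push_cast
  simp only [zero_mul, Complex.exp_zero, Complex.real_smul]
  linear_combination u * habC - b * this

section Layout

variable {r : ℕ} {G B K K' : GeomGraph} {P f : Fin r → ℂ} {δ ε s s' : ℝ} {h h' : ℕ}

lemma Ring.pos (hε : 0 < ε) (H : Ring G B ε h K s) : 0 < s := by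
  have := height_ge h
  have := height_lt h
  cases H <;> nlinarith

lemma Ring.le (hε : 0 < ε) (H : Ring G B ε h K s) : s ≤ 18 * ε := by
  have := height_ge h
  have := height_lt h
  cases H <;> nlinarith

/-- Rings around different graphs are at levels that differ by a factor of more than `2`. -/
lemma Ring.graph_eq_or (hε : 0 < ε) (H : Ring G B ε h K s) (H' : Ring G B ε h' K' s') :
    K = K' ∨ (K = B ∧ K' = G ∧ 2 * s' < s) ∨ (K = G ∧ K' = B ∧ 2 * s < s') := by
  have := height_ge h
  have := height_lt h
  have := height_ge h'
  have := height_lt h'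
  cases H <;> cases H'
  · exact Or.inl rfl
  · exact Or.inr (Or.inl ⟨rfl, rfl, by nlinarith⟩)
  · exact Or.inr (Or.inr ⟨rfl, rfl, by nlinarith⟩)
  · exact Or.inl rfl

lemma Ring.height_eq (hε : 0 < ε) (H : Ring G B ε h K s) (H' : Ring G B ε h' K' s)  :
    h = h' := by
  have := height_ge h
  have := height_lt h
  have := height_ge h'
  have := height_lt h'
  cases H with
  | outer =>
    generalize hs : ε * (10 + 8 * height h) = s at H'
    cases H' with
    | outer => exact height_strictMono.injective (by
        have := mul_left_cancel₀ hε.ne' hs; linarith)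
    | inner => have := mul_left_cancel₀ hε.ne' hs; linarith
  | inner =>
    generalize hs : ε * (10 - 8 * height h) = s at H'
    cases H' with
    | outer => have := mul_left_cancel₀ hε.ne' hs; linarith
    | inner => exact height_strictMono.injective (by
        have := mul_left_cancel₀ hε.ne' hs; linarith)

lemma Ring.le_graph (hle : G ≤ B) (H : Ring G B ε h K s) : K ≤ B := by
  cases H
  · exact le_rfl
  · exact hle

lemma Ring.ge_graph (hle : G ≤ B) (H : Ring G B ε h K s) : G ≤ K := by
  cases H
  · exact hle
  · exact le_rfl

variable (L : Layout G B P f δ ε)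
include L

lemma Layout.δ_lt : δ < π / 2 := by linarith [L.δ_le, Real.pi_pos]

lemma Layout.half_le_cos : 1 / 2 ≤ Real.cos δ := by
  rw [← Real.cos_pi_div_three]
  exact Real.cos_le_cos_of_nonneg_of_le_pi L.δ_pos.le (by linarith [Real.pi_pos]) L.δ_le

lemma Layout.spread_ring (H : Ring G B ε h K s) (v : ℂ) : Spread (rays K P f v) v δ :=
  (L.spread v).mono (rays_mono (H.le_graph L.le) P f v)

lemma Layout.long {u v : ℂ} (H : Ring G B ε h K s) (huv : B.Adj u v) : 2 * s < ‖v - u‖ := by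
  have h1 := L.sep_vert v (B.edge_vert huv.symm) u (B.edge_vert huv) huv.ne.symm
  rw [dist_eq_norm] at h1
  have := H.le L.ε_pos
  have := L.ε_pos
  linarith

lemma Layout.gate_ne (t : Fin r) : f t ≠ P t :=
  (L.spread (P t)).ne _ (Or.inr ⟨t, rfl, rfl⟩)

/-- A strip seen from one of the endpoints `p` of its edge, with `o` the other endpoint. -/
lemma Layout.strip_at {u v z : ℂ} (H : Ring G B ε h K s) (huv : B.Adj u v)
    (hz : z ∈ segment ℝ (polar u v (-δ) s) (polar v u δ s)) {p : ℂ} (hp : p = u ∨ p = v) :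
    ∃ o φ σ, B.Adj p o ∧ (K.Adj u v → K.Adj p o) ∧ s(u, v) = s(p, o) ∧ z = polar p o φ σ ∧
      -δ ≤ φ ∧ φ ≤ δ ∧ φ ≠ 0 ∧ s / 2 ≤ σ ∧ 0 < σ ∧ (φ = δ ∨ φ = -δ →
        σ = s ∧ (z = polar u v (-δ) s ∨ z = polar v u δ s)) := by
  have hs := H.pos L.ε_pos
  have hc := L.half_le_cos
  have hδ := L.δ_pos
  rcases hp with rfl | rfl
  · obtain ⟨φ, σ, h1, h2, h3, h4, h5, h6⟩ :=
      exists_polar_left_of_mem_strip L.δ_pos L.δ_lt hz (L.long H huv) hs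
    refine ⟨v, φ, σ, huv, id, rfl, h1, h2, by linarith, h3.ne, by nlinarith, h5, ?_⟩
    rintro (h7 | h7)
    · linarith
    · have h8 := h6 h7
      refine ⟨?_, Or.inl h8⟩
      rw [h1] at h8
      exact (polar_inj huv.ne.symm h5 hs (by linarith [Real.pi_pos]) (by linarith [Real.pi_pos])
        h8).2
  · obtain ⟨φ, σ, h1, h2, h3, h4, h5, h6⟩ :=
      exists_polar_right_of_mem_strip L.δ_pos L.δ_lt hz (L.long H huv) hs
    refine ⟨u, φ, σ, huv.symm, SimpleGraph.Subgraph.Adj.symm, Sym2.eq_swap, h1, by linarith, h3,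
      h2.ne', by nlinarith, h5, ?_⟩
    rintro (h7 | h7)
    · have h8 := h6 h7
      refine ⟨?_, Or.inr h8⟩
      rw [h1] at h8
      exact (polar_inj huv.ne h5 hs (by linarith [Real.pi_pos]) (by linarith [Real.pi_pos])
        h8).2
    · linarith

/-- A strip keeps away from all vertices that are not incident to its edge. -/
lemma Layout.strip_vert {u v z w : ℂ} (H : Ring G B ε h K s) (huv : B.Adj u v)
    (hz : z ∈ segment ℝ (polar u v (-δ) s) (polar v u δ s)) (hw : w ∈ B.verts)
    (hd : dist z w ≤ 18 * ε) : w = u ∨ w = v := by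
  by_contra hne
  push Not at hne
  obtain ⟨y, hy, hzy⟩ := exists_dist_le_of_mem_strip huv.ne.symm (H.pos L.ε_pos) hz
  have h1 := L.sep_edge w hw u v huv hne.1 hne.2 y hy
  have h2 := H.le L.ε_pos
  have h3 := dist_triangle_left w y z
  have h4 := L.ε_pos
  linarith

lemma Layout.share_of_dist {u v x y z z' : ℂ} (huv : B.Adj u v) (hxy : B.Adj x y)
    (hz : z ∈ segment ℝ u v) (hz' : z' ∈ segment ℝ x y) (hd : dist z z' ≤ 40 * ε) :
    ∃ p, (p = u ∨ p = v) ∧ (p = x ∨ p = y) := by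
  by_contra hne
  push Not at hne
  obtain ⟨h1, h2⟩ := hne u (Or.inl rfl)
  obtain ⟨h3, h4⟩ := hne v (Or.inr rfl)
  linarith [L.sep_edges u v x y huv hxy h1 h2 h3 h4 z hz z' hz']

/-- A point on an arc in polar coordinates. -/
lemma Layout.arc_at {v x y z : ℂ} {j : ℕ} (H : Ring G B ε h K s)
    (hxy : Consec (rays K P f v) v x y) (hj : j < 3)
    (hz : z ∈ segment ℝ (arcPt δ v x y s j) (arcPt δ v x y s (j + 1))) :
    ∃ ψ σ, z = polar v x ψ σ ∧ δ ≤ ψ ∧ ψ ≤ ccwAngle v x y - δ ∧ s / 2 ≤ σ ∧ σ ≤ s ∧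
      (ψ = δ ∨ ψ = ccwAngle v x y - δ →
        σ = s ∧ (z = arcPt δ v x y s j ∨ z = arcPt δ v x y s (j + 1))) ∧
      δ + j * ((ccwAngle v x y - 2 * δ) / 3) ≤ ψ ∧
      ψ ≤ δ + (j + 1) * ((ccwAngle v x y - 2 * δ) / 3) ∧
      (ψ = δ + j * ((ccwAngle v x y - 2 * δ) / 3) →
        σ = s ∧ z = arcPt δ v x y s j) ∧
      (ψ = δ + (j + 1) * ((ccwAngle v x y - 2 * δ) / 3) →
        σ = s ∧ z = arcPt δ v x y s (j + 1)) := by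
  have hs := H.pos L.ε_pos
  have hδ := L.δ_pos
  have hsp := L.spread_ring H v
  have hθ := hsp.le_angle x hxy.1 y hxy.2.1
  have hx := hsp.ne x hxy.1
  obtain ⟨ψ, σ, h1, h2, h3, h4, h5, h6, h7⟩ := exists_polar_of_mem_arc hδ hs hθ hz
  have hσ : ∀ k, z = arcPt δ v x y s k → σ = s := by
    intro k hk
    have := norm_polar_sub hx (δ + k * ((ccwAngle v x y - 2 * δ) / 3)) s
    rw [← arcPt, ← hk, h1, norm_polar_sub hx, abs_of_pos (by linarith), abs_of_pos hs] at this
    exact this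
  set ω := (ccwAngle v x y - 2 * δ) / 3 with hω
  have hω0 : 0 < ω := by rw [hω]; linarith
  have hω3 : ccwAngle v x y - δ = δ + 3 * ω := by rw [hω]; ring
  have hj0 : (0 : ℝ) ≤ j := Nat.cast_nonneg j
  have hj3 : (j : ℝ) + 1 ≤ 3 := by
    have : j + 1 ≤ 3 := hj
    exact_mod_cast this
  have b1 : δ ≤ ψ := by nlinarith
  have b2 : ψ ≤ ccwAngle v x y - δ := by rw [hω3]; nlinarith
  have c1 : ψ = δ + j * ω → σ = s ∧ z = arcPt δ v x y s j := fun e => ⟨hσ _ (h6 e), h6 e⟩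
  have c2 : ψ = δ + (j + 1) * ω → σ = s ∧ z = arcPt δ v x y s (j + 1) :=
    fun e => ⟨hσ _ (h7 e), h7 e⟩
  refine ⟨ψ, σ, h1, b1, b2, h2, h3, ?_, h4, h5, c1, c2⟩
  rintro (e | e)
  · obtain ⟨d1, d2⟩ := c1 (by nlinarith)
    exact ⟨d1, Or.inl d2⟩
  · obtain ⟨d1, d2⟩ := c2 (by rw [hω3] at e; nlinarith)
    exact ⟨d1, Or.inr d2⟩

lemma Layout.arc_dist {v x y z : ℂ} {j : ℕ} (H : Ring G B ε h K s)
    (hxy : Consec (rays K P f v) v x y) (hj : j < 3)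
    (hz : z ∈ segment ℝ (arcPt δ v x y s j) (arcPt δ v x y s (j + 1))) :
    dist z v ≤ 18 * ε := by
  obtain ⟨ψ, σ, h1, -, -, h2, h3, -⟩ := L.arc_at H hxy hj hz
  have hs := H.pos L.ε_pos
  rw [dist_eq_norm, h1, norm_polar_sub ((L.spread_ring H v).ne x hxy.1), abs_of_pos (by linarith)]
  exact h3.trans (H.le L.ε_pos)

/-- A point on a gate segment in polar coordinates. -/
lemma Layout.gate_at {t : Fin r} {p q c : ℝ × ℝ} (H : GateSeg t h p q)
    (hc : c ∈ segment ℝ p q) :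
    (c = 0 ∧ (c = p ∨ c = q)) ∨
    ∃ φ σ, gatePt δ ε (P t) (f t) c = polar (P t) (f t) φ σ ∧ 0 < σ ∧ σ ≤ 18 * ε ∧ -δ ≤ φ ∧
      φ ≤ δ ∧ (φ = δ ∨ φ = -δ → (c = p ∨ c = q) ∧ ∃ K, Ring G B ε h K σ) := by
  obtain ⟨h1, h2, h3⟩ := H.bounds hc
  have hε := L.ε_pos
  rcases (add_nonneg h1 h2).eq_or_lt' with h4 | h4
  · left
    have hc0 : c = 0 := Prod.ext (by simp only [Prod.fst_zero]; linarith)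
      (by simp only [Prod.snd_zero]; linarith)
    exact ⟨hc0, (H.boundary hc (Or.inl (by rw [hc0]; rfl))).1⟩
  · right
    obtain ⟨φ, σ, e1, e2, e3, e4, e5, e6, e7⟩ :=
      exists_polar_gatePt L.δ_pos L.δ_lt hε (L.gate_ne t) h1 h2 h4
    refine ⟨φ, σ, e1, e2, by nlinarith, e4, e5, fun hφ => ?_⟩
    have h0 : c.1 = 0 ∨ c.2 = 0 := hφ.imp e7 e6
    obtain ⟨b1, b2⟩ := H.boundary hc h0
    refine ⟨b1, ?_⟩
    have hσ : σ = ε * (c.1 + c.2) := by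
      have hn := congrArg (fun z => ‖z - P t‖) e1
      simp only [norm_polar_sub (L.gate_ne t), abs_of_pos e2] at hn
      rw [← hn]
      rcases h0 with h0 | h0
      · rw [show c = (0, c.2) from Prod.ext h0 rfl, gatePt_right, norm_polar_sub (L.gate_ne t),
          abs_of_nonneg (by positivity)]
        simp
      · rw [show c = (c.1, 0) from Prod.ext rfl h0, gatePt_left, norm_polar_sub (L.gate_ne t),
          abs_of_nonneg (by positivity)]
        simp
    rcases b2 with b2 | b2 | b2
    · rw [b2] at h4; simp at h4
    · rw [hσ, b2]; exact ⟨_, Ring.outer⟩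
    · rw [hσ, b2]; exact ⟨_, Ring.inner⟩

lemma Layout.gate_dist {t : Fin r} {p q c : ℝ × ℝ} (H : GateSeg t h p q)
    (hc : c ∈ segment ℝ p q) : dist (gatePt δ ε (P t) (f t) c) (P t) ≤ 18 * ε := by
  have := L.ε_pos
  rcases L.gate_at H hc with ⟨rfl, -⟩ | ⟨φ, σ, e1, e2, e3, -⟩
  · rw [show (0 : ℝ × ℝ) = (0, 0) from rfl, gatePt_zero, dist_self]; linarith
  · rw [e1, dist_eq_norm, norm_polar_sub (L.gate_ne t), abs_of_pos e2]; exact e3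

omit L in
/-- The only way in which two track segments with endpoints `x, y` and `x', y'`, of the tracks
`h` and `h'`, are allowed to share the point `z`. -/
def Compatible (P : Fin r → ℂ) (h h' : ℕ) (x y x' y' z : ℂ) : Prop :=
  (x = x' ∧ y = y' ∧ h = h') ∨
    ((z = x ∨ z = y) ∧ (z = x' ∨ z = y') ∧ (h = h' ∨ ∃ t, z = P t))

omit L in
lemma Compatible.symm {x y x' y' z : ℂ} (H : Compatible P h h' x y x' y' z) :
    Compatible P h' h x' y' x y z := by
  rcases H with ⟨h1, h2, h3⟩ | ⟨h1, h2, h3⟩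
  · exact Or.inl ⟨h1.symm, h2.symm, h3.symm⟩
  · exact Or.inr ⟨h2, h1, h3.imp_left Eq.symm⟩

lemma Layout.strip_strip {u v u' v' z : ℂ} (H : Ring G B ε h K s) (H' : Ring G B ε h' K' s')
    (huv : K.Adj u v) (huv' : K'.Adj u' v')
    (hz : z ∈ segment ℝ (polar u v (-δ) s) (polar v u δ s))
    (hz' : z ∈ segment ℝ (polar u' v' (-δ) s') (polar v' u' δ s')) :
    Compatible P h h' (polar u v (-δ) s) (polar v u δ s) (polar u' v' (-δ) s')
      (polar v' u' δ s') z := by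
  have hδ := L.δ_pos
  have hB := (H.le_graph L.le).2 huv
  have hB' := (H'.le_graph L.le).2 huv'
  obtain ⟨y, hy, hzy⟩ := exists_dist_le_of_mem_strip hB.ne.symm (H.pos L.ε_pos) hz
  obtain ⟨y', hy', hzy'⟩ := exists_dist_le_of_mem_strip hB'.ne.symm (H'.pos L.ε_pos) hz'
  have hs := H.le L.ε_pos
  have hs' := H'.le L.ε_pos
  obtain ⟨p, hp, hp'⟩ := L.share_of_dist hB hB' hy hy' (by
    have := dist_triangle_left y y' z
    linarith [L.ε_pos])
  obtain ⟨o, φ, σ, a1, -, a2, a3, a4, a5, a6, a7, a8, -⟩ := L.strip_at H hB hz hp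
  obtain ⟨o', φ', σ', b1, -, b2, b3, b4, b5, b6, b7, b8, -⟩ := L.strip_at H' hB' hz' hp'
  have ho : o = o' := (L.spread p).ray_unique hδ (Or.inl a1) (Or.inl b1) a8 b8 a4 a5 b4 b5
    (a3.symm.trans b3)
  have hsym : s(u, v) = s(u', v') := by rw [a2, b2, ho]
  rcases Sym2.eq_iff.1 hsym with ⟨rfl, rfl⟩ | ⟨rfl, rfl⟩
  · have := strip_radius_unique hδ L.δ_lt hz (L.long H hB) (H.pos L.ε_pos) hz' (L.long H' hB)
      (H'.pos L.ε_pos)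
    subst this
    exact Or.inl ⟨rfl, rfl, H.height_eq L.ε_pos H'⟩
  · exfalso
    obtain ⟨φ, σ, h1, h2, h3, h4, h5, h6⟩ :=
      exists_polar_left_of_mem_strip L.δ_pos L.δ_lt hz (L.long H hB) (H.pos L.ε_pos)
    obtain ⟨φ', σ', h1', h2', h3', h4', h5', h6'⟩ :=
      exists_polar_right_of_mem_strip L.δ_pos L.δ_lt hz' (L.long H' hB') (H'.pos L.ε_pos)
    have := (polar_inj hB.ne.symm h5 h5' (by linarith [Real.pi_pos])
      (by linarith [Real.pi_pos, L.δ_lt]) (h1.symm.trans h1')).1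
    linarith

lemma Layout.strip_arc {u w v x y z : ℂ} {j : ℕ} (H : Ring G B ε h K s)
    (H' : Ring G B ε h' K' s') (huw : K.Adj u w) (hv : v ∈ B.verts)
    (hxy : Consec (rays K' P f v) v x y) (hj : j < 3)
    (hz : z ∈ segment ℝ (polar u w (-δ) s) (polar w u δ s))
    (hz' : z ∈ segment ℝ (arcPt δ v x y s' j) (arcPt δ v x y s' (j + 1))) :
    Compatible P h h' (polar u w (-δ) s) (polar w u δ s) (arcPt δ v x y s' j)
      (arcPt δ v x y s' (j + 1)) z := by
  have hδ := L.δ_pos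
  have hB := (H.le_graph L.le).2 huw
  have hsp := L.spread_ring H' v
  obtain ⟨o, φ, σ, a1, a1', a2, a3, a4, a5, a6, a7, a8, a9⟩ :=
    L.strip_at H hB hz (L.strip_vert H hB hz hv (L.arc_dist H' hxy hj hz'))
  obtain ⟨ψ, σ', b1, b2, b3, b4, b5, b6, -⟩ := L.arc_at H' hxy hj hz'
  have hs' := H'.pos L.ε_pos
  have hov := (L.spread v).ne o (Or.inl a1)
  have hxv := hsp.ne x hxy.1
  have hσ : σ = σ' := by
    have := congrArg (fun z => ‖z - v‖) (a3.symm.trans b1)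
    simpa only [norm_polar_sub hov, norm_polar_sub hxv, abs_of_pos a8,
      abs_of_pos (show 0 < σ' by linarith)] using this
  have key : K'.Adj v o → Compatible P h h' (polar u w (-δ) s) (polar w u δ s)
      (arcPt δ v x y s' j) (arcPt δ v x y s' (j + 1)) z := by
    intro ho
    have hb := hsp.boundary_ray hδ hxy (Or.inl ho) (by linarith) a8 b2 b3 a4 a5 (b1.symm.trans a3)
    have hφ : φ = δ ∨ φ = -δ := hb.imp (fun e => e.2.1) (fun e => e.2.1)
    have hψ : ψ = δ ∨ ψ = ccwAngle v x y - δ := hb.imp (fun e => e.2.2.1) (fun e => e.2.2.1)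
    obtain ⟨c1, c2⟩ := a9 hφ
    obtain ⟨d1, d2⟩ := b6 hψ
    have : s = s' := by linarith
    subst this
    exact Or.inr ⟨c2, d2, Or.inl (H.height_eq L.ε_pos H')⟩
  rcases H.graph_eq_or L.ε_pos H' with e | ⟨-, -, e⟩ | ⟨e1, e2, -⟩
  · exact key (e ▸ a1' huw)
  · linarith
  · exact key (e2 ▸ a1)

lemma Layout.arc_arc {v x y v' x' y' z : ℂ} {j j' : ℕ} (H : Ring G B ε h K s)
    (H' : Ring G B ε h' K' s') (hv : v ∈ B.verts) (hv' : v' ∈ B.verts)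
    (hxy : Consec (rays K P f v) v x y) (hxy' : Consec (rays K' P f v') v' x' y')
    (hj : j < 3) (hj' : j' < 3)
    (hz : z ∈ segment ℝ (arcPt δ v x y s j) (arcPt δ v x y s (j + 1)))
    (hz' : z ∈ segment ℝ (arcPt δ v' x' y' s' j') (arcPt δ v' x' y' s' (j' + 1))) :
    Compatible P h h' (arcPt δ v x y s j) (arcPt δ v x y s (j + 1)) (arcPt δ v' x' y' s' j')
      (arcPt δ v' x' y' s' (j' + 1)) z := by
  have hδ := L.δ_pos
  have hε := L.ε_pos
  have hs := H.pos hε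
  have hs' := H'.pos hε
  have hvv : v = v' := by
    by_contra hne
    have h1 := L.sep_vert v hv v' hv' hne
    have h2 := L.arc_dist H hxy hj hz
    have h3 := L.arc_dist H' hxy' hj' hz'
    have h4 := dist_triangle_left v v' z
    linarith
  subst hvv
  have hsp := L.spread_ring H v
  have hsp' := L.spread_ring H' v
  have hxv := hsp.ne x hxy.1
  have hxv' := hsp'.ne x' hxy'.1
  obtain ⟨ψ, σ, a1, a2, a3, a4, a5, a6, a7, a8, a9, a10⟩ := L.arc_at H hxy hj hz
  obtain ⟨ψ', σ', b1, b2, b3, b4, b5, b6, b7, b8, b9, b10⟩ := L.arc_at H' hxy' hj' hz'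
  have hσ : σ = σ' := by
    have := congrArg (fun z => ‖z - v‖) (a1.symm.trans b1)
    simpa only [norm_polar_sub hxv, norm_polar_sub hxv', abs_of_pos (show 0 < σ by linarith),
      abs_of_pos (show 0 < σ' by linarith)] using this
  rcases H.graph_eq_or hε H' with rfl | ⟨-, -, e⟩ | ⟨-, -, e⟩
  rotate_left
  · linarith
  · linarith
  obtain ⟨rfl, rfl⟩ := hsp.sector_unique hxy hxy' (by linarith) (by linarith) (by linarith)
    (by linarith) (by linarith) (by linarith) (a1.symm.trans b1)
  have hθ := hsp.le_angle x hxy.1 y hxy.2.1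
  have hle := ccwAngle_le v x y
  have hψ : ψ = ψ' := (polar_inj hxv (by linarith) (by linarith) (by linarith) (by linarith)
    (a1.symm.trans b1)).1
  subst hψ hσ
  set ω := (ccwAngle v x y - 2 * δ) / 3 with hω
  have hω0 : 0 < ω := by rw [hω]; linarith
  rcases lt_trichotomy j j' with hjj | rfl | hjj
  · have : (j : ℝ) + 1 ≤ j' := by exact_mod_cast hjj
    obtain ⟨c1, c2⟩ := a10 (by nlinarith)
    obtain ⟨d1, d2⟩ := b9 (by nlinarith)
    have : s = s' := by linarith
    subst this
    exact Or.inr ⟨Or.inr c2, Or.inl d2, Or.inl (H.height_eq hε H')⟩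
  · have e1 : (δ + ((j + 1 : ℕ) : ℝ) * ω) = δ + j * ω + ω := by push_cast; ring
    have : s = s' := radius_eq_of_mem_segment hxv (by rw [← hω, e1]; linarith)
      (by rw [← hω, e1]; linarith) hz hz'
    subst this
    exact Or.inl ⟨rfl, rfl, H.height_eq hε H'⟩
  · have : (j' : ℝ) + 1 ≤ j := by exact_mod_cast hjj
    obtain ⟨c1, c2⟩ := b10 (by nlinarith)
    obtain ⟨d1, d2⟩ := a9 (by nlinarith)
    have : s = s' := by linarith
    subst this
    exact Or.inr ⟨Or.inl d2, Or.inr c2, Or.inl (H.height_eq hε H')⟩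

lemma Layout.strip_gate {u w z : ℂ} {t : Fin r} {p q : ℝ × ℝ} (H : Ring G B ε h K s)
    (huw : K.Adj u w) (H' : GateSeg t h' p q)
    (hz : z ∈ segment ℝ (polar u w (-δ) s) (polar w u δ s))
    (hz' : z ∈ segment ℝ (gatePt δ ε (P t) (f t) p) (gatePt δ ε (P t) (f t) q)) : False := by
  obtain ⟨c, hc, rfl⟩ := mem_segment_gatePt hz'
  have hB := (H.le_graph L.le).2 huw
  obtain ⟨o, φ, σ, a1, a1', a2, a3, a4, a5, a6, a7, a8, a9⟩ :=
    L.strip_at H hB hz (L.strip_vert H hB hz (L.P_mem t) (L.gate_dist H' hc))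
  rcases L.gate_at H' hc with ⟨rfl, -⟩ | ⟨φ', σ', e1, e2, e3, e4, e5, -⟩
  · rw [show (0 : ℝ × ℝ) = (0, 0) from rfl, gatePt_zero] at a3
    exact polar_ne a1.ne.symm a8 a3.symm
  · have := (L.spread (P t)).ray_unique L.δ_pos (Or.inl a1) (Or.inr ⟨t, rfl, rfl⟩) a8 e2 a4 a5 e4
      e5 (a3.symm.trans e1)
    exact L.gate_notAdj t (this ▸ a1)

lemma Layout.arc_gate {v x y z : ℂ} {j : ℕ} {t : Fin r} {p q : ℝ × ℝ} (H : Ring G B ε h K s)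
    (hv : v ∈ B.verts) (hxy : Consec (rays K P f v) v x y) (hj : j < 3)
    (H' : GateSeg t h' p q)
    (hz : z ∈ segment ℝ (arcPt δ v x y s j) (arcPt δ v x y s (j + 1)))
    (hz' : z ∈ segment ℝ (gatePt δ ε (P t) (f t) p) (gatePt δ ε (P t) (f t) q)) :
    Compatible P h h' (arcPt δ v x y s j) (arcPt δ v x y s (j + 1))
      (gatePt δ ε (P t) (f t) p) (gatePt δ ε (P t) (f t) q) z := by
  obtain ⟨c, hc, rfl⟩ := mem_segment_gatePt hz'
  have hε := L.ε_pos
  have hs := H.pos hε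
  have hvv : v = P t := by
    by_contra hne
    have h1 := L.sep_vert v hv _ (L.P_mem t) hne
    have h2 := L.arc_dist H hxy hj hz
    have h3 := L.gate_dist H' hc
    have h4 := dist_triangle_left v (P t) (gatePt δ ε (P t) (f t) c)
    linarith
  subst hvv
  obtain ⟨ψ, σ, a1, a2, a3, a4, a5, a6, -⟩ := L.arc_at H hxy hj hz
  have hsp := L.spread_ring H (P t)
  rcases L.gate_at H' hc with ⟨rfl, -⟩ | ⟨φ, σ', e1, e2, e3, e4, e5, e6⟩
  · rw [show (0 : ℝ × ℝ) = (0, 0) from rfl, gatePt_zero] at a1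
    exact absurd a1.symm (polar_ne (hsp.ne x hxy.1) (by linarith))
  · have hb := hsp.boundary_ray L.δ_pos hxy (Or.inr ⟨t, rfl, rfl⟩) (by linarith) e2 a2 a3 e4 e5
      (a1.symm.trans e1)
    have hφ : φ = δ ∨ φ = -δ := hb.imp (fun e => e.2.1) (fun e => e.2.1)
    have hψ : ψ = δ ∨ ψ = ccwAngle (P t) x y - δ :=
      hb.imp (fun e => e.2.2.1) (fun e => e.2.2.1)
    have hσ : σ = σ' := by rcases hb with e | e <;> exact e.2.2.2
    obtain ⟨c1, c2⟩ := a6 hψ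
    obtain ⟨d1, K', d2⟩ := e6 hφ
    rw [← hσ, c1] at d2
    exact Or.inr ⟨c2, d1.imp (congrArg _) (congrArg _), Or.inl (H.height_eq hε d2)⟩

lemma Layout.gate_gate {z : ℂ} {t t' : Fin r} {p q p' q' : ℝ × ℝ}
    (H : GateSeg t h p q) (H' : GateSeg t' h' p' q')
    (hz : z ∈ segment ℝ (gatePt δ ε (P t) (f t) p) (gatePt δ ε (P t) (f t) q))
    (hz' : z ∈ segment ℝ (gatePt δ ε (P t') (f t') p') (gatePt δ ε (P t') (f t') q')) :
    Compatible P h h' (gatePt δ ε (P t) (f t) p) (gatePt δ ε (P t) (f t) q)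
      (gatePt δ ε (P t') (f t') p') (gatePt δ ε (P t') (f t') q') z := by
  obtain ⟨c, hc, rfl⟩ := mem_segment_gatePt hz
  obtain ⟨c', hc', he⟩ := mem_segment_gatePt hz'
  have htt : P t = P t' := by
    by_contra hne
    have h1 := L.sep_vert _ (L.P_mem t) _ (L.P_mem t') hne
    have h2 := L.gate_dist H hc
    have h3 := L.gate_dist H' hc'
    rw [← he] at h3
    have h4 := dist_triangle_left (P t) (P t') (gatePt δ ε (P t) (f t) c)
    linarith [L.ε_pos]
  obtain rfl := L.P_inj htt
  obtain rfl := gatePt_injective L.δ_pos L.δ_lt L.ε_pos (L.gate_ne t) he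
  rcases H.disjoint H' hc hc' with ⟨rfl, rfl, e⟩ | ⟨e1, e2, e3⟩
  · exact Or.inl ⟨rfl, rfl, e⟩
  · refine Or.inr ⟨e1.imp (congrArg _) (congrArg _), e2.imp (congrArg _) (congrArg _),
      e3.imp_right ?_⟩
    rintro rfl
    exact ⟨t, gatePt_zero _ _ _ _⟩

/-- The segments of all tracks together form a plane drawing, and different tracks have only
gate vertices in common. -/
theorem Layout.track_compatible {x y x' y' z : ℂ} (H : Track G B P f δ ε h x y)
    (H' : Track G B P f δ ε h' x' y') (hz : z ∈ segment ℝ x y) (hz' : z ∈ segment ℝ x' y') :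
    Compatible P h h' x y x' y' z := by
  cases H with
  | strip u v HR huv =>
    cases H' with
    | strip u' v' HR' huv' => exact L.strip_strip HR HR' huv huv' hz hz'
    | arc v' x' y' j HR' hv hxy hj => exact L.strip_arc HR HR' huv hv hxy hj hz hz'
    | gate t HG => exact (L.strip_gate HR huv HG hz hz').elim
  | arc v x y j HR hv hxy hj =>
    cases H' with
    | strip u' v' HR' huv' => exact (L.strip_arc HR' HR huv' hv hxy hj hz' hz).symm
    | arc v' x' y' j HR' hv' hxy' hj' => exact L.arc_arc HR HR' hv hv' hxy hxy' hj hj' hz hz'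
    | gate t HG => exact L.arc_gate HR hv hxy hj HG hz hz'
  | gate t HG =>
    cases H' with
    | strip u' v' HR' huv' => exact (L.strip_gate HR' huv' HG hz' hz).elim
    | arc v' x' y' j HR' hv hxy hj => exact (L.arc_gate HR' hv hxy hj HG hz' hz).symm
    | gate t HG' => exact L.gate_gate HG HG' hz hz'

end Layout

section Layout

variable {r : ℕ} {G B K K' : GeomGraph} {P f : Fin r → ℂ} {δ ε s s' : ℝ} {h h' : ℕ}

/-! ### Tracks and the given graph -/

lemma pointSet_mono {G B : GeomGraph} (hle : G ≤ B) : G.pointSet ⊆ B.pointSet := by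
  rintro z (hz | ⟨u, v, huv, hz⟩)
  · exact Or.inl (hle.1 hz)
  · exact Or.inr ⟨u, v, hle.2 huv, hz⟩

/-- A point close to a vertex `v` that lies on the graph is `v` itself or lies on an edge at `v`. -/
lemma Layout.near_vertex (L : Layout G B P f δ ε) {v z : ℂ} (hv : v ∈ B.verts)
    (hd : dist z v ≤ 18 * ε) (hKB : K ≤ B) (hz : z ∈ K.pointSet) :
    z = v ∨ ∃ o σ, K.Adj v o ∧ 0 < σ ∧ z = polar v o 0 σ := by
  by_cases hzv : z = v
  · exact Or.inl hzv
  right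
  have hε := L.ε_pos
  rcases hz with hz | ⟨a, b, hab, hz⟩
  · have := L.sep_vert z (hKB.1 hz) v hv hzv
    linarith
  · have hn : 0 < ‖z - v‖ := norm_pos_iff.2 (sub_ne_zero.2 hzv)
    by_cases h : v = a ∨ v = b
    · rcases h with rfl | rfl
      · exact ⟨b, _, hab, hn, eq_polar_of_mem_segment hz⟩
      · rw [segment_symm] at hz
        exact ⟨a, _, hab.symm, hn, eq_polar_of_mem_segment hz⟩
    · push Not at h
      have := L.sep_edge v hv a b (hKB.2 hab) h.1 h.2 z hz
      rw [dist_comm] at this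
      linarith

variable (L : Layout G B P f δ ε)
include L

lemma Layout.strip_avoid {u v z : ℂ} (H : Ring G B ε h K s) (huv : B.Adj u v)
    (hz : z ∈ segment ℝ (polar u v (-δ) s) (polar v u δ s)) : z ∉ B.pointSet := by
  have hε := L.ε_pos
  have hδ := L.δ_pos
  have hs := H.le hε
  rintro (hzB | ⟨a, b, hab, hzab⟩)
  · have := L.strip_vert H huv hz hzB (by rw [dist_self]; linarith)
    obtain ⟨o, φ, σ, a1, -, -, a3, -, -, -, -, a8, -⟩ := L.strip_at H huv hz this
    exact polar_ne a1.ne.symm a8 a3.symm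
  · obtain ⟨y, hy, hzy⟩ := exists_dist_le_of_mem_strip huv.ne.symm (H.pos hε) hz
    obtain ⟨p, hp, hp'⟩ := L.share_of_dist huv hab hy hzab (by rw [dist_comm]; linarith)
    obtain ⟨o, φ, σ, a1, -, -, a3, a4, a5, a6, -, a8, -⟩ := L.strip_at H huv hz hp
    have hzp : z ≠ p := by rw [a3]; exact polar_ne a1.ne.symm a8
    have hn : 0 < ‖z - p‖ := norm_pos_iff.2 (sub_ne_zero.2 hzp)
    have key : ∀ o', B.Adj p o' → z = polar p o' 0 ‖z - p‖ → False := by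
      intro o' ho' e
      have : o = o' := (L.spread p).ray_unique hδ (Or.inl a1) (Or.inl ho') a8 hn a4 a5
        (by linarith) hδ.le (a3.symm.trans e)
      subst this
      have hlt := L.δ_lt
      exact a6 (polar_inj a1.ne.symm a8 hn (by linarith [Real.pi_pos]) (by linarith [Real.pi_pos])
        (a3.symm.trans e)).1
    rcases hp' with rfl | rfl
    · exact key b hab (eq_polar_of_mem_segment hzab)
    · rw [segment_symm] at hzab
      exact key a hab.symm (eq_polar_of_mem_segment hzab)

lemma Layout.arc_avoid {v x y z : ℂ} {j : ℕ} (H : Ring G B ε h K s) (hv : v ∈ B.verts)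
    (hxy : Consec (rays K P f v) v x y) (hj : j < 3)
    (hz : z ∈ segment ℝ (arcPt δ v x y s j) (arcPt δ v x y s (j + 1))) : z ∉ K.pointSet := by
  intro hzK
  have hδ := L.δ_pos
  have hs := H.pos L.ε_pos
  have hsp := L.spread_ring H v
  obtain ⟨ψ, σ, a1, a2, a3, a4, a5, a6, -⟩ := L.arc_at H hxy hj hz
  have hσ : 0 < σ := by linarith
  rcases L.near_vertex hv (L.arc_dist H hxy hj hz) (H.le_graph L.le) hzK with e | ⟨o, σ', ho, h1, e⟩
  · rw [a1] at e
    exact polar_ne (hsp.ne x hxy.1) hσ e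
  · rcases hsp.boundary_ray hδ hxy (Or.inl ho) hσ h1 a2 a3 (by linarith) hδ.le
      (a1.symm.trans e) with hb | hb
    · linarith [hb.2.1]
    · linarith [hb.2.1]

lemma Layout.gate_avoid {z : ℂ} {t : Fin r} {p q : ℝ × ℝ} (H : GateSeg t h p q)
    (hz : z ∈ segment ℝ (gatePt δ ε (P t) (f t) p) (gatePt δ ε (P t) (f t) q))
    (hzB : z ∈ B.pointSet) :
    z = P t ∧ (z = gatePt δ ε (P t) (f t) p ∨ z = gatePt δ ε (P t) (f t) q) := by
  obtain ⟨c, hc, rfl⟩ := mem_segment_gatePt hz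
  have hδ := L.δ_pos
  rcases L.gate_at H hc with ⟨rfl, hc0⟩ | ⟨φ, σ, e1, e2, e3, e4, e5, -⟩
  · exact ⟨gatePt_zero _ _ _ _, hc0.imp (congrArg _) (congrArg _)⟩
  · exfalso
    rcases L.near_vertex (L.P_mem t) (L.gate_dist H hc) le_rfl hzB with e | ⟨o, σ', ho, h1, e⟩
    · rw [e1] at e
      exact polar_ne (L.gate_ne t) e2 e
    · have := (L.spread (P t)).ray_unique hδ (Or.inr ⟨t, rfl, rfl⟩) (Or.inl ho) e2 h1 e4 e5
        (by linarith) hδ.le (e1.symm.trans e)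
      exact L.gate_notAdj t (this ▸ ho)

/-- Tracks meet the small graph only at gate vertices. -/
lemma Layout.track_avoid {x y z : ℂ} (H : Track G B P f δ ε h x y) (hz : z ∈ segment ℝ x y)
    (hzG : z ∈ G.pointSet) : ∃ t, z = P t ∧ (z = x ∨ z = y) := by
  cases H with
  | strip u v HR huv =>
    exact absurd (pointSet_mono L.le hzG) (L.strip_avoid HR ((HR.le_graph L.le).2 huv) hz)
  | arc v x y j HR hv hxy hj =>
    exact absurd (pointSet_mono (HR.ge_graph L.le) hzG) (L.arc_avoid HR hv hxy hj hz)
  | gate t HG => exact ⟨t, L.gate_avoid HG hz (pointSet_mono L.le hzG)⟩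

/-- The only track segments at the vertex of a gate are the two first segments of the track that
starts there and the last segment of the track that ends there. -/
lemma Layout.track_at_gate {x y : ℂ} {t : Fin r} (H : Track G B P f δ ε h x y)
    (ht : P t = x ∨ P t = y) :
    x = P t ∧ ((h = t ∧ y = gatePt δ ε (P t) (f t) (10, height h)) ∨
      (h + 1 = t ∧ y = gatePt δ ε (P t) (f t) (height h, 10))) := by
  have hz : P t ∈ segment ℝ x y := by
    rcases ht with e | e
    · rw [e]; exact left_mem_segment ℝ x y
    · rw [e]; exact right_mem_segment ℝ x y
  have hB : P t ∈ B.pointSet := Or.inl (L.P_mem t)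
  cases H with
  | strip u v HR huv =>
    exact absurd hB (L.strip_avoid HR ((HR.le_graph L.le).2 huv) hz)
  | arc v x y j HR hv hxy hj =>
    have hG : P t ∈ G.verts := L.verts_eq ▸ L.P_mem t
    exact absurd (pointSet_mono (HR.ge_graph L.le) (Or.inl hG)) (L.arc_avoid HR hv hxy hj hz)
  | @gate p q t' HG =>
    have htt : t = t' := L.P_inj (L.gate_avoid HG hz hB).1
    subst htt
    have hinj := gatePt_injective L.δ_pos L.δ_lt L.ε_pos (L.gate_ne t)
    have h0 := gatePt_zero δ ε (P t) (f t)
    have hpq : (0, 0) = p ∨ (0, 0) = q :=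
      ht.imp (fun e => hinj (h0.trans e)) (fun e => hinj (h0.trans e))
    have h1 := height_ge h
    have h2 := height_lt h
    cases HG with
    | pass H =>
      simp only [Prod.mk.injEq] at hpq
      rcases hpq with ⟨e, -⟩ | ⟨-, e⟩ <;> linarith
    | outerLeft H =>
      simp only [Prod.mk.injEq] at hpq
      rcases hpq with ⟨e, -⟩ | ⟨-, e⟩ <;> linarith
    | innerLeft H =>
      simp only [Prod.mk.injEq] at hpq
      rcases hpq with ⟨e, -⟩ | ⟨e, -⟩ <;> linarith
    | start H => exact ⟨h0, Or.inl ⟨H, rfl⟩⟩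
    | outerRight H =>
      simp only [Prod.mk.injEq] at hpq
      rcases hpq with ⟨-, e⟩ | ⟨e, -⟩ <;> linarith
    | innerRight H =>
      simp only [Prod.mk.injEq] at hpq
      rcases hpq with ⟨-, e⟩ | ⟨-, e⟩ <;> linarith
    | finish H => exact ⟨h0, Or.inr ⟨H, rfl⟩⟩

omit L in
/-- The graph formed by the segments of the `h`-th track. -/
def trackGraph (G B : GeomGraph) (P f : Fin r → ℂ) (δ ε : ℝ) (h : ℕ) : SimpleGraph ℂ :=
  SimpleGraph.fromRel (Track G B P f δ ε h)

lemma Layout.trackGraph_compatible {x y x' y' z : ℂ}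
    (H : (trackGraph G B P f δ ε h).Adj x y) (H' : (trackGraph G B P f δ ε h').Adj x' y')
    (hz : z ∈ segment ℝ x y) (hz' : z ∈ segment ℝ x' y') :
    (s(x, y) = s(x', y') ∧ h = h') ∨
      ((z = x ∨ z = y) ∧ (z = x' ∨ z = y') ∧ (h = h' ∨ ∃ t, z = P t)) := by
  rw [trackGraph, SimpleGraph.fromRel_adj] at H H'
  have hzs : z ∈ segment ℝ y x := by rwa [segment_symm]
  have hzs' : z ∈ segment ℝ y' x' := by rwa [segment_symm]
  rcases H.2 with H | H <;> rcases H'.2 with H' | H'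
  · rcases L.track_compatible H H' hz hz' with ⟨rfl, rfl, e⟩ | e
    · exact Or.inl ⟨rfl, e⟩
    · exact Or.inr e
  · rcases L.track_compatible H H' hz hzs' with ⟨rfl, rfl, e⟩ | e
    · exact Or.inl ⟨Sym2.eq_swap, e⟩
    · exact Or.inr ⟨e.1, e.2.1.symm, e.2.2⟩
  · rcases L.track_compatible H H' hzs hz' with ⟨rfl, rfl, e⟩ | e
    · exact Or.inl ⟨Sym2.eq_swap, e⟩
    · exact Or.inr ⟨e.1.symm, e.2.1, e.2.2⟩
  · rcases L.track_compatible H H' hzs hzs' with ⟨rfl, rfl, e⟩ | e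
    · exact Or.inl ⟨rfl, e⟩
    · exact Or.inr ⟨e.1.symm, e.2.1.symm, e.2.2⟩

lemma Layout.trackGraph_avoid {x y z : ℂ} (H : (trackGraph G B P f δ ε h).Adj x y)
    (hz : z ∈ segment ℝ x y) (hzG : z ∈ G.pointSet) : ∃ t, z = P t ∧ (z = x ∨ z = y) := by
  rw [trackGraph, SimpleGraph.fromRel_adj] at H
  rcases H.2 with H | H
  · exact L.track_avoid H hz hzG
  · obtain ⟨t, e1, e2⟩ := L.track_avoid H (by rwa [segment_symm]) hzG
    exact ⟨t, e1, e2.symm⟩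

lemma Layout.trackGraph_at_gate {x : ℂ} {t : Fin r}
    (H : (trackGraph G B P f δ ε h).Adj (P t) x) :
    (h = t ∧ x = gatePt δ ε (P t) (f t) (10, height h)) ∨
      (h + 1 = t ∧ x = gatePt δ ε (P t) (f t) (height h, 10)) := by
  rw [trackGraph, SimpleGraph.fromRel_adj] at H
  rcases H.2 with h2 | h2
  · exact (L.track_at_gate h2 (Or.inl rfl)).2
  · exact absurd (L.track_at_gate h2 (Or.inr rfl)).1 H.1.symm

omit L in
lemma IsPlanar.mono {G B : GeomGraph} (hB : B.IsPlanar) (hle : G ≤ B) : G.IsPlanar :=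
  ⟨hB.finite.subset hle.1, fun u w x y h1 h2 => hB.edges_disjoint u w x y (hle.2 h1) (hle.2 h2),
    fun u w y h1 h2 => hB.vert_notMem u w y (hle.2 h1) (hle.1 h2)⟩

omit L in
lemma not_mem_openSegment_of_endpoint {x y z : ℂ} (hne : x ≠ y) (hz : z = x ∨ z = y) :
    z ∉ openSegment ℝ x y := by
  rcases hz with rfl | rfl
  · rw [left_mem_openSegment_iff]; exact hne
  · rw [right_mem_openSegment_iff]; exact hne

/-- The small graph stays plane if a path composed of track segments is added. -/
theorem Layout.isPlanar_sup (hB : B.IsPlanar) {H : GeomGraph} (hfin : H.verts.Finite)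
    (hadj : ∀ x y, H.Adj x y → ∃ h, (trackGraph G B P f δ ε h).Adj x y)
    (hverts : ∀ x ∈ H.verts, x ∈ G.verts ∨ ∃ h y, (trackGraph G B P f δ ε h).Adj x y) :
    IsPlanar (G ⊔ H) := by
  have hG := hB.mono L.le
  have hmix : ∀ u w x y, G.Adj u w → H.Adj x y →
      Disjoint (openSegment ℝ u w) (openSegment ℝ x y) := by
    intro u w x y huw hxy
    obtain ⟨h, hT⟩ := hadj x y hxy
    rw [Set.disjoint_left]
    intro z hz hz'
    obtain ⟨t, -, e⟩ := L.trackGraph_avoid hT (openSegment_subset_segment ℝ _ _ hz')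
      (Or.inr ⟨u, w, huw, openSegment_subset_segment ℝ _ _ hz⟩)
    exact not_mem_openSegment_of_endpoint hxy.ne e hz'
  refine ⟨?_, ?_, ?_⟩
  · rw [SimpleGraph.Subgraph.verts_sup]; exact hG.finite.union hfin
  · intro u w x y h1 h2 hne
    rw [SimpleGraph.Subgraph.sup_adj] at h1 h2
    rcases h1 with h1 | h1 <;> rcases h2 with h2 | h2
    · exact hG.edges_disjoint u w x y h1 h2 hne
    · exact hmix u w x y h1 h2
    · exact (hmix x y u w h2 h1).symm
    · obtain ⟨h, hT⟩ := hadj u w h1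
      obtain ⟨h', hT'⟩ := hadj x y h2
      rw [Set.disjoint_left]
      intro z hz hz'
      rcases L.trackGraph_compatible hT hT' (openSegment_subset_segment ℝ _ _ hz)
        (openSegment_subset_segment ℝ _ _ hz') with e | e
      · exact hne e.1
      · exact not_mem_openSegment_of_endpoint h1.ne e.1 hz
  · intro u w y h1 h2
    rw [SimpleGraph.Subgraph.sup_adj] at h1
    rw [SimpleGraph.Subgraph.verts_sup] at h2
    rcases h1 with h1 | h1
    · by_cases hy : y ∈ G.verts
      · exact hG.vert_notMem u w y h1 hy
      · obtain ⟨h, y', hT⟩ := (hverts y (h2.resolve_left hy)).resolve_left hy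
        intro hz
        obtain ⟨t, e, -⟩ := L.trackGraph_avoid hT (left_mem_segment ℝ _ _)
          (Or.inr ⟨u, w, h1, openSegment_subset_segment ℝ _ _ hz⟩)
        exact hy (by rw [e, ← L.verts_eq]; exact L.P_mem t)
    · obtain ⟨h, hT⟩ := hadj u w h1
      intro hz
      have hzs := openSegment_subset_segment ℝ _ _ hz
      have key : y = u ∨ y = w := by
        by_cases hy : y ∈ G.verts
        · obtain ⟨t, -, e⟩ := L.trackGraph_avoid hT hzs (Or.inl hy)
          exact e
        · obtain ⟨h', y', hT'⟩ := (hverts y (h2.resolve_left hy)).resolve_left hy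
          rcases L.trackGraph_compatible hT hT' hzs (left_mem_segment ℝ _ _) with e | e
          · have : y ∈ s(u, w) := by rw [e.1]; exact Sym2.mem_mk_left _ _
            simpa using this
          · exact e.1
      exact not_mem_openSegment_of_endpoint h1.ne key hz

/-- Tracks of different heights have only gate vertices in common. -/
lemma Layout.common_vertex {x y y' : ℂ} (hne : h ≠ h') (H : (trackGraph G B P f δ ε h).Adj x y)
    (H' : (trackGraph G B P f δ ε h').Adj x y') : ∃ t, x = P t := by
  rcases L.trackGraph_compatible H H' (left_mem_segment ℝ _ _) (left_mem_segment ℝ _ _) with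
    e | e
  · exact absurd e.2 hne
  · exact e.2.2.resolve_left hne

end Layout

/-! ### Existence of a layout -/

lemma exists_pos_le_of_finite {α : Type*} {s : Set α} (hs : s.Finite) {g : α → ℝ}
    (hg : ∀ x ∈ s, 0 < g x) : ∃ ρ > 0, ∀ x ∈ s, ρ ≤ g x := by
  rcases s.eq_empty_or_nonempty with rfl | hne
  · exact ⟨1, one_pos, by simp⟩
  · obtain ⟨x, hx, hmin⟩ := Set.exists_min_image s g hs hne
    exact ⟨g x, hg x hx, hmin⟩

lemma isCompact_segment (a b : ℂ) : IsCompact (segment ℝ a b) := by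
  rw [segment_eq_image ℝ a b]
  exact isCompact_Icc.image (by fun_prop)

lemma exists_pos_le_dist_segment {a b c d : ℂ} (h : Disjoint (segment ℝ a b) (segment ℝ c d)) :
    ∃ ρ > 0, ∀ z ∈ segment ℝ a b, ∀ z' ∈ segment ℝ c d, ρ ≤ dist z z' := by
  obtain ⟨⟨z₀, z₀'⟩, hz₀, hmin⟩ := ((isCompact_segment a b).prod
    (isCompact_segment c d)).exists_isMinOn ⟨(a, c), left_mem_segment ℝ a b, left_mem_segment ℝ c d⟩
    (continuous_dist.continuousOn)
  refine ⟨dist z₀ z₀', dist_pos.2 ?_, fun z hz z' hz' => hmin (show (z, z') ∈ _ from ⟨hz, hz'⟩)⟩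
  rintro rfl
  exact Set.disjoint_left.1 h hz₀.1 hz₀.2

/-- Disjoint segments between finitely many points keep a uniform distance. -/
lemma exists_separation {V : Set ℂ} (hV : V.Finite) :
    ∃ ρ > 0, ∀ a ∈ V, ∀ b ∈ V, ∀ c ∈ V, ∀ d ∈ V, Disjoint (segment ℝ a b) (segment ℝ c d) →
      ∀ z ∈ segment ℝ a b, ∀ z' ∈ segment ℝ c d, ρ ≤ dist z z' := by
  classical
  have key : ∀ x : ℂ × ℂ × ℂ × ℂ, ∃ ρ > 0,
      Disjoint (segment ℝ x.1 x.2.1) (segment ℝ x.2.2.1 x.2.2.2) →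
        ∀ z ∈ segment ℝ x.1 x.2.1, ∀ z' ∈ segment ℝ x.2.2.1 x.2.2.2, ρ ≤ dist z z' := by
    rintro ⟨a, b, c, d⟩
    by_cases h : Disjoint (segment ℝ a b) (segment ℝ c d)
    · obtain ⟨ρ, h1, h2⟩ := exists_pos_le_dist_segment h
      exact ⟨ρ, h1, fun _ => h2⟩
    · exact ⟨1, one_pos, fun h' => absurd h' h⟩
  choose g hg hg' using key
  obtain ⟨ρ, h1, h2⟩ := exists_pos_le_of_finite (hV.prod (hV.prod (hV.prod hV)))
    (g := g) (fun x _ => hg x)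
  exact ⟨ρ, h1, fun a ha b hb c hc d hd h z hz z' hz' =>
    (h2 (a, b, c, d) ⟨ha, hb, hc, hd⟩).trans (hg' (a, b, c, d) h z hz z' hz')⟩

lemma IsPlanar.not_mem_segment {B : GeomGraph} (hB : B.IsPlanar) {v x y : ℂ} (hv : v ∈ B.verts)
    (hxy : B.Adj x y) (h1 : v ≠ x) (h2 : v ≠ y) : v ∉ segment ℝ x y := by
  intro h
  rw [← insert_endpoints_openSegment] at h
  rcases h with h | h | h
  · exact h1 h
  · exact h2 h
  · exact hB.vert_notMem x y v hxy hv h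

lemma IsPlanar.disjoint_segment {B : GeomGraph} (hB : B.IsPlanar) {u v x y : ℂ} (huv : B.Adj u v)
    (hxy : B.Adj x y) (h1 : u ≠ x) (h2 : u ≠ y) (h3 : v ≠ x) (h4 : v ≠ y) :
    Disjoint (segment ℝ u v) (segment ℝ x y) := by
  rw [Set.disjoint_left]
  intro z hz hz'
  have hz0 := hz
  rw [← insert_endpoints_openSegment] at hz
  rcases hz with rfl | rfl | hz
  · exact hB.not_mem_segment (B.edge_vert huv) hxy h1 h2 hz'
  · exact hB.not_mem_segment (B.edge_vert huv.symm) hxy h3 h4 hz'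
  · rw [← insert_endpoints_openSegment] at hz'
    rcases hz' with rfl | rfl | hz'
    · exact hB.not_mem_segment (B.edge_vert hxy) huv h1.symm h3.symm hz0
    · exact hB.not_mem_segment (B.edge_vert hxy.symm) huv h2.symm h4.symm hz0
    · refine Set.disjoint_left.1 (hB.edges_disjoint u v x y huv hxy ?_) hz hz'
      intro e
      rcases Sym2.eq_iff.1 e with ⟨e, -⟩ | ⟨e, -⟩
      · exact h1 e
      · exact h2 e

/-- Different edges at a vertex of a plane graph have different directions. -/
lemma IsPlanar.ccwAngle_lt {B : GeomGraph} (hB : B.IsPlanar) {v a b : ℂ} (ha : B.Adj v a)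
    (hb : B.Adj v b) (hab : a ≠ b) : ccwAngle v a b < 2 * π := by
  refine (ccwAngle_le v a b).lt_of_ne fun h => ?_
  have key : ∀ a b, B.Adj v a → B.Adj v b → a ≠ b → b = polar v a 0 ‖b - v‖ →
      ‖b - v‖ ≤ ‖a - v‖ → False := by
    intro a b ha hb hab h hle
    refine hB.not_mem_segment (B.edge_vert hb.symm) ha hb.ne.symm hab.symm ?_
    have hn : 0 < ‖a - v‖ := norm_pos_iff.2 (sub_ne_zero.2 ha.ne.symm)
    refine ⟨1 - ‖b - v‖ / ‖a - v‖, ‖b - v‖ / ‖a - v‖, ?_, by positivity, by ring, ?_⟩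
    · rw [sub_nonneg, div_le_one hn]; exact hle
    · conv_rhs => rw [h]
      have hnC : (‖a - v‖ : ℂ) ≠ 0 := by exact_mod_cast hn.ne'
      simp only [polar, unitDir, Complex.real_smul]
      push_cast
      simp only [zero_mul, Complex.exp_zero]
      field_simp
      ring
  have h1 := eq_ray_of_ccwAngle_eq ha.ne.symm h
  rcases le_total ‖b - v‖ ‖a - v‖ with hle | hle
  · exact key a b ha hb hab h1 hle
  · refine key b a hb ha hab.symm ?_ hle
    have hn : 0 < ‖b - v‖ := norm_pos_iff.2 (sub_ne_zero.2 hb.ne.symm)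
    have hdir : unitDir v b = unitDir v a := by
      conv_lhs => rw [h1]
      rw [unitDir_polar ha.ne.symm hn]; simp
    conv_lhs => rw [← polar_zero_norm v a]
    rw [polar, polar, hdir]

/-- Every plane graph with gates that point in directions different from those of the edges has
layouts with arbitrarily small `ε`. -/
theorem exists_layout {r : ℕ} {G B : GeomGraph} {P f : Fin r → ℂ} (hle : G ≤ B)
    (hverts : B.verts = G.verts) (hB : B.IsPlanar) (hP : ∀ t, P t ∈ B.verts)
    (hinj : Function.Injective P) (hf : ∀ t, f t ≠ P t)
    (hgate : ∀ t w, B.Adj (P t) w → ccwAngle (P t) w (f t) < 2 * π ∧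
      ccwAngle (P t) (f t) w < 2 * π) :
    ∃ δ, ∃ ε₀ > 0, ∀ ε, 0 < ε → ε < ε₀ → Layout G B P f δ ε := by
  have hne : ∀ v, ∀ x ∈ rays B P f v, x ≠ v := by
    rintro v x (hx | ⟨t, rfl, rfl⟩)
    · exact hx.ne.symm
    · exact hf t
  have hmem : ∀ v, ∀ x ∈ rays B P f v, v ∈ B.verts ∧ x ∈ B.verts ∪ Set.range f := by
    rintro v x (hx | ⟨t, rfl, rfl⟩)
    · exact ⟨B.edge_vert hx, Or.inl (B.edge_vert hx.symm)⟩
    · exact ⟨hP t, Or.inr ⟨t, rfl⟩⟩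
  have hT : (B.verts ∪ Set.range f).Finite := hB.finite.union (Set.finite_range f)
  obtain ⟨ρ, hρ, hρ'⟩ := exists_pos_le_of_finite (hB.finite.prod (hT.prod hT))
    (g := fun x => ccwAngle x.1 x.2.1 x.2.2) (fun x _ => ccwAngle_pos _ _ _)
  obtain ⟨η, hη, hη'⟩ := exists_separation hB.finite
  refine ⟨min (ρ / 4) (π / 3), η / 40, by positivity, fun ε hε hε' => ?_⟩
  have hπ := Real.pi_pos
  refine ⟨hle, hverts, hP, hinj, ?_, by positivity, min_le_right _ _, ?_, hε, ?_, ?_, ?_⟩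
  · intro t h
    have := (hgate t _ h).2
    rw [ccwAngle_self (hf t)] at this
    exact lt_irrefl _ this
  · intro v
    refine ⟨hne v, fun a ha b hb => ?_, fun a ha b hb hab => ?_⟩
    · have h1 : ρ ≤ ccwAngle v a b :=
        hρ' (v, a, b) ⟨(hmem v a ha).1, (hmem v a ha).2, (hmem v b hb).2⟩
      have h2 := min_le_left (ρ / 4) (π / 3)
      linarith
    · rcases ha with ha | ⟨t, rfl, rfl⟩
      · rcases hb with hb | ⟨t, rfl, rfl⟩
        · exact hB.ccwAngle_lt ha hb hab
        · exact (hgate t a ha).1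
      · rcases hb with hb | ⟨t', e, rfl⟩
        · exact (hgate t b hb).2
        · exact absurd (by rw [hinj e]) hab
  · intro v hv w hw hvw
    have := hη' v hv v hv w hw w hw (by simpa using hvw) v (left_mem_segment ℝ v v) w
      (left_mem_segment ℝ w w)
    linarith
  · intro v hv x y hxy h1 h2 z hz
    have := hη' v hv v hv x (B.edge_vert hxy) y (B.edge_vert hxy.symm) (by
      simpa using hB.not_mem_segment hv hxy h1 h2) v (left_mem_segment ℝ v v) z hz
    linarith
  · intro u v x y huv hxy h1 h2 h3 h4 z hz z' hz'
    have := hη' u (B.edge_vert huv) v (B.edge_vert huv.symm) x (B.edge_vert hxy) y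
      (B.edge_vert hxy.symm) (hB.disjoint_segment huv hxy h1 h2 h3 h4) z hz z' hz'
    linarith

/-! ### The tour along the outer face -/

/-- Connected sets that avoid the graph do not leave the outer face. -/
lemma mem_outerFace_of_isPreconnected {C : GeomGraph} {S : Set ℂ} (hS : IsPreconnected S)
    (hSC : S ⊆ C.pointSetᶜ) {x y : ℂ} (hx : x ∈ S) (hy : y ∈ S) (h : x ∈ C.outerFace) :
    y ∈ C.outerFace := by
  refine ⟨hSC hy, ?_⟩
  rw [← connectedComponentIn_eq (hS.subset_connectedComponentIn hx hSC hy)]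
  exact h.2

/-- The midpoint of a strip is one of the points by which `IsOuterDart` is tested. -/
lemma strip_midpoint {δ s : ℝ} {u v : ℂ} (huv : v ≠ u) :
    (u + v) / 2 - ((s * Real.sin δ / ‖v - u‖ : ℝ) : ℂ) * (I * (v - u)) ∈
      segment ℝ (polar u v (-δ) s) (polar v u δ s) := by
  refine ⟨1 / 2, 1 / 2, by norm_num, by norm_num, by norm_num, ?_⟩
  have hn : (‖v - u‖ : ℂ) ≠ 0 := by exact_mod_cast norm_ne_zero_iff.2 (sub_ne_zero.2 huv)
  rw [polar_eq_cos_sin, polar_eq_cos_sin, unitDir_swap u v, Real.cos_neg, Real.sin_neg, unitDir]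
  simp only [Complex.real_smul]
  push_cast
  field_simp
  ring

/-- At a vertex entered along an edge with the outer face on its right, the edge that follows
counterclockwise again has the outer face on its right: a strip, an arc and another strip of a
track close to the graph lead from one edge to the other. -/
lemma IsOuterDart.succ {C : GeomGraph} (hC : C.IsPlanar) {u v n : ℂ} (h : C.IsOuterDart u v)
    (hs : C.IsCcwSucc v u n) : C.IsOuterDart v n := by
  obtain ⟨δ, ε₀, hε₀, hL⟩ := exists_layout (G := C) (B := C) (P := (Fin.elim0 : Fin 0 → ℂ))
    (f := Fin.elim0) le_rfl rfl hC (fun t => t.elim0) (fun t => t.elim0) (fun t => t.elim0)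
    (fun t => t.elim0)
  obtain ⟨huv, εd, hεd, hd⟩ := h
  have hvn := hs.2.1
  have L₀ := hL (ε₀ / 2) (by linarith) (by linarith)
  have hsin : 0 < Real.sin δ :=
    Real.sin_pos_of_pos_of_lt_pi L₀.δ_pos (by linarith [L₀.δ_lt, Real.pi_pos])
  have hl1 : 0 < ‖v - u‖ := norm_pos_iff.2 (sub_ne_zero.2 huv.ne.symm)
  have hl2 : 0 < ‖n - v‖ := norm_pos_iff.2 (sub_ne_zero.2 hvn.ne.symm)
  have hk : 0 < 10 + 8 * height 0 := by linarith [height_ge 0]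
  set k := 10 + 8 * height 0
  refine ⟨hvn, min (ε₀ * k * Real.sin δ / ‖n - v‖) (εd * ‖v - u‖ / ‖n - v‖), by positivity,
    fun t ht ht' => ?_⟩
  -- the level at which the strip along `vn` contains the given point
  set ε := t * ‖n - v‖ / (k * Real.sin δ) with hε
  have hε0 : 0 < ε := by positivity
  have hεlt : ε < ε₀ := by
    rw [hε, div_lt_iff₀ (by positivity), ← lt_div_iff₀ hl2, ← mul_assoc]
    exact ht'.trans_le (min_le_left _ _)
  have L := hL ε hε0 hεlt
  have HR : Ring C C ε 0 C (ε * k) := Ring.outer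
  have hsε : ε * k * Real.sin δ = t * ‖n - v‖ := by rw [hε]; field_simp
  have hstart : (u + v) / 2 - ((ε * k * Real.sin δ / ‖v - u‖ : ℝ) : ℂ) * (I * (v - u)) ∈
      C.outerFace := by
    apply hd
    · positivity
    · rw [hsε, div_lt_iff₀ hl1, ← lt_div_iff₀ hl2]
      exact ht'.trans_le (min_le_right _ _)
  have hstrip : ∀ x y, C.Adj x y →
      segment ℝ (polar x y (-δ) (ε * k)) (polar y x δ (ε * k)) ⊆ C.pointSetᶜ :=
    fun x y hxy z hz => L.strip_avoid HR hxy hz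
  have hsegpre : ∀ x y : ℂ, IsPreconnected (segment ℝ x y) :=
    fun x y => (convex_segment x y).isPreconnected
  have hcons : Consec (rays C (Fin.elim0 : Fin 0 → ℂ) Fin.elim0 v) v u n := by
    refine ⟨Or.inl hs.1, Or.inl hs.2.1, ?_⟩
    rintro z (hz | ⟨t, -⟩)
    · exact hs.2.2 z hz
    · exact t.elim0
  have hstep : ∀ j < 3, arcPt δ v u n (ε * k) j ∈ C.outerFace →
      arcPt δ v u n (ε * k) (j + 1) ∈ C.outerFace := fun j hj hin =>
    mem_outerFace_of_isPreconnected (hsegpre _ _)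
      (fun z hz => L.arc_avoid HR (C.edge_vert hvn) hcons hj hz) (left_mem_segment ℝ _ _)
      (right_mem_segment ℝ _ _) hin
  have h0 : arcPt δ v u n (ε * k) 0 ∈ C.outerFace := by
    rw [arcPt_zero]
    exact mem_outerFace_of_isPreconnected (hsegpre _ _) (hstrip u v huv)
      (strip_midpoint huv.ne.symm) (right_mem_segment ℝ _ _) hstart
  have h3 := hstep 2 (by norm_num) (hstep 1 (by norm_num) (hstep 0 (by norm_num) h0))
  rw [arcPt_three δ huv.ne hvn.ne.symm] at h3
  have h4 := mem_outerFace_of_isPreconnected (hsegpre _ _) (hstrip v n hvn)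
      (left_mem_segment ℝ _ _) (strip_midpoint hvn.ne.symm) h3
  rw [hsε, mul_div_assoc, div_self hl2.ne', mul_one] at h4
  exact h4

/-- The tour along the boundary of the outer face returns to the edge where it starts, after at
most `boundaryLength C` steps. -/
lemma exists_face_walk {C : GeomGraph} (hC : C.IsPlanar) {p v : ℂ} (h : C.IsOuterDart p v) :
    ∃ N, 0 < N ∧ N ≤ C.boundaryLength ∧ ∃ d : ℕ → ℂ × ℂ, d 0 = (p, v) ∧ d N = (p, v) ∧
      (∀ i, C.Adj (d i).1 (d i).2 ∧ (d (i + 1)).1 = (d i).2 ∧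
        C.IsCcwSucc (d i).2 (d i).1 (d (i + 1)).2) ∧
      ∀ i, 0 < i → i < N → d i ≠ (p, v) := by
  set D : Set (ℂ × ℂ) := {d | C.IsOuterDart d.1 d.2} with hD
  have hfin : D.Finite := (hC.finite.prod hC.finite).subset
    fun d hd => ⟨C.edge_vert hd.1, C.edge_vert hd.1.symm⟩
  have hsucc : ∀ d : D, ∃ n, C.IsCcwSucc d.1.2 d.1.1 n := fun d =>
    exists_consec (N := {w | C.Adj d.1.2 w}) (hC.finite.subset fun w hw => C.edge_vert hw.symm)
      d.2.1.symm
  choose n hn using hsucc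
  let F : D → D := fun d => ⟨(d.1.2, n d), IsOuterDart.succ hC d.2 (hn d)⟩
  have hF : Function.Injective F := by
    rintro ⟨⟨a, b⟩, hd⟩ ⟨⟨a', b'⟩, hd'⟩ he
    have e1 : b = b' := congrArg (fun d : D => d.1.1) he
    subst e1
    have e2 : n ⟨(a, b), hd⟩ = n ⟨(a', b), hd'⟩ := congrArg (fun d : D => d.1.2) he
    have hsp : Spread {w | C.Adj b w} b 0 :=
      ⟨fun x hx => hx.ne.symm, fun x hx y hy => by linarith [ccwAngle_pos b x y],
        fun x hx y hy hxy => hC.ccwAngle_lt hx hy hxy⟩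
    have h1 : Consec {w | C.Adj b w} b a _ := hn ⟨(a, b), hd⟩
    have h2 : Consec {w | C.Adj b w} b a' _ := hn ⟨(a', b), hd'⟩
    rw [← e2] at h2
    have := hsp.consec_left_unique h1 h2
    subst this
    rfl
  have : Finite D := hfin
  let _ : Fintype D := Fintype.ofFinite D
  let d₀ : D := ⟨(p, v), h⟩
  have hper : d₀ ∈ Function.periodicPts F := hF.mem_periodicPts d₀
  refine ⟨Function.minimalPeriod F d₀, Function.minimalPeriod_pos_of_mem_periodicPts hper, ?_,
    fun i => (F^[i] d₀).1, rfl, ?_, fun i => ⟨(F^[i] d₀).2.1, ?_, ?_⟩, fun i hi hi' he => ?_⟩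
  · refine Function.minimalPeriod_le_card.trans_eq ?_
    rw [boundaryLength, ← Nat.card_coe_set_eq, Nat.card_eq_fintype_card]
  · exact congrArg Subtype.val (Function.isPeriodicPt_minimalPeriod F d₀)
  · simp only [Function.iterate_succ_apply']; rfl
  · simp only [Function.iterate_succ_apply']; exact hn _
  · exact Function.not_isPeriodicPt_of_pos_of_lt_minimalPeriod hi.ne' hi' (Subtype.ext he)

/-! ### Routes along the tracks -/

/-- The `h`-th track contains a walk with at most `n` edges from `x` to `y`. -/
def Reach {r : ℕ} (G B : GeomGraph) (P f : Fin r → ℂ) (δ ε : ℝ) (h n : ℕ) (x y : ℂ) : Prop :=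
  ∃ p : (trackGraph G B P f δ ε h).Walk x y, p.length ≤ n

section Reach

variable {r : ℕ} {G B K : GeomGraph} {P f : Fin r → ℂ} {δ ε s : ℝ} {h n m : ℕ} {x y z : ℂ}

lemma Reach.trans (H : Reach G B P f δ ε h n x y) (H' : Reach G B P f δ ε h m y z) :
    Reach G B P f δ ε h (n + m) x z := by
  obtain ⟨p, hp⟩ := H
  obtain ⟨q, hq⟩ := H'
  exact ⟨p.append q, by rw [SimpleGraph.Walk.length_append]; omega⟩

lemma Reach.symm (H : Reach G B P f δ ε h n x y) : Reach G B P f δ ε h n y x := by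
  obtain ⟨p, hp⟩ := H
  exact ⟨p.reverse, by rwa [SimpleGraph.Walk.length_reverse]⟩

lemma Reach.mono (H : Reach G B P f δ ε h n x y) (hnm : n ≤ m) : Reach G B P f δ ε h m x y := by
  obtain ⟨p, hp⟩ := H
  exact ⟨p, hp.trans hnm⟩

lemma Track.reach (H : Track G B P f δ ε h x y) : Reach G B P f δ ε h 1 x y := by
  by_cases hxy : x = y
  · subst hxy
    exact ⟨.nil, by simp⟩
  · have : (trackGraph G B P f δ ε h).Adj x y := by
      rw [trackGraph, SimpleGraph.fromRel_adj]
      exact ⟨hxy, Or.inl H⟩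
    exact ⟨.cons this .nil, by simp⟩

lemma Ring.reach_strip {u v : ℂ} (H : Ring G B ε h K s) (huv : K.Adj u v) :
    Reach G B P f δ ε h 1 (polar u v (-δ) s) (polar v u δ s) :=
  (Track.strip u v H huv).reach

/-- A track of height at least `t` passes the `t`-th gate without touching its component. -/
lemma reach_pass {t : Fin r} (ht : (t : ℕ) ≤ h) :
    Reach G B P f δ ε h 1 (polar (P t) (f t) (-δ) (ε * (10 + 8 * height h)))
      (polar (P t) (f t) δ (ε * (10 + 8 * height h))) := by
  have := (Track.gate (G := G) (B := B) (P := P) (f := f) (δ := δ) (ε := ε) t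
    (GateSeg.pass ht)).reach
  rwa [gatePt_left, gatePt_right] at this

lemma reach_turn_left {t : Fin r} (ht : h < t) :
    Reach G B P f δ ε h 2 (polar (P t) (f t) (-δ) (ε * (10 + 8 * height h)))
      (polar (P t) (f t) (-δ) (ε * (10 - 8 * height h))) := by
  have h1 := (Track.gate (G := G) (B := B) (P := P) (f := f) (δ := δ) (ε := ε) t
    (GateSeg.outerLeft ht.le)).reach
  have h2 := (Track.gate (G := G) (B := B) (P := P) (f := f) (δ := δ) (ε := ε) t
    (GateSeg.innerLeft ht)).reach
  have := h1.trans h2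
  rwa [gatePt_left, gatePt_left] at this

lemma reach_turn_right {t : Fin r} (ht : h < t) :
    Reach G B P f δ ε h 2 (polar (P t) (f t) δ (ε * (10 + 8 * height h)))
      (polar (P t) (f t) δ (ε * (10 - 8 * height h))) := by
  have h1 := (Track.gate (G := G) (B := B) (P := P) (f := f) (δ := δ) (ε := ε) t
    (GateSeg.outerRight ht)).reach
  have h2 := (Track.gate (G := G) (B := B) (P := P) (f := f) (δ := δ) (ε := ε) t
    (GateSeg.innerRight ht)).reach
  have := h1.trans h2
  rwa [gatePt_right, gatePt_right] at this

lemma reach_start {t : Fin r} (ht : h = t) :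
    Reach G B P f δ ε h 2 (P t) (polar (P t) (f t) (-δ) (ε * (10 + 8 * height h))) := by
  have h1 := (Track.gate (G := G) (B := B) (P := P) (f := f) (δ := δ) (ε := ε) t
    (GateSeg.start ht)).reach
  have h2 := (Track.gate (G := G) (B := B) (P := P) (f := f) (δ := δ) (ε := ε) t
    (GateSeg.outerLeft ht.le)).reach.symm
  have := h1.trans h2
  rwa [gatePt_zero, gatePt_left] at this

lemma reach_finish {t : Fin r} (ht : h + 1 = t) :
    Reach G B P f δ ε h 2 (polar (P t) (f t) δ (ε * (10 + 8 * height h))) (P t) := by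
  have h1 := (Track.gate (G := G) (B := B) (P := P) (f := f) (δ := δ) (ε := ε) t
    (GateSeg.outerRight (show h < t by omega))).reach
  have h2 := (Track.gate (G := G) (B := B) (P := P) (f := f) (δ := δ) (ε := ε) t
    (GateSeg.finish ht)).reach.symm
  have := h1.trans h2
  rwa [gatePt_zero, gatePt_right] at this

variable (L : Layout G B P f δ ε)
include L

lemma Layout.reach_arc {v : ℂ} (H : Ring G B ε h K s) (hv : v ∈ B.verts)
    (hxy : Consec (rays K P f v) v x y) :
    Reach G B P f δ ε h 3 (polar v x δ s) (polar v y (-δ) s) := by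
  have hsp := L.spread_ring H v
  have h0 := (Track.arc (δ := δ) v x y 0 H hv hxy (by norm_num)).reach
  have h1 := (Track.arc (δ := δ) v x y 1 H hv hxy (by norm_num)).reach
  have h2 := (Track.arc (δ := δ) v x y 2 H hv hxy (by norm_num)).reach
  have := (h0.trans h1).trans h2
  rwa [arcPt_zero, arcPt_three δ (hsp.ne x hxy.1) (hsp.ne y hxy.2.1)] at this

lemma Layout.rays_gate (t : Fin r) :
    rays K P f (P t) = insert (f t) {w | K.Adj (P t) w} := by
  ext w
  constructor
  · rintro (hw | ⟨t', e, rfl⟩)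
    · exact Or.inr hw
    · rw [L.P_inj e]; exact Or.inl rfl
  · rintro (rfl | hw)
    · exact Or.inr ⟨t, rfl, rfl⟩
    · exact Or.inl hw

/-- From one side of the gate of a component `C` a track leads around `C` to the other side, at
the inner level. It follows the tour along the boundary of the outer face of `C`. -/
theorem Layout.reach_around {C : GeomGraph} {t : Fin r} {c : Corner} (hC : C.IsPlanar)
    (hCG : ∀ v ∈ C.verts, ∀ w, G.Adj v w ↔ C.Adj v w) (hCB : C.verts ⊆ B.verts)
    (hother : ∀ t', P t' ∈ C.verts → t' = t) (hc : C.IsCorner c) (hP : c.pt = P t)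
    (hf : c.Contains (f t)) :
    Reach G B P f δ ε h (4 * C.boundaryLength + 3)
      (polar (P t) (f t) δ (ε * (10 - 8 * height h)))
      (polar (P t) (f t) (-δ) (ε * (10 - 8 * height h))) := by
  have HR : Ring G B ε h G (ε * (10 - 8 * height h)) := Ring.inner
  set T := ε * (10 - 8 * height h)
  obtain ⟨p, v, n⟩ := c
  obtain rfl : v = P t := hP
  rcases hc with ⟨hd, hsucc⟩ | ⟨hv, -, -⟩
  · -- the attachment corner lies between the edges to `p` and `n`
    simp only at hd hsucc
    have hvC : P t ∈ C.verts := C.edge_vert hd.1.symm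
    have hset : ∀ v ∈ C.verts, {w | G.Adj v w} = {w | C.Adj v w} :=
      fun v hv => Set.ext fun w => hCG v hv w
    have hfsec : ccwAngle (P t) p (f t) < ccwAngle (P t) p n := by
      rcases hf.2 with e | e
      · exact absurd e hd.1.ne
      · exact e
    obtain ⟨N, hN, hNle, d, hd0, hdN, hdi, hdne⟩ := exists_face_walk hC hd
    have hsp : ∀ v ∈ C.verts, Spread {w | C.Adj v w} v δ := fun v hv =>
      (L.spread_ring HR v).mono (by rw [← hset v hv]; exact fun w hw => Or.inl hw)
    -- the start and the end of the strip along the `i`-th edge of the tour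
    let A : ℕ → ℂ := fun i => polar (d i).1 (d i).2 (-δ) T
    let E : ℕ → ℂ := fun i => polar (d i).2 (d i).1 δ T
    have hAE : ∀ i, Reach G B P f δ ε h 1 (A i) (E i) := fun i =>
      HR.reach_strip ((hCG _ (C.edge_vert (hdi i).1) _).2 (hdi i).1)
    have hfirst : Reach G B P f δ ε h 3 (polar (P t) (f t) δ T) (A 1) := by
      have h1 := hdi 0
      rw [hd0] at h1
      have hA : A 1 = polar (P t) (d 1).2 (-δ) T := by
        simp only [A]; rw [show (d 1).1 = P t from h1.2.1]
      rw [hA]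
      refine L.reach_arc HR (L.P_mem t) ?_
      rw [L.rays_gate, hset _ hvC]
      refine Consec.insert_right (hsp _ hvC).ne (L.gate_ne t) h1.2.2 ?_
      exact hfsec.trans_le (hsucc.2.2 _ h1.2.2.2.1)
    have hlast : Reach G B P f δ ε h 3 (E N) (polar (P t) (f t) (-δ) T) := by
      have hE : E N = polar (P t) p δ T := by simp only [E]; rw [hdN]
      rw [hE]
      refine L.reach_arc HR (L.P_mem t) ?_
      rw [L.rays_gate, hset _ hvC]
      exact Consec.insert_left hsucc hfsec
    have hEA : ∀ i, 0 < i → i < N → Reach G B P f δ ε h 3 (E i) (A (i + 1)) := by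
      intro i hi hiN
      have h1 := hdi i
      have hw : (d i).2 ∈ C.verts := C.edge_vert h1.1.symm
      have hA : A (i + 1) = polar (d i).2 (d (i + 1)).2 (-δ) T := by
        simp only [A]; rw [← h1.2.1]
      rw [hA]
      refine L.reach_arc HR (hCB hw) ?_
      by_cases hwt : (d i).2 = P t
      · rw [hwt, L.rays_gate, hset _ hvC]
        have h2 := h1.2.2
        rw [hwt] at h2
        refine Consec.insert_of_le h2 ?_
        by_contra hlt
        push Not at hlt
        have hn : 0 < ‖f t - P t‖ := norm_pos_iff.2 (sub_ne_zero.2 (L.gate_ne t))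
        have h3 := (hsp _ hvC).sector_unique h2 hsucc hn hn (ccwAngle_pos _ _ _) hlt
          (ccwAngle_pos _ _ _) hfsec
          ((eq_polar h2.1.ne.symm (f t)).symm.trans (eq_polar hsucc.1.ne.symm (f t)))
        exact hdne i hi hiN (Prod.ext h3.1 hwt)
      · have : rays G P f (d i).2 = {w | C.Adj (d i).2 w} := by
          rw [← hset _ hw]
          ext w
          refine ⟨?_, fun h => Or.inl h⟩
          rintro (h | ⟨t', e, -⟩)
          · exact h
          · have := hother t' (e ▸ hw)
            subst this
            exact absurd e.symm hwt
        rw [this]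
        exact h1.2.2
    have hmid : ∀ i, i < N → Reach G B P f δ ε h (4 * i + 1) (A 1) (E (i + 1)) := by
      intro i
      induction i with
      | zero => intro _; exact hAE 1
      | succ i ih =>
        intro hi
        exact (((ih (by omega)).trans (hEA (i + 1) (by omega) hi)).trans (hAE (i + 2))).mono
          (by omega)
    have h1 := hmid (N - 1) (by omega)
    rw [Nat.sub_add_cancel hN] at h1
    exact ((hfirst.trans h1).trans hlast).mono (by omega)
  · -- a component with a single vertex is surrounded by a single arc
    simp only at hv
    have hvC : P t ∈ C.verts := by rw [hv]; rfl
    have hemp : {w | G.Adj (P t) w} = ∅ := by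
      ext w
      simp only [Set.mem_ofPred_eq, Set.mem_empty_iff_false, iff_false]
      intro hw
      have hw' := (hCG _ hvC w).1 hw
      have : w ∈ C.verts := C.edge_vert hw'.symm
      rw [hv] at this
      exact hw'.ne this.symm
    refine (L.reach_arc HR (L.P_mem t) ?_).mono (by omega)
    rw [L.rays_gate, hemp]
    exact ⟨Or.inl rfl, Or.inl rfl, by rintro z (rfl | hz) <;> simp_all⟩

lemma Layout.reach_before_gate {t : Fin r} {p n : ℂ} (hpn : B.IsCcwSucc (P t) p n)
    (hf : ccwAngle (P t) p (f t) < ccwAngle (P t) p n) :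
    Reach G B P f δ ε h 3 (polar (P t) p δ (ε * (10 + 8 * height h)))
      (polar (P t) (f t) (-δ) (ε * (10 + 8 * height h))) := by
  refine L.reach_arc Ring.outer (L.P_mem t) ?_
  rw [L.rays_gate]
  exact Consec.insert_left hpn hf

lemma Layout.reach_after_gate {t : Fin r} {p n : ℂ} (hpn : B.IsCcwSucc (P t) p n)
    (hf : ccwAngle (P t) p (f t) < ccwAngle (P t) p n) :
    Reach G B P f δ ε h 3 (polar (P t) (f t) δ (ε * (10 + 8 * height h)))
      (polar (P t) n (-δ) (ε * (10 + 8 * height h))) := by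
  refine L.reach_arc Ring.outer (L.P_mem t) ?_
  rw [L.rays_gate]
  exact Consec.insert_right (fun z hz => SimpleGraph.Subgraph.Adj.ne hz |>.symm) (L.gate_ne t)
    hpn hf

/-- A track passes a corner without a gate by a single arc. -/
lemma Layout.reach_corner {v p n : ℂ} (hpn : B.IsCcwSucc v p n)
    (hf : ∀ t, P t = v → ccwAngle v p n ≤ ccwAngle v p (f t)) :
    Reach G B P f δ ε h 3 (polar v p δ (ε * (10 + 8 * height h)))
      (polar v n (-δ) (ε * (10 + 8 * height h))) := by
  refine L.reach_arc Ring.outer (B.edge_vert hpn.1) ⟨Or.inl hpn.1, Or.inl hpn.2.1, ?_⟩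
  rintro z (hz | ⟨t, e, rfl⟩)
  · exact hpn.2.2 z hz
  · exact hf t e

end Reach

section Route

variable {r : ℕ} {G B : GeomGraph} {P f : Fin r → ℂ} {δ ε : ℝ} {h m : ℕ}
  {g : Fin r → Corner} {φ : ℕ → Corner} {N : Fin r → ℕ}

open Classical in
/-- A bound for the number of edges by which a track passes the corner `c` of the big graph and
enters the next corner; `N t` is the length of the tour around the component that is attached at
the corner `g t`. -/
noncomputable def passLength (g : Fin r → Corner) (N : Fin r → ℕ) (c : Corner) : ℕ :=
  14 + 4 * ∑ t ∈ Finset.univ.filter (fun t => g t = c), N t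

variable (L : Layout G B P f δ ε)
  (hloop : ∀ h t, Reach G B P f δ ε h (4 * N t + 3)
    (polar (P t) (f t) δ (ε * (10 - 8 * height h)))
    (polar (P t) (f t) (-δ) (ε * (10 - 8 * height h))))
  (hgP : ∀ t, (g t).pt = P t)
  (hgf : ∀ t, ccwAngle (P t) (g t).prev (f t) < ccwAngle (P t) (g t).prev (g t).next)
  (hgs : ∀ t, B.IsCcwSucc (P t) (g t).prev (g t).next)

include hloop in
/-- Every track gets from the left side of a gate to the right side, possibly around the component
at the gate. -/
lemma reach_across_gate (h : ℕ) (t : Fin r) :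
    Reach G B P f δ ε h (4 * N t + 7) (polar (P t) (f t) (-δ) (ε * (10 + 8 * height h)))
      (polar (P t) (f t) δ (ε * (10 + 8 * height h))) := by
  rcases le_or_gt (t : ℕ) h with ht | ht
  · exact (reach_pass ht).mono (by omega)
  · exact (((reach_turn_left ht).trans (hloop h t).symm).trans (reach_turn_right ht).symm).mono
      (by omega)

include L hloop hgP hgf hgs in
/-- Every track passes every corner of the big graph at the outer level. -/
lemma Layout.reach_through {c : Corner} (hc : B.IsCcwSucc c.pt c.prev c.next) :
    Reach G B P f δ ε h (passLength g N c - 1)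
      (polar c.pt c.prev δ (ε * (10 + 8 * height h)))
      (polar c.pt c.next (-δ) (ε * (10 + 8 * height h))) := by
  classical
  by_cases hex : ∃ t, g t = c
  · obtain ⟨t, rfl⟩ := hex
    have hle : N t ≤ ∑ t' ∈ Finset.univ.filter (fun t' => g t' = g t), N t' :=
      Finset.single_le_sum (fun _ _ => Nat.zero_le _) (by simp)
    have h1 := L.reach_before_gate (h := h) (hgs t) (hgf t)
    have h2 := reach_across_gate hloop h t
    have h3 := L.reach_after_gate (h := h) (hgs t) (hgf t)
    rw [hgP t]
    refine ((h1.trans h2).trans h3).mono ?_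
    rw [passLength]
    omega
  · push Not at hex
    refine (L.reach_corner hc ?_).mono (by rw [passLength]; omega)
    intro t ht
    -- a gate inside the sector of the corner `c` would be attached at `c`
    by_contra hlt
    push Not at hlt
    have hgs' := hgs t
    have hgf' := hgf t
    have hft := L.gate_ne t
    rw [ht] at hgs' hgf' hft
    have hn : 0 < ‖f t - c.pt‖ := norm_pos_iff.2 (sub_ne_zero.2 hft)
    have hsp : Spread {w | B.Adj c.pt w} c.pt δ :=
      (L.spread c.pt).mono fun w hw => Or.inl hw
    have h3 := hsp.sector_unique hgs' hc hn hn (ccwAngle_pos _ _ _) hgf' (ccwAngle_pos _ _ _) hlt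
      ((eq_polar hgs'.1.ne.symm (f t)).symm.trans (eq_polar hc.1.ne.symm (f t)))
    apply hex t
    have h4 := (hgP t).trans ht
    rcases hgt : g t with ⟨p, v, n⟩
    rw [hgt] at h3 h4
    obtain ⟨p', v', n'⟩ := c
    simp only at h3 h4
    rw [h3.1, h3.2, h4]

variable (hφ : ∀ k ≤ m, B.IsCcwSucc (φ k).pt (φ k).prev (φ k).next)
  (hstep : ∀ k < m, (φ (k + 1)).prev = (φ k).pt ∧ (φ (k + 1)).pt = (φ k).next)

include L hloop hgP hgf hgs hφ hstep in
/-- A track follows the tour along the boundary of the outer face of the big graph. -/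
lemma Layout.reach_between {a b : ℕ} (hab : a < b) (hb : b ≤ m) :
    Reach G B P f δ ε h (1 + ∑ k ∈ Finset.Ioo a b, passLength g N (φ k))
      (polar (φ a).pt (φ a).next (-δ) (ε * (10 + 8 * height h)))
      (polar (φ b).pt (φ b).prev δ (ε * (10 + 8 * height h))) := by
  have hone : ∀ k < m, Reach G B P f δ ε h 1
      (polar (φ k).pt (φ k).next (-δ) (ε * (10 + 8 * height h)))
      (polar (φ (k + 1)).pt (φ (k + 1)).prev δ (ε * (10 + 8 * height h))) := by
    intro k hk
    rw [(hstep k hk).1, (hstep k hk).2]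
    exact Ring.outer.reach_strip (hφ k hk.le).2.1
  induction b, hab using Nat.le_induction with
  | base => exact (hone a hb).mono (by omega)
  | succ b hab ih =>
    have h1 := ih (by omega)
    have h2 := L.reach_through (h := h) hloop hgP hgf hgs (hφ b (by omega))
    refine ((h1.trans h2).trans (hone b hb)).mono ?_
    have hlt : a < b := hab
    have : Finset.Ioo a (b + 1) = insert b (Finset.Ioo a b) := by
      ext k; simp only [Finset.mem_Ioo, Finset.mem_insert]; omega
    rw [this, Finset.sum_insert (by simp)]
    have : 14 ≤ passLength g N (φ b) := by rw [passLength]; omega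
    omega

include L hloop hgP hgf hgs hφ hstep in
/-- The track of height `i` connects the `i`-th attachment vertex to the next one. -/
theorem Layout.reach_next {i j : Fin r} (hij : (i : ℕ) + 1 = j) {k l : ℕ} (hk : k ≤ m)
    (hl : l ≤ m) (hkl : k ≠ l) (hgi : φ k = g i) (hgj : φ l = g j) :
    Reach G B P f δ ε i (19 + 4 * N j +
      ∑ k' ∈ Finset.Ioo (min k l) (max k l), passLength g N (φ k')) (P i) (P j) := by
  have h1 : Reach G B P f δ ε i 2 _ _ := reach_start (t := i) rfl
  have h2 : Reach G B P f δ ε i 2 _ _ := reach_finish (t := j) hij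
  rcases lt_or_gt_of_ne hkl with hlt | hlt
  · have h3 := L.reach_between (h := i) hloop hgP hgf hgs hφ hstep hlt hl
    rw [hgi, hgj, hgP, hgP] at h3
    have h4 := L.reach_after_gate (h := i) (hgs i) (hgf i)
    have h5 := L.reach_before_gate (h := i) (hgs j) (hgf j)
    have h6 : Reach G B P f δ ε i 1 _ _ := reach_pass (t := i) le_rfl
    have h7 := reach_across_gate hloop i j
    rw [min_eq_left hlt.le, max_eq_right hlt.le]
    exact ((((((h1.trans h6).trans h4).trans h3).trans h5).trans h7).trans h2).mono (by omega)
  · have h3 := (L.reach_between (h := i) hloop hgP hgf hgs hφ hstep hlt hk).symm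
    rw [hgi, hgj, hgP, hgP] at h3
    have h4 := (L.reach_before_gate (h := i) (hgs i) (hgf i)).symm
    have h5 := (L.reach_after_gate (h := i) (hgs j) (hgf j)).symm
    rw [min_eq_right hlt.le, max_eq_left hlt.le]
    exact ((((h1.trans h4).trans h3).trans h5).trans h2).mono (by omega)

end Route

/-! ### The length of the tracks -/

/-- The length of a track is at most `20` times the cost of the corners it connects. Both of these
corners are among those whose component is counted twice in the cost, so after subtracting their
two components once the cost is at least the distance of the corners on the tour plus the sum of
the boundary lengths of all visited components. -/
lemma length_le_cost {r m : ℕ} {φ : ℕ → Corner} {C : Fin r → GeomGraph} {g : Fin r → Corner}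
    {i j : Fin r} (hij : i ≠ j) (hinj : Set.InjOn φ {k | k < m})
    (hi : tourIndex φ (g i) < m) (hj : tourIndex φ (g j) < m)
    (hgi : φ (tourIndex φ (g i)) = g i) (hgj : φ (tourIndex φ (g j)) = g j)
    (hne : tourIndex φ (g i) ≠ tourIndex φ (g j)) :
    ((19 + 4 * (C j).boundaryLength +
      ∑ k ∈ Finset.Ioo (min (tourIndex φ (g i)) (tourIndex φ (g j)))
        (max (tourIndex φ (g i)) (tourIndex φ (g j))),
        passLength g (fun t => (C t).boundaryLength) (φ k) : ℕ) : ℤ) + 1 ≤ 20 * cost φ C g i j := by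
  classical
  set k := tourIndex φ (g i) with hk
  set l := tourIndex φ (g j) with hl
  set A := visitedBetween φ g (g i) (g j) with hA
  have hmemA : ∀ t, t ∈ A ↔ ∃ k' ∈ Finset.uIcc k l, φ k' = g t := by
    intro t
    simp only [hA, visitedBetween, Finset.mem_filter, Finset.mem_univ, true_and, ← hk, ← hl]
  have hiA : i ∈ A := (hmemA i).2 ⟨k, Finset.left_mem_uIcc, hgi⟩
  have hjA : j ∈ A := (hmemA j).2 ⟨l, Finset.right_mem_uIcc, hgj⟩
  set n : Fin r → ℕ := fun t => (C t).boundaryLength with hn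
  -- the subtracted terms of the cost are at most half of the terms added for the components
  have hpair : n i + n j ≤ ∑ t ∈ A, n t := by
    rw [← Finset.sum_pair hij]
    exact Finset.sum_le_sum_of_subset (by
      intro t ht
      rcases Finset.mem_insert.1 ht with rfl | ht
      · exact hiA
      · rw [Finset.mem_singleton.1 ht]; exact hjA)
  -- different corners of the tour carry different components
  have hsum : ∑ k' ∈ Finset.Ioo (min k l) (max k l), ∑ t ∈ Finset.univ.filter
      (fun t => g t = φ k'), n t ≤ ∑ t ∈ A, n t := by
    rw [← Finset.sum_biUnion]
    · refine Finset.sum_le_sum_of_subset fun t ht => ?_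
      obtain ⟨k', hk', ht⟩ := Finset.mem_biUnion.1 ht
      refine (hmemA t).2 ⟨k', ?_, ((Finset.mem_filter.1 ht).2).symm⟩
      rw [Finset.uIcc, Finset.mem_Icc]
      have := Finset.mem_Ioo.1 hk'
      exact ⟨this.1.le, this.2.le⟩
    · intro k₁ hk₁ k₂ hk₂ hne'
      rw [Function.onFun, Finset.disjoint_left]
      intro t ht₁ ht₂
      have h1 := Finset.mem_Ioo.1 hk₁
      have h2 := Finset.mem_Ioo.1 hk₂
      have hmax : max k l < m := max_lt hi hj
      refine hne' (hinj (h1.2.trans hmax) (h2.2.trans hmax) ?_)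
      rw [← (Finset.mem_filter.1 ht₁).2, ← (Finset.mem_filter.1 ht₂).2]
  have hpass : ∑ k' ∈ Finset.Ioo (min k l) (max k l), passLength g n (φ k') =
      14 * (max k l - min k l - 1) + 4 * ∑ k' ∈ Finset.Ioo (min k l) (max k l),
        ∑ t ∈ Finset.univ.filter (fun t => g t = φ k'), n t := by
    simp only [passLength, Finset.sum_add_distrib, Finset.sum_const, Nat.card_Ioo,
      ← Finset.mul_sum, smul_eq_mul]
    ring
  have hcost : cost φ C g i j =
      ((Nat.dist k l : ℕ) : ℤ) + 2 * ((∑ t ∈ A, n t : ℕ) : ℤ) - n i - n j := by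
    rw [cost, tourDist, ← hk, ← hl, ← hA]
    push_cast
    rfl
  have hdist : Nat.dist k l = max k l - min k l := by
    rcases le_total k l with h | h
    · rw [Nat.dist_eq_sub_of_le h, max_eq_right h, min_eq_left h]
    · rw [Nat.dist_eq_sub_of_le_right h, max_eq_left h, min_eq_right h]
  have hpos : min k l < max k l := by
    rcases lt_or_gt_of_ne hne with h | h
    · rw [max_eq_right h.le, min_eq_left h.le]; exact h
    · rw [max_eq_left h.le, min_eq_right h.le]; exact h
  have hnj : (C j).boundaryLength = n j := rfl
  rw [hcost, hpass, hdist, hnj]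
  omega

/-! ### Concatenation of the tracks -/

/-- Paths from `P i` to `P (i + 1)` in graphs `T i` that have only the vertices `P i` in common
can be concatenated to a path; the `i`-th of them occupies the positions from `q i` to
`q (i + 1)`. -/
theorem exists_path_through {V : Type*} (T : ℕ → SimpleGraph V) (P : ℕ → V) (ℓ : ℕ → ℕ) (n : ℕ)
    (hP : ∀ i < n, P i ≠ P (i + 1))
    (hreach : ∀ i < n, ∃ p : (T i).Walk (P i) (P (i + 1)), p.length ≤ ℓ i)
    (hcommon : ∀ i < n, ∀ j < n, i ≠ j → ∀ x y z, (T i).Adj x y → (T j).Adj x z →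
      ∃ t, x = P t ∧ (i = t ∨ i + 1 = t) ∧ (j = t ∨ j + 1 = t)) :
    ∃ (R : (⊤ : SimpleGraph V).Walk (P 0) (P n)) (q : ℕ → ℕ), R.IsPath ∧ q 0 = 0 ∧
      q n = R.length ∧ (∀ i ≤ n, R.getVert (q i) = P i) ∧
      (∀ i < n, q i < q (i + 1) ∧ q (i + 1) ≤ q i + ℓ i ∧
        ∀ k, q i ≤ k → k < q (i + 1) → (T i).Adj (R.getVert k) (R.getVert (k + 1))) ∧
      (∀ x ∈ R.support, x = P n ∨ ∃ i < n, ∃ y, (T i).Adj x y) := by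
  classical
  induction n with
  | zero =>
    exact ⟨.nil, fun _ => 0, by simp, rfl, rfl, by simp, by simp, by simp⟩
  | succ n ih =>
    obtain ⟨R, q, hR, hq0, hqn, hqP, hqs, hsupp⟩ := ih (fun i hi => hP i (by omega))
      (fun i hi => hreach i (by omega)) (fun i hi j hj => hcommon i (by omega) j (by omega))
    obtain ⟨p', hp'⟩ := hreach n (by omega)
    set p := p'.bypass with hpdef
    have hp : p.IsPath := p'.bypass_isPath
    have hpl : p.length ≤ ℓ n := p'.length_bypass_le_length.trans hp'
    have hpn : 0 < p.length := by
      rw [Nat.pos_iff_ne_zero]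
      intro h0
      exact hP n (by omega) (SimpleGraph.Walk.eq_of_length_eq_zero h0)
    set pt : (⊤ : SimpleGraph V).Walk (P n) (P (n + 1)) := p.mapLe le_top with hpt
    have hptl : pt.length = p.length := by simp [hpt]
    have hptv : ∀ k, pt.getVert k = p.getVert k := by
      intro k; simp [hpt, SimpleGraph.Walk.mapLe]
    have hpadj : ∀ k < p.length, (T n).Adj (p.getVert k) (p.getVert (k + 1)) :=
      fun k hk => p.adj_getVert_succ hk
    have hpsupp : ∀ x ∈ p.support, ∃ y, (T n).Adj x y := by
      intro x hx
      obtain ⟨k, rfl, hk⟩ := SimpleGraph.Walk.mem_support_iff_exists_getVert.1 hx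
      rcases hk.lt_or_eq with hk | rfl
      · exact ⟨_, hpadj k hk⟩
      · have := hpadj (p.length - 1) (by omega)
        rw [Nat.sub_add_cancel hpn] at this
        exact ⟨_, this.symm⟩
    have hdisj : ∀ x ∈ R.support, x ∉ pt.support.tail := by
      intro x hx hx'
      have hx2 : x ∈ p.support.tail := by
        rwa [hpt, SimpleGraph.Walk.support_mapLe_eq_support] at hx'
      have hxn : x ≠ P n := by
        rintro rfl
        have := hp.support_nodup
        rw [← SimpleGraph.Walk.cons_tail_support] at this
        exact (List.nodup_cons.1 this).1 hx2
      obtain ⟨y, hy⟩ := hpsupp x (List.mem_of_mem_tail hx2)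
      obtain ⟨i, hi, z, hz⟩ := (hsupp x hx).resolve_left hxn
      obtain ⟨t, ht, h1, h2⟩ := hcommon i (by omega) n (by omega) hi.ne x z y hz hy
      have : t = n := by omega
      exact hxn (this ▸ ht)
    have hvert1 : ∀ k ≤ R.length, (R.append pt).getVert k = R.getVert k := by
      intro k hk
      rw [SimpleGraph.Walk.getVert_append]
      split_ifs with h
      · rfl
      · have : k = R.length := by omega
        rw [this, Nat.sub_self, SimpleGraph.Walk.getVert_zero, SimpleGraph.Walk.getVert_length]
    have hvert2 : ∀ k, (R.append pt).getVert (R.length + k) = p.getVert k := by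
      intro k
      rw [SimpleGraph.Walk.getVert_append, if_neg (by omega), Nat.add_sub_cancel_left, hptv]
    have hmono : ∀ i ≤ n, q i ≤ R.length := by
      have h : ∀ d ≤ n, q (n - d) ≤ q n := by
        intro d
        induction d with
        | zero => simp
        | succ d ih =>
          intro hd
          have h1 := (hqs (n - (d + 1)) (by omega)).1
          rw [show n - (d + 1) + 1 = n - d by omega] at h1
          exact h1.le.trans (ih (by omega))
      intro i hi
      have := h (n - i) (by omega)
      rwa [Nat.sub_sub_self hi, hqn] at this
    obtain ⟨q', hq1, hq2⟩ : ∃ q' : ℕ → ℕ, (∀ i ≤ n, q' i = q i) ∧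
        q' (n + 1) = R.length + p.length :=
      ⟨fun i => if i ≤ n then q i else R.length + p.length, fun i hi => if_pos hi,
        if_neg (by omega)⟩
    refine ⟨R.append pt, q', ?_, ?_, ?_, ?_, ?_, ?_⟩
    · rw [SimpleGraph.Walk.isPath_def, SimpleGraph.Walk.support_append, List.nodup_append']
      refine ⟨hR.support_nodup, ?_, fun x hx hx' => hdisj x hx hx'⟩
      rw [hpt, SimpleGraph.Walk.support_mapLe_eq_support]
      exact hp.support_nodup.tail
    · rw [hq1 0 (by omega), hq0]
    · rw [hq2, SimpleGraph.Walk.length_append, hptl]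
    · intro i hi
      rcases Nat.lt_or_ge n i with h | h
      · have : i = n + 1 := by omega
        subst this
        rw [hq2, hvert2, SimpleGraph.Walk.getVert_length]
      · rw [hq1 i h, hvert1 _ (hmono i h), hqP i h]
    · intro i hi
      rcases Nat.lt_or_ge i n with h | h
      · rw [hq1 i h.le, hq1 (i + 1) h]
        refine ⟨(hqs i h).1, (hqs i h).2.1, fun k hk hk' => ?_⟩
        have := hmono (i + 1) h
        rw [hvert1 _ (by omega), hvert1 _ (by omega)]
        exact (hqs i h).2.2 k hk hk'
      · have : i = n := by omega
        subst this
        rw [hq1 i le_rfl, hq2, hqn]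
        refine ⟨by omega, by omega, fun k hk hk' => ?_⟩
        obtain ⟨k, rfl⟩ := Nat.exists_eq_add_of_le hk
        rw [add_assoc, hvert2, hvert2]
        exact hpadj k (by omega)
    · intro x hx
      rw [SimpleGraph.Walk.mem_support_append_iff] at hx
      rcases hx with hx | hx
      · rcases hsupp x hx with rfl | ⟨i, hi, y, hy⟩
        · obtain ⟨y, hy⟩ := hpsupp (P n) p.start_mem_support
          exact Or.inr ⟨n, by omega, y, hy⟩
        · exact Or.inr ⟨i, by omega, y, hy⟩
      · rw [hpt, SimpleGraph.Walk.support_mapLe_eq_support] at hx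
        obtain ⟨y, hy⟩ := hpsupp x hx
        exact Or.inr ⟨n, by omega, y, hy⟩

/-! ### The directions of the tracks at a gate -/

section Gate

variable {r : ℕ} {G B : GeomGraph} {P f : Fin r → ℂ} {δ ε : ℝ}

/-- The coordinate of a gate point orthogonal to the axis of the gate, in gate coordinates and in
polar coordinates; its sign tells on which side of the axis the point lies. -/
lemma Layout.gate_im (L : Layout G B P f δ ε) {t : Fin r} {c : ℝ × ℝ} {φ σ : ℝ}
    (he : gatePt δ ε (P t) (f t) c = polar (P t) (f t) φ σ) :
    ε * (c.2 - c.1) * Real.sin δ = σ * Real.sin φ := by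
  rw [polar_eq_cos_sin, gatePt, add_assoc] at he
  simp only [Complex.exp_mul_I, ← Complex.ofReal_cos, ← Complex.ofReal_sin, Real.cos_neg,
    Real.sin_neg] at he
  have h1 := add_left_cancel he
  have h2 : ((ε : ℂ) * (((c.1 + c.2) * Real.cos δ : ℝ) + ((c.2 - c.1) * Real.sin δ : ℝ) * I)) *
      unitDir (P t) (f t) =
      ((σ * Real.cos φ : ℝ) + (σ * Real.sin φ : ℝ) * I) * unitDir (P t) (f t) := by
    push_cast at h1 ⊢
    linear_combination h1
  have h3 := congrArg Complex.im (mul_right_cancel₀ (unitDir_ne_zero (L.gate_ne t)) h2)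
  simp only [Complex.add_re, Complex.add_im, Complex.mul_re, Complex.mul_im, Complex.ofReal_re,
    Complex.ofReal_im, Complex.I_re, Complex.I_im, mul_zero, mul_one, sub_zero, add_zero,
    zero_add, zero_mul] at h3
  linarith

/-- The first point of the track that starts at a gate lies on the left side of the gate. -/
lemma Layout.exists_polar_start (L : Layout G B P f δ ε) (t : Fin r) (h : ℕ) :
    ∃ φ σ, gatePt δ ε (P t) (f t) (10, height h) = polar (P t) (f t) φ σ ∧ 0 < σ ∧ -δ ≤ φ ∧
      φ < 0 := by
  have h1 := height_ge h
  have h2 := height_lt h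
  have hδ := L.δ_pos
  have hε := L.ε_pos
  have hlt := L.δ_lt
  obtain ⟨φ, σ, e1, e2, -, e3, e4, -⟩ := exists_polar_gatePt (c := (10, height h)) L.δ_pos L.δ_lt
    L.ε_pos (L.gate_ne t) (by simp) (by simp; linarith) (by simp; linarith)
  refine ⟨φ, σ, e1, e2, e3, ?_⟩
  by_contra hge
  push Not at hge
  have hs : 0 ≤ Real.sin φ := Real.sin_nonneg_of_nonneg_of_le_pi hge (by linarith)
  have hs' : 0 < Real.sin δ := Real.sin_pos_of_pos_of_lt_pi hδ (by linarith)
  have := L.gate_im e1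
  simp only at this
  have h3 : 0 < ε * (10 - height h) * Real.sin δ := by
    have : 0 < 10 - height h := by linarith
    positivity
  nlinarith [mul_nonneg e2.le hs]

/-- The last point before the vertex, of the track that ends at a gate, lies on the right side of the
gate. -/
lemma Layout.exists_polar_finish (L : Layout G B P f δ ε) (t : Fin r) (h : ℕ) :
    ∃ φ σ, gatePt δ ε (P t) (f t) (height h, 10) = polar (P t) (f t) φ σ ∧ 0 < σ ∧ 0 < φ ∧
      φ ≤ δ := by
  have h1 := height_ge h
  have h2 := height_lt h
  have hδ := L.δ_pos
  have hε := L.ε_pos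
  have hlt := L.δ_lt
  obtain ⟨φ, σ, e1, e2, -, e3, e4, -⟩ := exists_polar_gatePt (c := (height h, 10)) L.δ_pos L.δ_lt
    L.ε_pos (L.gate_ne t) (by simp; linarith) (by simp) (by simp; linarith)
  refine ⟨φ, σ, e1, e2, ?_, e4⟩
  by_contra hle
  push Not at hle
  have hs : Real.sin φ ≤ 0 := Real.sin_nonpos_of_nonpos_of_neg_pi_le hle (by linarith)
  have hs' : 0 < Real.sin δ := Real.sin_pos_of_pos_of_lt_pi hδ (by linarith)
  have := L.gate_im e1
  simp only at this
  have h3 : 0 < ε * (10 - height h) * Real.sin δ := by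
    have : 0 < 10 - height h := by linarith
    positivity
  nlinarith [mul_nonneg e2.le (neg_nonneg.2 hs)]

end Gate

/-! ### Components and attachment corners -/

lemma IsComponent.adj_iff {G C : GeomGraph} (hC : G.IsComponent C) {v : ℂ} (hv : v ∈ C.verts)
    (w : ℂ) : G.Adj v w ↔ C.Adj v w := by
  refine ⟨fun h => ?_, fun h => hC.prop.1.2 h⟩
  have hadj : (⊤ : SimpleGraph ℂ).Adj v w := G.adj_sub h
  have hle : C ⊔ (⊤ : SimpleGraph ℂ).subgraphOfAdj hadj ≤ C := by
    refine hC.le_of_ge ⟨sup_le hC.prop.1 (SimpleGraph.subgraphOfAdj_le_of_adj G h), ?_⟩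
      le_sup_left
    exact SimpleGraph.Subgraph.connected_sup hC.prop.2.preconnected
      (SimpleGraph.Subgraph.subgraphOfAdj_connected hadj).preconnected ⟨v, hv, by simp⟩
  refine hle.2 ?_
  rw [SimpleGraph.Subgraph.sup_adj]
  exact Or.inr (by simp [SimpleGraph.subgraphOfAdj])

lemma IsComponent.eq_of_mem {G C C' : GeomGraph} (hC : G.IsComponent C) (hC' : G.IsComponent C')
    {v : ℂ} (hv : v ∈ C.verts) (hv' : v ∈ C'.verts) : C = C' := by
  have hcon : (C ⊔ C').Connected := 
    SimpleGraph.Subgraph.connected_sup hC.prop.2.preconnected hC'.prop.2.preconnected ⟨v, hv, hv'⟩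
  have hle : C ⊔ C' ≤ G := sup_le hC.prop.1 hC'.prop.1
  exact le_antisymm (le_sup_left.trans (hC'.le_of_ge ⟨hle, hcon⟩ le_sup_right))
    (le_sup_right.trans (hC.le_of_ge ⟨hle, hcon⟩ le_sup_left))

lemma IsCorner.mem_verts {C : GeomGraph} {c : Corner} (hc : C.IsCorner c) : c.pt ∈ C.verts := by
  rcases hc with ⟨h, -⟩ | ⟨h, -, -⟩
  · exact C.edge_vert h.1.symm
  · rw [h]; rfl

/-! ### The path through the attachment vertices -/

section Path

variable {r : ℕ} {G B : GeomGraph} {P f : Fin r → ℂ} {δ ε : ℝ}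

/-- The path that follows the `i`-th track from the `i`-th attachment vertex to the next one, for
every `i`. It leaves and enters the attachment vertices through their gates. -/
theorem Layout.exists_path (L : Layout G B P f δ ε) (hr : 0 < r) {ℓ : ℕ → ℕ}
    (hreach : ∀ i j : Fin r, (i : ℕ) + 1 = j → Reach G B P f δ ε i (ℓ i) (P i) (P j)) :
    ∃ (u v : ℂ) (R : (⊤ : SimpleGraph ℂ).Walk u v) (q : Fin r → ℕ),
      R.IsPath ∧ StrictMono q ∧ (∀ i, q i ≤ R.length ∧ R.getVert (q i) = P i) ∧
      (∀ i : Fin r, (i : ℕ) = 0 → q i = 0) ∧ (∀ i : Fin r, (i : ℕ) + 1 = r → q i = R.length) ∧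
      (∀ i j : Fin r, (i : ℕ) + 1 = j → q j ≤ q i + ℓ i) ∧
      (∀ k < R.length, ∃ h, (trackGraph G B P f δ ε h).Adj (R.getVert k) (R.getVert (k + 1))) ∧
      (∀ x ∈ R.support, (∃ t, x = P t) ∨ ∃ h y, (trackGraph G B P f δ ε h).Adj x y) ∧
      ∀ i, ∀ k ≤ R.length, R.getVert k = P i →
        (0 < k → R.getVert (k - 1) = gatePt δ ε (P i) (f i) (height (i - 1), 10)) ∧
        (k < R.length → R.getVert (k + 1) = gatePt δ ε (P i) (f i) (10, height i)) := by
  obtain ⟨n, rfl⟩ : ∃ n, r = n + 1 := ⟨r - 1, by omega⟩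
  have hlt : ∀ i, min i n < n + 1 := fun i => by omega
  obtain ⟨P', hP'⟩ : ∃ P' : ℕ → ℂ, ∀ i, P' i = P ⟨min i n, hlt i⟩ := ⟨_, fun _ => rfl⟩
  have hPP : ∀ i : Fin (n + 1), P' i = P i := by
    intro i
    rw [hP']
    congr 1
    ext
    simp only
    omega
  have hPP' : ∀ i (hi : i ≤ n), P' i = P ⟨i, by omega⟩ := fun i hi => hPP ⟨i, by omega⟩
  obtain ⟨R, q, hR, hq0, hqn, hqP, hqs, hsupp⟩ := exists_path_through (trackGraph G B P f δ ε) P'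
    ℓ n (fun i hi h => by
      rw [hPP' i hi.le, hPP' (i + 1) hi] at h
      have := congrArg Fin.val (L.P_inj h)
      simp at this)
    (fun i hi => by
      rw [hPP' i hi.le, hPP' (i + 1) hi]
      exact hreach ⟨i, by omega⟩ ⟨i + 1, by omega⟩ rfl)
    (fun i hi j hj hij x y z hy hz => by
      obtain ⟨t, rfl⟩ := L.common_vertex hij hy hz
      refine ⟨t, (hPP t).symm, ?_, ?_⟩
      · rcases L.trackGraph_at_gate hy with h | h
        · exact Or.inl h.1
        · exact Or.inr h.1
      · rcases L.trackGraph_at_gate hz with h | h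
        · exact Or.inl h.1
        · exact Or.inr h.1)
  have hmono : ∀ i j, i < j → j ≤ n → q i < q j := by
    intro i j hij
    induction j, hij using Nat.le_induction with
    | base => exact fun hj => (hqs i hj).1
    | succ j hij ih => exact fun hj => (ih (by omega)).trans (hqs j hj).1
  have hqle : ∀ i ≤ n, q i ≤ R.length := by
    intro i hi
    rcases hi.lt_or_eq with hi | rfl
    · exact hqn ▸ (hmono i n hi le_rfl).le
    · exact hqn.le
  have hstep : ∀ j ≤ n, ∀ k < q j, ∃ i < j, q i ≤ k ∧ k < q (i + 1) := by
    intro j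
    induction j with
    | zero => intro _ k hk; omega
    | succ j ih =>
      intro hj k hk
      rcases lt_or_ge k (q j) with h | h
      · obtain ⟨i, hi, h1⟩ := ih (by omega) k h
        exact ⟨i, by omega, h1⟩
      · exact ⟨j, by omega, h, hk⟩
  refine ⟨P' 0, P' n, R, fun i => q i, hR, ?_, ?_, ?_, ?_, ?_, ?_, ?_, ?_⟩
  · intro i j hij
    exact hmono i j hij (by omega)
  · intro i
    exact ⟨hqle i (by omega), (hqP i (by omega)).trans (hPP i)⟩
  · intro i hi
    simp only [hi, hq0]
  · intro i hi
    have : (i : ℕ) = n := by omega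
    simp only [this, hqn]
  · intro i j hij
    simp only [← hij]
    exact (hqs i (by omega)).2.1
  · intro k hk
    obtain ⟨i, hi, h1, h2⟩ := hstep n le_rfl k (hqn ▸ hk)
    exact ⟨i, (hqs i hi).2.2 k h1 h2⟩
  · intro x hx
    rcases hsupp x hx with rfl | ⟨i, hi, y, hy⟩
    · exact Or.inl ⟨_, hPP' n le_rfl⟩
    · exact Or.inr ⟨i, y, hy⟩
  · intro i k hk hki
    have hki' : k = q i := hR.getVert_injOn hk (hqle i (by omega))
      (hki.trans ((hqP i (by omega)).trans (hPP i)).symm)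
    subst hki'
    constructor
    · intro h0
      have hi : (i : ℕ) ≠ 0 := by
        intro h
        rw [h, hq0] at h0
        exact lt_irrefl _ h0
      have h1 := hqs (i - 1) (by omega)
      rw [Nat.sub_add_cancel (by omega)] at h1
      have h2 := h1.2.2 (q i - 1) (by omega) (by omega)
      rw [Nat.sub_add_cancel (by omega), hki] at h2
      rcases L.trackGraph_at_gate h2.symm with h | h
      · have := h.1
        omega
      · exact h.2
    · intro h0
      have hi : (i : ℕ) < n := by
        by_contra h
        have : (i : ℕ) = n := by omega
        rw [this, hqn] at h0
        exact lt_irrefl _ h0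
      have h2 := (hqs i hi).2.2 (q i) le_rfl (hqs i hi).1
      rw [hki] at h2
      rcases L.trackGraph_at_gate h2 with h | h
      · exact h.2
      · have := h.1
        omega

/-- A neighbour of the vertex `R.getVert k` on a path is the previous or the next vertex. -/
lemma _root_.SimpleGraph.Walk.IsPath.eq_of_toSubgraph_adj {V : Type*} {H : SimpleGraph V} {u v : V}
    {R : H.Walk u v} (hR : R.IsPath) {k : ℕ} (hk : k ≤ R.length) {x : V}
    (h : R.toSubgraph.Adj (R.getVert k) x) : x = R.getVert (k - 1) ∨ x = R.getVert (k + 1) := by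
  rw [SimpleGraph.Walk.toSubgraph_adj_iff] at h
  obtain ⟨i, he, hi⟩ := h
  rcases Sym2.eq_iff.1 he with ⟨h1, h2⟩ | ⟨h1, h2⟩
  · obtain rfl := hR.getVert_injOn hi.le hk h1
    exact Or.inr h2.symm
  · obtain rfl := hR.getVert_injOn (Nat.succ_le_of_lt hi) hk h2
    exact Or.inl h1.symm

/-- A counterclockwise turn at the vertex of a gate, from a point `x` on the left side of the gate to
a point `y` on the right side, does not pass an edge of the big graph. -/
lemma Layout.ccwAngle_le_of_adj (L : Layout G B P f δ ε) {t : Fin r} {x y z : ℂ} {φ φ' σ σ' : ℝ}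
    (hx : x = polar (P t) (f t) φ σ) (hσ : 0 < σ) (hφ : -δ ≤ φ) (hφ0 : φ < 0)
    (hy : y = polar (P t) (f t) φ' σ') (hσ' : 0 < σ') (hφ' : φ' ≤ δ) (hφ0' : 0 < φ')
    (hz : B.Adj (P t) z) : ccwAngle (P t) x y ≤ ccwAngle (P t) x z := by
  have hf := L.gate_ne t
  have hδ := L.δ_pos
  have hδ' := L.δ_lt
  have hpi := Real.pi_pos
  have hxne : x ≠ P t := hx ▸ polar_ne hf hσ
  have hS := L.spread (P t)
  have hmf : f t ∈ rays B P f (P t) := Or.inr ⟨t, rfl, rfl⟩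
  have hmz : z ∈ rays B P f (P t) := Or.inl hz
  have hfz : f t ≠ z := by
    rintro rfl
    exact L.gate_notAdj t hz
  have h1 := hS.le_angle _ hmf _ hmz
  have h2 := hS.le_angle _ hmz _ hmf
  have h3 := hS.angle_add_swap hmf hmz hfz
  have hzx : z = polar (P t) x (ccwAngle (P t) (f t) z - φ) ‖z - P t‖ := by
    rw [hx, polar_polar hf hσ, add_sub_cancel, ← eq_polar hf]
  have hyx : y = polar (P t) x (φ' - φ) σ' := by
    rw [hx, polar_polar hf hσ, add_sub_cancel, hy]
  have e1 : ccwAngle (P t) x y = φ' - φ := by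
    rw [hyx]
    exact ccwAngle_polar hxne hσ' (by linarith) (by linarith)
  have e2 : ccwAngle (P t) x z = ccwAngle (P t) (f t) z - φ := by
    conv_lhs => rw [hzx]
    exact ccwAngle_polar hxne (norm_pos_iff.2 (sub_ne_zero.2 hz.ne.symm)) (by linarith)
      (by linarith)
  rw [e1, e2]
  linarith

/-- The gate in the middle of a corner of the big graph stays in the sector of this corner. -/
lemma Layout.contains_of_polar (L : Layout G B P f δ ε) {t : Fin r} {c : Corner} {x : ℂ}
    {φ σ : ℝ} (hc : c.pt = P t) (hs : B.IsCcwSucc (P t) c.prev c.next)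
    (hf : f t = polar (P t) c.prev (ccwAngle (P t) c.prev c.next / 2) 1)
    (hx : x = polar (P t) (f t) φ σ) (hσ : 0 < σ) (hφ : |φ| ≤ δ) : c.Contains x := by
  have hp : c.prev ≠ P t := hs.1.ne.symm
  have h4 := (L.spread (P t)).le_angle _ (Or.inl hs.1) _ (Or.inl hs.2.1)
  have hle := ccwAngle_le (P t) c.prev c.next
  have hδ := L.δ_pos
  obtain ⟨h1, h2⟩ := abs_le.1 hφ
  rw [Corner.Contains, hc]
  have hxp : x = polar (P t) c.prev (ccwAngle (P t) c.prev c.next / 2 + φ) σ := by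
    rw [hx, hf, polar_polar hp one_pos]
  refine ⟨hxp ▸ polar_ne hp hσ, Or.inr ?_⟩
  rw [hxp, ccwAngle_polar hp hσ (by linarith) (by linarith)]
  linarith

end Path

lemma IsCorner.of_nontrivial {C : GeomGraph} {c : Corner} (hc : C.IsCorner c)
    (hn : C.verts.Nontrivial) : C.IsOuterDart c.prev c.pt ∧ C.IsCcwSucc c.pt c.prev c.next := by
  rcases hc with h | ⟨h, -⟩
  · exact h
  · rw [h] at hn
    exact absurd hn (Set.not_nontrivial_singleton)

/-- The direction in the middle of a corner does not belong to a neighbour. -/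
lemma IsCcwSucc.bisector {B : GeomGraph} {v x y w : ℂ}
    (hs : B.IsCcwSucc v x y) (hw : B.Adj v w) :
    ccwAngle v w (polar v x (ccwAngle v x y / 2) 1) < 2 * π ∧
      ccwAngle v (polar v x (ccwAngle v x y / 2) 1) w < 2 * π := by
  have hx : x ≠ v := hs.1.ne.symm
  have hwv : w ≠ v := hw.ne.symm
  have hpos := ccwAngle_pos v x y
  have hle := ccwAngle_le v x y
  have hf : polar v x (ccwAngle v x y / 2) 1 ≠ v := polar_ne hx one_pos
  have hxf : ccwAngle v x (polar v x (ccwAngle v x y / 2) 1) = ccwAngle v x y / 2 :=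
    ccwAngle_polar hx one_pos (by linarith) (by linarith)
  have hxw := hs.2.2 w hw
  have h1 := ccwAngle_add hx hwv hf
  have h2 := ccwAngle_add hx hf hwv
  have h3 := ccwAngle_le v x w
  rw [hxf] at h1 h2
  constructor
  · rcases h1 with h1 | h1 <;> linarith [ccwAngle_pos v x w]
  · rcases h2 with h2 | h2
    · linarith
    · linarith [ccwAngle_le v (polar v x (ccwAngle v x y / 2) 1) w]

lemma IsSplitBoundary.tourIndex_spec {B : GeomGraph} {b c : Corner} {φ : ℕ → Corner}
    (hφ : B.IsSplitBoundary b φ) (hc : B.IsCorner c) :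
    φ (tourIndex φ c) = c ∧ (0 < B.boundaryLength → tourIndex φ c < B.boundaryLength) := by
  obtain ⟨k, hk, hkc⟩ := (hφ.visits c).1 hc
  refine ⟨Nat.sInf_mem (s := {k | φ k = c}) ⟨k, hkc⟩, fun h0 => ?_⟩
  rcases hk.lt_or_eq with hk | rfl
  · exact (Nat.sInf_le hkc).trans_lt hk
  · -- the last corner of the split tour is also the first one
    have : φ 0 = c := by rw [hφ.start, ← hφ.finish, hkc]
    exact (Nat.sInf_le this).trans_lt h0

/-- The path of the theorem, with constant `20`, if there are at least two components. Then every
corner of the augmentation lies between two edges, so its sector has a bisector. -/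
theorem exists_path_of_two_le {G Gs : GeomGraph} {r : ℕ} {C : Fin r → GeomGraph}
    {a g : Fin r → Corner} {b : Fin r} {φ : ℕ → Corner} (hr : 2 ≤ r) (hG : G.IsPlanar)
    (hcomp : ∀ t, G.IsComponent (C t)) (hCinj : Function.Injective C)
    (ha : ∀ t, (C t).IsCorner (a t)) (hGs : G.IsConnectedAugmentation Gs)
    (hg : ∀ t, Gs.IsCorner (g t)) (hga : ∀ t, (g t).LiesIn (a t))
    (hφ : Gs.IsSplitBoundary (g b) φ) :
    ∃ (u v : ℂ) (R : (⊤ : SimpleGraph ℂ).Walk u v) (q : Fin r → ℕ),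
      R.IsPath ∧ StrictMono q ∧ (∀ i, q i ≤ R.length ∧ R.getVert (q i) = (a i).pt) ∧
      (∀ i : Fin r, (i : ℕ) = 0 → q i = 0) ∧ (∀ i : Fin r, (i : ℕ) + 1 = r → q i = R.length) ∧
      (∀ i, StaysInCorner R (a i)) ∧ IsPlanar (G ⊔ R.toSubgraph) ∧
      (∀ i, LiesRightOf G (C i) (a i) R) ∧
      ∀ i j : Fin r, (i : ℕ) + 1 = j → (q j : ℤ) - q i + 1 ≤ (20 : ℕ) * cost φ C g i j := by
  set P : Fin r → ℂ := fun t => (a t).pt with hPdef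
  have hPC : ∀ t, P t ∈ (C t).verts := fun t => (ha t).mem_verts
  have hother : ∀ t t', P t' ∈ (C t).verts → t' = t := fun t t' h =>
    hCinj ((hcomp t').eq_of_mem (hcomp t) (hPC t') h)
  have hPinj : Function.Injective P := fun t t' h => hother t' t (h ▸ hPC t')
  have hCG : ∀ t, C t ≤ G := fun t => (hcomp t).prop.1
  have hPB : ∀ t, P t ∈ Gs.verts := fun t => hGs.le.1 ((hCG t).1 (hPC t))
  have hgP : ∀ t, (g t).pt = P t := fun t => (hga t).1
  have hnt : Gs.verts.Nontrivial := ⟨P ⟨0, by omega⟩, hPB _, P ⟨1, by omega⟩, hPB _, fun h => by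
    have := congrArg Fin.val (hPinj h)
    simp at this⟩
  have hgs : ∀ t, Gs.IsCcwSucc (P t) (g t).prev (g t).next := fun t => by
    rw [← hgP]
    exact ((hg t).of_nontrivial hnt).2
  have hφs : ∀ k ≤ Gs.boundaryLength, Gs.IsCcwSucc (φ k).pt (φ k).prev (φ k).next := fun k hk =>
    (((hφ.visits _).2 ⟨k, hk, rfl⟩).of_nontrivial hnt).2
  -- the gates bisect the sectors of the attachment corners of the augmentation
  set f : Fin r → ℂ := fun t =>
    polar (P t) (g t).prev (ccwAngle (P t) (g t).prev (g t).next / 2) 1 with hfdef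
  have hprev : ∀ t, (g t).prev ≠ P t := fun t => (hgs t).1.ne.symm
  have hf : ∀ t, f t ≠ P t := fun t => polar_ne (hprev t) one_pos
  have hgf : ∀ t, ccwAngle (P t) (g t).prev (f t) < ccwAngle (P t) (g t).prev (g t).next := by
    intro t
    have h1 := ccwAngle_pos (P t) (g t).prev (g t).next
    have h2 := ccwAngle_le (P t) (g t).prev (g t).next
    rw [hfdef]
    simp only
    rw [ccwAngle_polar (hprev t) one_pos (by linarith) (by linarith)]
    linarith
  obtain ⟨δ, ε₀, hε₀, hL⟩ := exists_layout hGs.le hGs.verts_eq hGs.planar hPB hPinj hf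
    (fun t w hw => (hgs t).bisector hw)
  have L := hL (ε₀ / 2) (by linarith) (by linarith)
  set ε := ε₀ / 2
  have hgate : ∀ t x ψ σ, x = polar (P t) (f t) ψ σ → 0 < σ → |ψ| ≤ δ → (a t).Contains x :=
    fun t x ψ σ hx hσ hψ => (hga t).2 x
      (L.contains_of_polar (hgP t) (hgs t) rfl hx hσ hψ)
  set N : Fin r → ℕ := fun t => (C t).boundaryLength with hNdef
  have hloop : ∀ h t, Reach G Gs P f δ ε h (4 * N t + 3)
      (polar (P t) (f t) δ (ε * (10 - 8 * height h)))
      (polar (P t) (f t) (-δ) (ε * (10 - 8 * height h))) := fun h t =>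
    L.reach_around (hG.mono (hCG t)) (fun v hv w => (hcomp t).adj_iff hv w)
      ((hCG t).1.trans hGs.le.1) (hother t) (ha t) rfl
      (hgate t (f t) 0 ‖f t - P t‖ (polar_zero_norm _ _).symm
        (norm_pos_iff.2 (sub_ne_zero.2 (hf t))) (by rw [abs_zero]; exact L.δ_pos.le))
  have hgne : ∀ {i j : Fin r}, i ≠ j → g i ≠ g j := fun hij h => hij (hPinj (by
    rw [← hgP, ← hgP, h]))
  have hidx : ∀ t, φ (tourIndex φ (g t)) = g t := fun t => (hφ.tourIndex_spec (hg t)).1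
  have hm : 0 < Gs.boundaryLength := by
    by_contra h0
    have h0 : Gs.boundaryLength = 0 := by omega
    have : ∀ t, g t = φ 0 := fun t => by
      obtain ⟨k, hk, hkt⟩ := (hφ.visits _).1 (hg t)
      rw [← hkt, show k = 0 by omega]
    exact hgne (i := ⟨0, by omega⟩) (j := ⟨1, by omega⟩) (by simp) ((this _).trans (this _).symm)
  have hidxlt : ∀ t, tourIndex φ (g t) < Gs.boundaryLength := fun t =>
    (hφ.tourIndex_spec (hg t)).2 hm
  have hidxne : ∀ {i j : Fin r}, i ≠ j → tourIndex φ (g i) ≠ tourIndex φ (g j) := fun hij h =>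
    hgne hij (by rw [← hidx, h, hidx])
  obtain ⟨ℓ, hℓ⟩ : ∃ ℓ : ℕ → ℕ, ∀ i j : Fin r, (i : ℕ) + 1 = j → ℓ i = 19 + 4 * N j +
      ∑ k ∈ Finset.Ioo (min (tourIndex φ (g i)) (tourIndex φ (g j)))
        (max (tourIndex φ (g i)) (tourIndex φ (g j))), passLength g N (φ k) := by
    classical
    refine ⟨fun n => if h : n + 1 < r then 19 + 4 * N ⟨n + 1, h⟩ + ∑ k ∈ Finset.Ioo
      (min (tourIndex φ (g ⟨n, by omega⟩)) (tourIndex φ (g ⟨n + 1, h⟩)))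
        (max (tourIndex φ (g ⟨n, by omega⟩)) (tourIndex φ (g ⟨n + 1, h⟩))),
        passLength g N (φ k) else 0, ?_⟩
    rintro ⟨i, hi⟩ ⟨j, hj⟩ rfl
    exact dif_pos hj
  have hne : ∀ {i j : Fin r}, (i : ℕ) + 1 = j → i ≠ j := by
    rintro i j h rfl
    omega
  have hreach : ∀ i j : Fin r, (i : ℕ) + 1 = j → Reach G Gs P f δ ε i (ℓ i) (P i) (P j) := by
    intro i j hij
    rw [hℓ i j hij]
    exact L.reach_next hloop hgP hgf hgs hφs hφ.step hij (hidxlt i).le (hidxlt j).le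
      (hidxne (hne hij)) (hidx i) (hidx j)
  obtain ⟨u, v, R, q, hR, hq, hqP, hq0, hqr, hql, hRadj, hRsupp, hRgate⟩ :=
    L.exists_path (by omega) hreach
  have hsub : ∀ x y, R.toSubgraph.Adj x y → ∃ h, (trackGraph G Gs P f δ ε h).Adj x y := by
    intro x y hxy
    rw [SimpleGraph.Walk.toSubgraph_adj_iff] at hxy
    obtain ⟨k, he, hk⟩ := hxy
    obtain ⟨h, hh⟩ := hRadj k hk
    rcases Sym2.eq_iff.1 he with ⟨rfl, rfl⟩ | ⟨rfl, rfl⟩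
    · exact ⟨h, hh⟩
    · exact ⟨h, hh.symm⟩
  refine ⟨u, v, R, q, hR, hq, hqP, hq0, hqr, ?_, ?_, ?_, ?_⟩
  · intro t k hk hkt
    obtain ⟨h1, h2⟩ := hRgate t k hk hkt
    refine ⟨fun h => ?_, fun h => ?_⟩
    · obtain ⟨ψ, σ, e, hσ, h3, h4⟩ := L.exists_polar_finish t (t - 1)
      exact hgate t _ ψ σ ((h1 h).trans e) hσ (abs_le.2 ⟨by linarith [L.δ_pos], h4⟩)
    · obtain ⟨ψ, σ, e, hσ, h3, h4⟩ := L.exists_polar_start t t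
      exact hgate t _ ψ σ ((h2 h).trans e) hσ (abs_le.2 ⟨h3, by linarith [L.δ_pos]⟩)
  · refine L.isPlanar_sup hGs.planar ?_ hsub ?_
    · have : R.toSubgraph.verts = {x | x ∈ R.support} := by
        ext x; simp
      rw [this]
      exact List.finite_toSet _
    · intro x hx
      rcases hRsupp x (R.mem_verts_toSubgraph.1 hx) with ⟨t, rfl⟩ | hx
      · exact Or.inl ((hCG t).1 (hPC t))
      · exact Or.inr hx
  · intro t
    refine ⟨?_, ?_⟩
    · ext x
      simp only [Set.mem_ofPred_eq, Set.mem_singleton_iff]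
      constructor
      · rintro ⟨hx, hxR⟩
        rcases hRsupp x hxR with ⟨t', rfl⟩ | ⟨h, y, hy⟩
        · rw [hother t t' hx]
        · obtain ⟨t', rfl, -⟩ := L.trackGraph_avoid hy (left_mem_segment ℝ _ _)
            (Or.inl ((hCG t).1 hx))
          rw [hother t t' hx]
      · rintro rfl
        refine ⟨hPC t, ?_⟩
        have := R.getVert_mem_support (q t)
        rwa [(hqP t).2] at this
    · intro k h0 hk hkt
      obtain ⟨h1, h2⟩ := hRgate t k hk.le hkt
      obtain ⟨ψ, σ, e, hσ, h3, h4⟩ := L.exists_polar_finish t (t - 1)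
      obtain ⟨ψ', σ', e', hσ', h3', h4'⟩ := L.exists_polar_start t t
      have hadj1 : R.toSubgraph.Adj (P t) (R.getVert (k + 1)) := by
        have := R.toSubgraph_adj_getVert hk
        rwa [hkt] at this
      have hadj2 : R.toSubgraph.Adj (P t) (R.getVert (k - 1)) := by
        have := R.toSubgraph_adj_getVert (i := k - 1) (by omega)
        rw [Nat.sub_add_cancel h0, hkt] at this
        exact this.symm
      refine ⟨Or.inr hadj1, Or.inr hadj2, ?_⟩
      rintro x (hx | hx)
      · exact L.ccwAngle_le_of_adj ((h2 hk).trans e') hσ' h3' h4' ((h1 h0).trans e) hσ h4 h3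
          (hGs.le.2 hx)
      · have hx' : R.toSubgraph.Adj (R.getVert k) x := by rwa [hkt]
        rcases hR.eq_of_toSubgraph_adj hk.le hx' with rfl | rfl
        · exact le_rfl
        · rw [ccwAngle_self hadj1.ne.symm]
          exact ccwAngle_le _ _ _
  · intro i j hij
    have h1 := length_le_cost (C := C) (hne hij) hφ.injOn (hidxlt i) (hidxlt j) (hidx i) (hidx j)
      (hidxne (hne hij))
    have h2 := hql i j hij
    rw [hℓ i j hij] at h2
    have h3 : (q j : ℤ) ≤ q i + ((19 + 4 * N j +
      ∑ k ∈ Finset.Ioo (min (tourIndex φ (g i)) (tourIndex φ (g j)))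
        (max (tourIndex φ (g i)) (tourIndex φ (g j))), passLength g N (φ k) : ℕ) : ℤ) := by
      exact_mod_cast h2
    push_cast at h1 h3 ⊢
    linarith

end GeomGraph

theorem mainTheorem5 :
    ∃ c : ℕ, ∀ (G : GeomGraph) (r : ℕ) (C : Fin r → GeomGraph) (a : Fin r → GeomGraph.Corner)
      (Gs : GeomGraph) (g : Fin r → GeomGraph.Corner) (b : Fin r) (φ : ℕ → GeomGraph.Corner),
      G.IsPlanar →
      Set.BijOn C Set.univ {H | G.IsComponent H} →
      (∀ i, (C i).TouchesOuterFace G) →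
      (∀ i, (C i).IsCorner (a i)) →
      G.IsConnectedAugmentation Gs →
      (∀ i, Gs.IsCorner (g i) ∧ (g i).LiesIn (a i)) →
      Gs.IsSplitBoundary (g b) φ →
      ∃ (u v : ℂ) (R : (⊤ : SimpleGraph ℂ).Walk u v) (q : Fin r → ℕ),
        R.IsPath ∧
        StrictMono q ∧
        (∀ i, q i ≤ R.length ∧ R.getVert (q i) = (a i).pt) ∧
        (∀ i : Fin r, (i : ℕ) = 0 → q i = 0) ∧
        (∀ i : Fin r, (i : ℕ) + 1 = r → q i = R.length) ∧
        (∀ i, GeomGraph.StaysInCorner R (a i)) ∧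
        GeomGraph.IsPlanar (G ⊔ R.toSubgraph) ∧
        (∀ i, GeomGraph.LiesRightOf G (C i) (a i) R) ∧
        ∀ i j : Fin r, (i : ℕ) + 1 = j →
          (q j : ℤ) - q i + 1 ≤ c * GeomGraph.cost φ C g i j := by
  refine ⟨20, fun G r C a Gs g b φ hG hC _ ha hGs hg hφ => ?_⟩
  have hcomp : ∀ t, G.IsComponent (C t) := fun t => hC.mapsTo (Set.mem_univ t)
  rcases Nat.lt_or_ge r 2 with hr | hr
  · -- a single component: the path is its attachment vertex
    have hb : ∀ i : Fin r, i = b := fun i => Fin.ext (by omega)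
    have hmem : (a b).pt ∈ G.verts := (hcomp b).prop.1.1 (ha b).mem_verts
    refine ⟨(a b).pt, (a b).pt, .nil, fun _ => 0, .nil, ?_, ?_, ?_, ?_, ?_, ?_, ?_, ?_⟩
    · intro i j hij
      rw [hb i, hb j] at hij
      exact absurd hij (lt_irrefl _)
    · intro i
      rw [hb i]
      exact ⟨le_rfl, rfl⟩
    · exact fun _ _ => rfl
    · exact fun _ _ => rfl
    · intro i k hk _
      have hk0 : k = 0 := Nat.le_zero.1 hk
      subst hk0
      exact ⟨fun h => absurd h (lt_irrefl _), fun h => absurd h (lt_irrefl _)⟩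
    · have : (SimpleGraph.Walk.nil : (⊤ : SimpleGraph ℂ).Walk (a b).pt (a b).pt).toSubgraph ≤ G := by
        simpa using hmem
      rwa [sup_eq_left.2 this]
    · intro i
      rw [hb i]
      refine ⟨?_, fun k h0 hk => ?_⟩
      · ext x
        simp only [SimpleGraph.Walk.support_nil, List.mem_singleton, Set.mem_ofPred_eq,
          Set.mem_singleton_iff]
        exact ⟨fun h => h.2, fun h => ⟨h ▸ (ha b).mem_verts, h⟩⟩
      · rw [SimpleGraph.Walk.length_nil] at hk
        omega
    · intro i j hij
      rw [hb i, hb j] at hij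
      omega
  · exact GeomGraph.exists_path_of_two_le hr hG hcomp
      (Set.injOn_univ.1 hC.injOn) ha hGs (fun i => (hg i).1) (fun i => (hg i).2) hφ
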